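/- **Setting.** Let $\mathcal X\subseteq\mathbb R^d$ be compact and convex, $\mathcal X\subseteq\mathcal O$ with $\mathcal O$ open. Let $\varphi:\mathcal O\times\mathbb R^\ell\to\mathbb R$ be convex and $L_\varphi$-Lipschitz. Let $\varepsilon\in\mathbb R^\ell$ be a random vector with $\mathbb E[\varepsilon]=0$, $\mathrm{Cov}(\varepsilon)=\mathbb I_\ell$. Let $c:\mathcal O\to\mathbb R^\ell$ be $C^1$ with $L_c$-Lipschitz Jacobian, and let $Q(x)=(q_1(x)\ \cdots\ q_\ell(x))^\top$ be symmetric positive definite for $x\in\mathcal O$, with each $q_j:\mathcal O\to\mathbb R^\ell$ of class $C^1$ with $L_q$-Lipschitz Jacobian. Put $\xi(x)=c(x)+Q(x)\varepsilon$ with law $\mathbb P_\xi(x)$, $f(x)=\mathbb E[\varphi(x,\xi(x))]$, $\tau=L_\varphi(L_c+\ell L_q)$, $\Delta_0=\max_{x,y\in\mathcal X}(f(x)-f(y))$, $L=L_\varphi\bigl(1+\max_{x\in\mathcal X}(\|\nabla c(x)\|+\sqrt\ell\sqrt{\sum_j\|\nabla q_j(x)\|^2})\bigr)$ and $\mathrm{prox}_{\lambda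 f}(x)=\arg\min_{y\in\mathcal X}\{f(y)+\frac1{2\lambda}\|y-x\|^2\}$. **Oracles and estimators.** At a reference point $z\in\mathcal X$ an oracle supplies independent data sets $S=\{(X_i,\xi_i)\}_{i\le n}$ and $W=\{(Y_i,\eta_i)\}_{i\le m}$, each i.i.d. with $\xi_i\sim\mathbb P_\xi(X_i)$ and $\eta_i\sim\mathbb P_\xi(Y_i)$ given the predictors. The oracle is either *adaptive* ($X_i$ has a law $\mathcal M(\cdot\,;z,n)$ that may depend on $z$ and $n$ and is carried by $\mathcal O$, and $Y_i=z$) or *static* ($X_i,Y_i$ have one fixed law carried by $\mathcal X$). From $S$ one computes estimates $\widehat c_n(z)$, $\widehat\nabla c_n(z)$, $\widehat q_{j,n}(z)$, $\widehat\nabla q_{j,n}(z)$, with $\widehat Q_n(z)=(\widehat q_{1,n}(z)\ \cdots\ \widehat q_{\ell,n}(z))^\top$ almost surely invertible. Assume that for some $B$, $\|\varepsilon\|\le B$ a.s. and $\|\widehat c_n(z)\|\le B$ a.s. for all $n\ge1$, $z\in\mathcal X$, and that for some $r\in(0,1]$, $C>0$, for all $n\ge 1$, $z\in\mathcal X$,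 $j\le\ell$, the mean squared errors $\mathbb E\|\widehat c_n(z)-c(z)\|^2$, $\mathbb E\|\widehat\nabla c_n(z)-\nabla c(z)\|^2$, $\mathbb E\|\widehat Q_n(z)-Q(z)\|^2$, $\mathbb E\|\widehat\nabla q_{j,n}(z)-\nabla q_j(z)\|^2$ and $\mathbb E\|\widehat Q_n(z)^{-1}-Q(z)^{-1}\|^2$ are all at most $Cn^{-r}$ (operator norms for matrices). **Algorithm.** Start from $z^0\in\mathcal X$. For $t=0,\dots,T$, draw, given the past, data sets $S^t$, $W^t$ of sizes $n_t$, $m_t$ from the oracle at $z^t$, form the residuals $\widehat\varepsilon_i=\widehat Q_{n_t}(Y_i)^{-1}(\eta_i-\widehat c_{n_t}(Y_i))$, and let $z^{t+1}$ minimize over $x\in\mathcal X$ $$\frac1{m_t}\sum_{i=1}^{m_t}\Bigl[\varphi\bigl(x,\ \widehat c_{n_t}(z^t)+\widehat\nabla c_{n_t}(z^t)(x-z^t)+\widehat Q_{n_t}(z^t)\widehat\varepsilon_i+\widehat G_{n_t}(z^t,\widehat\varepsilon_i)(x-z^t)\bigr)+\frac{\alpha_t}2\|x-z^t\|^2\Bigr],$$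 where $\widehat G_n(z,\varepsilon)$ has rows $\varepsilon^\top\widehat\nabla q_{j,n}(z)$, $j\le\ell$. The output is $z^{t^*}$, where $t^*$ is drawn from a distribution $\{p_t\}_{t=0}^T$, independently of $z^0,\dots,z^T$. **Statement.** Let $\rho_t=\rho_0(t+1)^a$ and $\alpha_t=\alpha_0(t+1)^b$ with $0\le a\le b<1$, $\rho_0>\tau$ and $\alpha_0\ge\rho_0+\tau$. Then there is an integer $\bar t\ge0$ such that $$\rho_{t+1}(\rho_t-\tau)>\alpha_t(\rho_{t+1}-\rho_t)\qquad\text{for all }t\ge\bar t.\tag{$*$}$$ Fix any $\bar t$ satisfying $(*)$, let $m_t=\lceil m_0(t+1)^j\rceil$ and $n_t=\lceil n_0(t+1)^k\rceil$ with positive integers $m_0,n_0$ and real numbers $j>1+a-2b$, $k>2(1+a-b)/r$, and put $P_t=\frac{\rho_{t+1}(\rho_t-\tau)}{\alpha_t}-(\rho_{t+1}-\rho_t)$, and $p_t=0$ for $t<\bar t$, $p_t=P_t/\sum_{s=\bar t}^TP_s$ for $\bar t\le t\le T$. Then: 1. For every constant $\widetilde C>0$, the quantity $\Delta(T)=2\Delta_0+\sum_{t=\bar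 t}^T\frac{4\rho_{t+1}L^2}{m_t\alpha_t^2}+\sum_{t=\bar t}^T\frac{4\rho_{t+1}\widetilde C}{n_t^{r/2}\alpha_t}$ is bounded from above over all $T\ge\bar t$. 2. $p_t$ is approximately proportional to $(t+1)^{2a-b}$: there are $u_t>0$ ($t\ge\bar t$) with $u_t\to1$ as $t\to\infty$ such that for every $T\ge\bar t$ there is $\kappa_T>0$ with $p_t=\kappa_T\,u_t\,(t+1)^{2a-b}$ for $\bar t\le t\le T$. 3. There is a constant $K$, independent of $T$, of $z^0$ and of the run of the algorithm, such that for every $T\ge\bar t$ the output $z^{t^*}$ satisfies, with $\widehat z^{\,t}=\mathrm{prox}_{f/\rho_t}(z^t)$, $$\mathbb E\bigl[\|z^{t^*}-\widehat z^{\,t^*}\|^2\bigr]\le\frac K{(T+1)^{1+2a-b}},\qquad \mathbb E[\rho_{t^*}^2]\;\mathbb E\bigl[\|z^{t^*}-\widehat z^{\,t^*}\|^2\bigr]\le\frac K{(T+1)^{1-b}}.$$ -/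

import Mathlib

open MeasureTheory ProbabilityTheory Filter Topology

noncomputable section

namespace ALS

/-- The Euclidean space `ℝ^k` with the `ℓ₂`-norm. -/
abbrev Vec (k : ℕ) := EuclideanSpace ℝ (Fin k)

/-- A single observation `(X, ξ)`: a predictor (decision) and a response. -/
abbrev Obs (d l : ℕ) := Vec d × Vec l

/-! ### Linear algebra -/

/-- The matrix whose `j`-th row is `v j`. -/
def rows {l : ℕ} (v : Fin l → Vec l) : Matrix (Fin l) (Fin l) ℝ :=
  Matrix.of fun j k => v j k

/-- Matrix-vector product on Euclidean space. -/
def act {l : ℕ} (A : Matrix (Fin l) (Fin l) ℝ) (v : Vec l) : Vec l :=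
  WithLp.toLp 2 (A.mulVec v.ofLp)

/-- The matrix norm induced by the `ℓ₂`-norm, as an extended nonnegative real. -/
def opENorm {l : ℕ} (A : Matrix (Fin l) (Fin l) ℝ) : ENNReal :=
  ‖Matrix.toEuclideanCLM (n := Fin l) (𝕜 := ℝ) A‖ₑ

/-- `G(ε) h`, where `G(ε)` is the `l × d` matrix with rows `εᵀ D₁, …, εᵀ D_l` and `D_j` is the
Jacobian (or an estimate of it) of the `j`-th row of the square root covariance matrix. -/
def jacAct {d l : ℕ} (D : Fin l → Vec d →L[ℝ] Vec l) (e : Vec l) (h : Vec d) : Vec l :=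
  WithLp.toLp 2 fun j => inner ℝ e (D j h)

/-- `y` minimizes `g` over `X`. -/
def IsArgmin {d : ℕ} (X : Set (Vec d)) (g : Vec d → ℝ) (y : Vec d) : Prop :=
  y ∈ X ∧ ∀ x ∈ X, g y ≤ g x

/-! ### The stochastic program -/

/-- The data of the stochastic program with decision-dependent uncertainty: the feasible set `X`
inside `O`, the cost `φ`, the regression function `c`, the rows `q j` of the square root
covariance matrix `Q`, the law `Pε` of the error `ε`, and the Lipschitz constants of `φ`, of the
Jacobian of `c` and of the Jacobians of the `q j`. -/
structure Problem (d l : ℕ) where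
  X : Set (Vec d)
  O : Set (Vec d)
  φ : Vec d → Vec l → ℝ
  c : Vec d → Vec l
  q : Fin l → Vec d → Vec l
  Pε : Measure (Vec l)
  Lφ : ℝ
  Lc : ℝ
  Lq : ℝ

namespace Problem

variable {d l : ℕ} (P : Problem d l)

/-- The square root covariance matrix `Q(x)`, with rows `q j x`. -/
def Q (x : Vec d) : Matrix (Fin l) (Fin l) ℝ := rows fun j => P.q j x

/-- The response `c(x) + Q(x) ε` of the regression model. -/
def response (x : Vec d) (e : Vec l) : Vec l := P.c x + act (P.Q x) e

/-- The basic assumptions on the feasible set, the cost function and the regression model. -/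
structure Regular : Prop where
  isOpen_O : IsOpen P.O
  X_subset_O : P.X ⊆ P.O
  isCompact_X : IsCompact P.X
  convex_X : Convex ℝ P.X
  Lφ_nonneg : 0 ≤ P.Lφ
  Lc_nonneg : 0 ≤ P.Lc
  Lq_nonneg : 0 ≤ P.Lq
  /-- convexity of `φ` over `O × ℝ^l`; `O` itself need not be convex -/
  convex_φ : ∀ K ⊆ P.O, Convex ℝ K →
    ConvexOn ℝ (K ×ˢ (Set.univ : Set (Vec l))) (fun p => P.φ p.1 p.2)
  /-- Lipschitz continuity of `φ` for the Euclidean norm of `ℝ^d × ℝ^l` -/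
  lipschitz_φ : ∀ x ∈ P.O, ∀ y ∈ P.O, ∀ ξ η : Vec l,
    |P.φ x ξ - P.φ y η| ≤ P.Lφ * Real.sqrt (‖x - y‖ ^ 2 + ‖ξ - η‖ ^ 2)
  prob_ε : IsProbabilityMeasure P.Pε
  memLp_ε : MemLp (fun e : Vec l => e) 2 P.Pε
  mean_ε : ∫ e, e ∂P.Pε = 0
  cov_ε : ∀ i k : Fin l, ∫ e, e i * e k ∂P.Pε = if i = k then 1 else 0
  smooth_c : ContDiffOn ℝ 1 P.c P.O
  lipschitz_c : ∀ x ∈ P.O, ∀ y ∈ P.O,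
    ‖fderiv ℝ P.c x - fderiv ℝ P.c y‖ ≤ P.Lc * ‖x - y‖
  posDef_Q : ∀ x ∈ P.O, (P.Q x).PosDef
  smooth_q : ∀ j, ContDiffOn ℝ 1 (P.q j) P.O
  lipschitz_q : ∀ j, ∀ x ∈ P.O, ∀ y ∈ P.O,
    ‖fderiv ℝ (P.q j) x - fderiv ℝ (P.q j) y‖ ≤ P.Lq * ‖x - y‖

/-- The objective `f(x) = E[φ(x, c(x) + Q(x) ε)]`. -/
def f (x : Vec d) : ℝ := ∫ e, P.φ x (P.response x e) ∂P.Pε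

/-- The weak convexity modulus `τ = L_φ (L_c + l L_q)`. -/
def τ : ℝ := P.Lφ * (P.Lc + l * P.Lq)

/-- `prox_{λ f}(x)`, the minimizer over `X` of `f(y) + ‖y - x‖² / (2 λ)`. -/
def prox (lam : ℝ) (x : Vec d) : Vec d :=
  Classical.epsilon fun y => IsArgmin P.X (fun y => P.f y + 1 / (2 * lam) * ‖y - x‖ ^ 2) y

/-- `L = L_φ (1 + max_{x ∈ X} (‖∇c(x)‖ + √l √(∑_j ‖∇q_j(x)‖²)))`. -/
def L : ℝ :=
  P.Lφ * (1 + sSup ((fun x => ‖fderiv ℝ P.c x‖ +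
    Real.sqrt l * Real.sqrt (∑ j, ‖fderiv ℝ (P.q j) x‖ ^ 2)) '' P.X))

/-- `Δ₀ = max_{x, y ∈ X} (f(x) - f(y))`. -/
def Δ₀ : ℝ := sSup ((fun p : Vec d × Vec d => P.f p.1 - P.f p.2) '' (P.X ×ˢ P.X))

/-- The law of `(X, ξ)` when the predictor `X` has law `ν` and, given `X`, the response `ξ` has
the law of `c(X) + Q(X) ε`. -/
def obsLaw (ν : Measure (Vec d)) : Measure (Obs d l) :=
  (ν.prod P.Pε).map fun p => (p.1, P.response p.1 p.2)

end Problem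

/-! ### Simulation oracles -/

/-- A simulation oracle. The adaptive one draws the predictors of a data set of size `n` from a law
`M n z` that depends on the reference point `z`; the static one draws all predictors from one
fixed law. -/
inductive Oracle (d : ℕ) where
  | adaptive (M : ℕ → Kernel (Vec d) (Vec d))
  | static (ν : Measure (Vec d))

namespace Oracle

variable {d l : ℕ}

/-- The predictors have probability laws, carried by the region where the model lives. -/
def Valid (P : Problem d l) : Oracle d → Prop
  | adaptive M => ∀ n, IsMarkovKernel (M n) ∧ ∀ z ∈ P.X, M n z P.Oᶜ = 0
  | static ν => IsProbabilityMeasure ν ∧ ν P.Xᶜ = 0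

/-- The law of the predictors `X_i` of the learning data set `S` of size `n`. -/
def learnDesign (n : ℕ) (z : Vec d) : Oracle d → Measure (Vec d)
  | adaptive M => M n z
  | static ν => ν

/-- The law of the predictors `Y_i` of the residual data set `W`; with the adaptive oracle all of
them are the reference point. -/
def residDesign (z : Vec d) : Oracle d → Measure (Vec d)
  | adaptive _ => Measure.dirac z
  | static ν => ν

/-- The law of the data set `S = {(X_i, ξ_i)}_{i ∈ [n]}` at the reference point `z`. -/
def learnLaw (𝒪 : Oracle d) (P : Problem d l) (n : ℕ) (z : Vec d) :
    Measure (Fin n → Obs d l) :=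
  Measure.pi fun _ => P.obsLaw (𝒪.learnDesign n z)

/-- The law of the data set `W = {(Y_i, η_i)}_{i ∈ [m]}` at the reference point `z`. -/
def residLaw (𝒪 : Oracle d) (P : Problem d l) (m : ℕ) (z : Vec d) :
    Measure (Fin m → Obs d l) :=
  Measure.pi fun _ => P.obsLaw (𝒪.residDesign z)

/-- The joint law of the independent data sets `S` and `W` at the reference point `z`. -/
def dataLaw (𝒪 : Oracle d) (P : Problem d l) (n m : ℕ) (z : Vec d) :
    Measure ((Fin n → Obs d l) × (Fin m → Obs d l)) :=
  (𝒪.learnLaw P n z).prod (𝒪.residLaw P m z)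

end Oracle

/-! ### Statistical estimators -/

/-- Estimators, as functions of a data set of size `n` and of a point `z`: estimates of `c(z)`,
`∇c(z)`, `q_j(z)` and `∇q_j(z)`. -/
structure Estimators (d l : ℕ) where
  c : (n : ℕ) → (Fin n → Obs d l) → Vec d → Vec l
  dc : (n : ℕ) → (Fin n → Obs d l) → Vec d → (Vec d →L[ℝ] Vec l)
  q : Fin l → (n : ℕ) → (Fin n → Obs d l) → Vec d → Vec l
  dq : Fin l → (n : ℕ) → (Fin n → Obs d l) → Vec d → (Vec d →L[ℝ] Vec l)

namespace Estimators

variable {d l : ℕ} (est : Estimators d l)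

/-- The estimate of `Q(z)`. -/
def Q (n : ℕ) (s : Fin n → Obs d l) (z : Vec d) : Matrix (Fin l) (Fin l) ℝ :=
  rows fun j => est.q j n s z

/-- The estimators depend measurably on the data set and the point, and the estimated matrix
is almost surely invertible. -/
structure WellPosed (P : Problem d l) (𝒪 : Oracle d) : Prop where
  meas_c : ∀ n, Measurable fun p : (Fin n → Obs d l) × Vec d => est.c n p.1 p.2
  meas_dc : ∀ n, Measurable fun p : (Fin n → Obs d l) × Vec d => est.dc n p.1 p.2
  meas_q : ∀ j n, Measurable fun p : (Fin n → Obs d l) × Vec d => est.q j n p.1 p.2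
  meas_dq : ∀ j n, Measurable fun p : (Fin n → Obs d l) × Vec d => est.dq j n p.1 p.2
  invertible_Q : ∀ n, 0 < n → ∀ z ∈ P.X, ∀ᵐ s ∂𝒪.learnLaw P n z, IsUnit (est.Q n s z)

/-- The error and the estimates of `c` are almost surely bounded, uniformly. -/
structure Bounded (P : Problem d l) (𝒪 : Oracle d) (B : ℝ) : Prop where
  bdd_ε : ∀ᵐ e ∂P.Pε, ‖e‖ ≤ B
  bdd_c : ∀ n, 0 < n → ∀ z ∈ P.X, ∀ᵐ s ∂𝒪.learnLaw P n z, ‖est.c n s z‖ ≤ B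

/-- The mean squared errors at each point are at most `C n^{-r}`. -/
structure Rate (P : Problem d l) (𝒪 : Oracle d) (r C : ℝ) : Prop where
  mse_c : ∀ n : ℕ, 0 < n → ∀ z ∈ P.X,
    ∫⁻ s, ‖est.c n s z - P.c z‖ₑ ^ 2 ∂𝒪.learnLaw P n z ≤ ENNReal.ofReal (C * (n : ℝ) ^ (-r))
  mse_dc : ∀ n : ℕ, 0 < n → ∀ z ∈ P.X,
    ∫⁻ s, ‖est.dc n s z - fderiv ℝ P.c z‖ₑ ^ 2 ∂𝒪.learnLaw P n z
      ≤ ENNReal.ofReal (C * (n : ℝ) ^ (-r))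
  mse_Q : ∀ n : ℕ, 0 < n → ∀ z ∈ P.X,
    ∫⁻ s, opENorm (est.Q n s z - P.Q z) ^ 2 ∂𝒪.learnLaw P n z
      ≤ ENNReal.ofReal (C * (n : ℝ) ^ (-r))
  mse_dq : ∀ j, ∀ n : ℕ, 0 < n → ∀ z ∈ P.X,
    ∫⁻ s, ‖est.dq j n s z - fderiv ℝ (P.q j) z‖ₑ ^ 2 ∂𝒪.learnLaw P n z
      ≤ ENNReal.ofReal (C * (n : ℝ) ^ (-r))
  mse_Qinv : ∀ n : ℕ, 0 < n → ∀ z ∈ P.X,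
    ∫⁻ s, opENorm ((est.Q n s z)⁻¹ - (P.Q z)⁻¹) ^ 2 ∂𝒪.learnLaw P n z
      ≤ ENNReal.ofReal (C * (n : ℝ) ^ (-r))

/-- The empirical residual of the observation `(Y, η)`: the estimate of `Q(Y)`, inverted, times
`η` minus the estimate of `c(Y)`. -/
def residual (n : ℕ) (s : Fin n → Obs d l) (w : Obs d l) : Vec l :=
  act (est.Q n s w.1)⁻¹ (w.2 - est.c n s w.1)

/-- The learning-based surrogate function of `x` at the reference point `z`, for one residual. -/
def surrogate (P : Problem d l) (α : ℝ) (n : ℕ) (s : Fin n → Obs d l) (z : Vec d) (e : Vec l)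
    (x : Vec d) : ℝ :=
  P.φ x (est.c n s z + est.dc n s z (x - z) + act (est.Q n s z) e
      + jacAct (fun j => est.dq j n s z) e (x - z))
    + α / 2 * ‖x - z‖ ^ 2

/-- The learning-based mini-batch surrogate function of `x` at the reference point `z`. -/
def batchSurrogate (P : Problem d l) (α : ℝ) (n m : ℕ) (s : Fin n → Obs d l)
    (w : Fin m → Obs d l) (z x : Vec d) : ℝ :=
  1 / (m : ℝ) * ∑ i, est.surrogate P α n s z (est.residual n s (w i)) x

end Estimators

/-! ### The algorithm -/

/-- The iterations `t = 0, …, T` of the adaptive learning-based surrogate algorithm with sample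
sizes `n t`, `m t` and proximal parameters `α t`, on the probability space `(Ω, μ)`.
`ℱ t` contains the information available before the data sets of iteration `t` are drawn. -/
structure Run {d l : ℕ} (P : Problem d l) (𝒪 : Oracle d) (est : Estimators d l)
    (n m : ℕ → ℕ) (α : ℕ → ℝ) (T : ℕ) {Ω : Type*} [mΩ : MeasurableSpace Ω] (μ : Measure Ω) where
  ℱ : Filtration ℕ mΩ
  z : ℕ → Ω → Vec d
  S : (t : ℕ) → Ω → (Fin (n t) → Obs d l)
  W : (t : ℕ) → Ω → (Fin (m t) → Obs d l)
  z_init : ∃ x ∈ P.X, ∀ ω, z 0 ω = x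
  z_adapted : ∀ t ≤ T + 1, Measurable[ℱ t] (z t)
  S_adapted : ∀ t ≤ T, Measurable[ℱ (t + 1)] (S t)
  W_adapted : ∀ t ≤ T, Measurable[ℱ (t + 1)] (W t)
  /-- given the past, the data sets are drawn by the oracle at the reference point `z t` -/
  sampling : ∀ t ≤ T, ∀ D, MeasurableSet[ℱ t] D → ∀ A, MeasurableSet A →
    μ (D ∩ {ω | (S t ω, W t ω) ∈ A}) = ∫⁻ ω in D, 𝒪.dataLaw P (n t) (m t) (z t ω) A ∂μ
  /-- the next iterate minimizes the mini-batch surrogate function -/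
  step : ∀ t ≤ T, ∀ᵐ ω ∂μ,
    IsArgmin P.X (est.batchSurrogate P (α t) (n t) (m t) (S t ω) (W t ω) (z t ω)) (z (t + 1) ω)

/-! ### Parameters and averaging weights -/

/-- The polynomial parameter `p₀ (t + 1)^a`. -/
def power (p₀ a : ℝ) (t : ℕ) : ℝ := p₀ * ((t : ℝ) + 1) ^ a

/-- The sample size `⌈m₀ (t + 1)^j⌉`. -/
def batchSize (m₀ : ℕ) (j : ℝ) (t : ℕ) : ℕ := ⌈(m₀ : ℝ) * ((t : ℝ) + 1) ^ j⌉₊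

/-- The condition `ρ_{t+1} (ρ_t - τ) > α_t (ρ_{t+1} - ρ_t)` for all `t ≥ tbar`. -/
def StepCondition (τ : ℝ) (ρ α : ℕ → ℝ) (tbar : ℕ) : Prop :=
  ∀ t, tbar ≤ t → ρ (t + 1) * (ρ t - τ) > α t * (ρ (t + 1) - ρ t)

/-- `P_t = ρ_{t+1} (ρ_t - τ) / α_t - (ρ_{t+1} - ρ_t)`. -/
def weight (τ : ℝ) (ρ α : ℕ → ℝ) (t : ℕ) : ℝ :=
  ρ (t + 1) * (ρ t - τ) / α t - (ρ (t + 1) - ρ t)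

/-- The averaging distribution on `{0, …, T}`: `p_t = 0` for `t < tbar` and
`p_t = P_t / ∑_{s = tbar}^T P_s` for `tbar ≤ t ≤ T`. -/
def avgProb (τ : ℝ) (ρ α : ℕ → ℝ) (tbar T t : ℕ) : ℝ :=
  if tbar ≤ t ∧ t ≤ T then weight τ ρ α t / ∑ s ∈ Finset.Icc tbar T, weight τ ρ α s else 0

/-- `Δ(T) = 2 Δ₀ + ∑_{t = tbar}^T 4 ρ_{t+1} L² / (m_t α_t²)
+ ∑_{t = tbar}^T 4 ρ_{t+1} C / (n_t^{r/2} α_t)`. -/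
def errorBudget {d l : ℕ} (P : Problem d l) (r C : ℝ) (ρ α : ℕ → ℝ) (n m : ℕ → ℕ)
    (tbar T : ℕ) : ℝ :=
  2 * P.Δ₀
    + ∑ t ∈ Finset.Icc tbar T, 4 * ρ (t + 1) * P.L ^ 2 / ((m t : ℝ) * α t ^ 2)
    + ∑ t ∈ Finset.Icc tbar T, 4 * ρ (t + 1) * C / ((n t : ℝ) ^ (r / 2) * α t)

/-- `tstar` is drawn from the averaging distribution on `{0, …, T}`, independently of the
iterates `z^0, …, z^T`. -/
structure IsOutputIndex {d : ℕ} (τ : ℝ) (ρ α : ℕ → ℝ) (tbar T : ℕ) {Ω : Type*}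
    [MeasurableSpace Ω] (μ : Measure Ω) (z : ℕ → Ω → Vec d) (tstar : Ω → ℕ) : Prop where
  meas : Measurable tstar
  law : ∀ t, μ (tstar ⁻¹' {t}) = ENNReal.ofReal (avgProb τ ρ α tbar T t)
  indep : IndepFun tstar (fun ω (t : Fin (T + 1)) => z t ω) μ

end ALS

end

noncomputable section

namespace ALS

/-! ### Polynomial parameters -/

/-! The argument is a descent argument for the Moreau envelope of the weakly convex function `f`,
with two additive errors per iteration: one from sampling and one from estimation.

Deterministic core. The exact local model at `u` agrees with `f` at `u`, is convex, and stays within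
`τ/2 ‖x - u‖²` of `f` on `X` (`abs_f_sub_integral_model_le`). Hence `f + ρ/2 ‖· - z‖²` is strongly
convex with modulus `ρ - τ`, and its minimizer over `X`, the proximal point of `z`, is unique. Both
this function and the surrogate have quadratic growth at their minimizers. Adding the two growth
inequalities shows that a minimizer of the surrogate is closer to the proximal point of `z` than `z`
is, by the factor `(α + τ - ρ)/(α + ρ - τ)` in squared distance.

Sampling error. The surrogate averages over `m` samples, and its minimizer depends on them. A
regularized empirical minimizer is stable under replacement of one sample, so by exchangeability its
empirical value differs from its mean value by `O(1/(m α))` in expectation (`argmin_stability`,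
`integral_argmin_le`). No uniform law of large numbers is involved.

Estimation error. The estimated model differs from the exact one by a multiple of `U + V + U V`,
where `U` collects the errors at `z` and `V` those at the residual point. Both have second moments
`O(n^{-r})`. Weighting squares by `n^{r/2}` gives an expected error `O(n^{-r/2})`, with no
independence of `U` and `V`.

Summation. The proximal point of `z^t` is a competitor in the envelope of `z^{t+1}`. The contraction
then bounds `P_t/2` times the expected squared distance by the decrease of the expected envelope
plus errors (`weight_mul_le`). The envelope is bounded and the errors are summable for the
prescribed `j` and `k`, so the weighted sum is bounded in `T`. Since `P_t` is asymptotic to a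
multiple of `(t+1)^{2a-b}`, the sum of the weights grows at least like `(T+1)^{1+2a-b}`. Dividing
gives the first rate, and `ρ_{t*} ≤ ρ_T` gives the second. The constants in the recursion are cruder
than those in `errorBudget`, which is harmless because only summability of the same two series
matters. -/

lemma power_pos {p a : ℝ} (hp : 0 < p) (t : ℕ) : 0 < power p a t := by
  unfold power; positivity

lemma power_mono {p a : ℝ} (hp : 0 ≤ p) (ha : 0 ≤ a) {s t : ℕ} (h : s ≤ t) :
    power p a s ≤ power p a t := by
  unfold power
  gcongr

lemma power_succ_le {p a : ℝ} (hp : 0 ≤ p) (ha : 0 ≤ a) (t : ℕ) :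
    power p a (t + 1) ≤ p * 2 ^ a * ((t : ℝ) + 1) ^ a := by
  unfold power
  rw [mul_assoc, ← Real.mul_rpow (by norm_num) (by positivity)]
  push_cast
  gcongr
  nlinarith [(Nat.cast_nonneg t : (0 : ℝ) ≤ t)]

lemma tendsto_natCast_add_one_atTop : Tendsto (fun t : ℕ => (t : ℝ) + 1) atTop atTop :=
  tendsto_atTop_add_const_right _ _ tendsto_natCast_atTop_atTop

/-- The product term of the weight has order `a + a - b`, while the increment of `ρ` has order at
most `a - 1`. The latter is negligible because `b < 1 + a`. -/
lemma tendsto_weight_div {τ ρ₀ α₀ a b : ℝ} (hρ₀ : τ < ρ₀) (hρ : 0 < ρ₀) (hα : 0 < α₀)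
    (ha : 0 ≤ a) (hab : a ≤ b) (hb : b < 1) :
    ∃ κ₀ : ℝ, 0 < κ₀ ∧
      Tendsto (fun t : ℕ => weight τ (power ρ₀ a) (power α₀ b) t / ((t : ℝ) + 1) ^ (2 * a - b))
        atTop (𝓝 κ₀) := by
  -- The limit is different in the two cases: for `a = 0` the increment of `ρ` vanishes but `τ`
  -- survives, while for `a > 0` the growth of `ρ` makes `τ` negligible.
  rcases ha.eq_or_lt with rfl | ha
  · refine ⟨ρ₀ * (ρ₀ - τ) / α₀, by have := sub_pos.2 hρ₀; positivity, ?_⟩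
    refine tendsto_const_nhds.congr fun t => ?_
    have hx : (0 : ℝ) < (t : ℝ) + 1 := by positivity
    simp only [weight, power, Real.rpow_zero, mul_one, sub_self, sub_zero, mul_zero, zero_sub,
      Real.rpow_neg hx.le]
    have := Real.rpow_pos_of_pos hx b
    field_simp
  · refine ⟨ρ₀ ^ 2 / α₀, by positivity, ?_⟩
    have hlim1 : Tendsto (fun t : ℕ => ((t : ℝ) + 1) ^ (-a)) atTop (𝓝 0) :=
      (tendsto_rpow_neg_atTop ha).comp tendsto_natCast_add_one_atTop
    have hlim2 : Tendsto (fun t : ℕ => ((t : ℝ) + 1) ^ (-(1 + a - b))) atTop (𝓝 0) :=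
      (tendsto_rpow_neg_atTop (by linarith)).comp tendsto_natCast_add_one_atTop
    have hlim3 : Tendsto (fun t : ℕ => (1 + ((t : ℝ) + 1)⁻¹) ^ a) atTop (𝓝 1) := by
      have h1 : Tendsto (fun t : ℕ => 1 + ((t : ℝ) + 1)⁻¹) atTop (𝓝 (1 + 0)) :=
        tendsto_const_nhds.add (tendsto_inv_atTop_zero.comp tendsto_natCast_add_one_atTop)
      have := h1.rpow_const (p := a) (Or.inl (by norm_num))
      simpa using this
    -- This is the increment of `ρ`, rescaled. Bernoulli's inequality for an exponent in `[0, 1]`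
    -- bounds the first two factors by `a`, and the last factor tends to `0`.
    have hlim4 : Tendsto (fun t : ℕ => ((1 + ((t : ℝ) + 1)⁻¹) ^ a - 1) * ((t : ℝ) + 1)
        * ((t : ℝ) + 1) ^ (-(1 + a - b))) atTop (𝓝 0) := by
      have hup : Tendsto (fun t : ℕ => a * ((t : ℝ) + 1) ^ (-(1 + a - b))) atTop (𝓝 0) := by
        simpa using hlim2.const_mul a
      refine squeeze_zero (fun t => ?_) (fun t => ?_) hup
      · have : (1 : ℝ) ≤ (1 + ((t : ℝ) + 1)⁻¹) ^ a :=
          Real.one_le_rpow (by have : (0 : ℝ) ≤ ((t : ℝ) + 1)⁻¹ := by positivity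
                               linarith) ha.le
        have := sub_nonneg.2 this
        positivity
      · have hx : (0 : ℝ) < (t : ℝ) + 1 := by positivity
        have h1 := rpow_one_add_le_one_add_mul_self (s := ((t : ℝ) + 1)⁻¹) (p := a)
          (by have : (0 : ℝ) ≤ ((t : ℝ) + 1)⁻¹ := by positivity
              linarith) ha.le (by linarith)
        gcongr
        calc ((1 + ((t : ℝ) + 1)⁻¹) ^ a - 1) * ((t : ℝ) + 1)
            ≤ (a * ((t : ℝ) + 1)⁻¹) * ((t : ℝ) + 1) := by gcongr; linarith
          _ = a := by field_simp
    have hmain : Tendsto (fun t : ℕ => ρ₀ / α₀ * (1 + ((t : ℝ) + 1)⁻¹) ^ a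
          * (ρ₀ - τ * ((t : ℝ) + 1) ^ (-a))
        - ρ₀ * (((1 + ((t : ℝ) + 1)⁻¹) ^ a - 1) * ((t : ℝ) + 1)
        * ((t : ℝ) + 1) ^ (-(1 + a - b)))) atTop
        (𝓝 (ρ₀ / α₀ * 1 * (ρ₀ - τ * 0) - ρ₀ * 0)) :=
      ((hlim3.const_mul _).mul (tendsto_const_nhds.sub (hlim1.const_mul τ))).sub
        (hlim4.const_mul ρ₀)
    have heq : ρ₀ / α₀ * 1 * (ρ₀ - τ * 0) - ρ₀ * 0 = ρ₀ ^ 2 / α₀ := by ring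
    rw [heq] at hmain
    refine hmain.congr fun t => ?_
    have hx : (0 : ℝ) < (t : ℝ) + 1 := by positivity
    have hsucc : (((t + 1 : ℕ) : ℝ) + 1) ^ a
        = ((t : ℝ) + 1) ^ a * (1 + ((t : ℝ) + 1)⁻¹) ^ a := by
      rw [← Real.mul_rpow hx.le (by positivity)]
      congr 1
      push_cast
      field_simp
    simp only [weight, power, hsucc]
    generalize (1 + ((t : ℝ) + 1)⁻¹) ^ a = y
    have e1 : ((t : ℝ) + 1) ^ (-(1 + a - b))
        = ((t : ℝ) + 1) ^ b / (((t : ℝ) + 1) * ((t : ℝ) + 1) ^ a) := by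
      rw [show -(1 + a - b) = b - (1 + a) by ring, Real.rpow_sub hx, Real.rpow_add hx,
        Real.rpow_one]
    have e2 : ((t : ℝ) + 1) ^ (2 * a - b)
        = ((t : ℝ) + 1) ^ a * ((t : ℝ) + 1) ^ a / ((t : ℝ) + 1) ^ b := by
      rw [Real.rpow_sub hx, two_mul, Real.rpow_add hx]
    rw [e1, e2, Real.rpow_neg hx.le]
    have h1 := Real.rpow_pos_of_pos hx b
    have h2 := Real.rpow_pos_of_pos hx a
    field_simp

lemma stepCondition_iff_weight_pos {τ : ℝ} {ρ α : ℕ → ℝ} (hα : ∀ t, 0 < α t) (tbar : ℕ) :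
    StepCondition τ ρ α tbar ↔ ∀ t, tbar ≤ t → 0 < weight τ ρ α t := by
  refine forall₂_congr fun t _ => ?_
  rw [weight, sub_pos, lt_div_iff₀ (hα t), gt_iff_lt, mul_comm (α t)]

lemma exists_stepCondition {τ ρ₀ α₀ a b : ℝ} (hρ₀ : τ < ρ₀) (hρ : 0 < ρ₀) (hα : 0 < α₀)
    (ha : 0 ≤ a) (hab : a ≤ b) (hb : b < 1) :
    ∃ tbar, StepCondition τ (power ρ₀ a) (power α₀ b) tbar := by
  obtain ⟨κ₀, hκ₀, hlim⟩ := tendsto_weight_div hρ₀ hρ hα ha hab hb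
  obtain ⟨N, hN⟩ := eventually_atTop.1 (hlim.eventually (lt_mem_nhds hκ₀))
  refine ⟨N, (stepCondition_iff_weight_pos (power_pos hα) N).2 fun t ht => ?_⟩
  have hx : (0 : ℝ) < ((t : ℝ) + 1) ^ (2 * a - b) := by positivity
  exact (div_pos_iff_of_pos_right hx).1 (hN t ht)

/-- Beyond some index the ratio exceeds half its limit. The finitely many earlier ratios are
positive, so their minimum is positive. -/
lemma exists_lower_bound_weight {τ ρ₀ α₀ a b : ℝ} (hρ₀ : τ < ρ₀) (hρ : 0 < ρ₀) (hα : 0 < α₀)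
    (ha : 0 ≤ a) (hab : a ≤ b) (hb : b < 1) {tbar : ℕ}
    (hpos : ∀ t, tbar ≤ t → 0 < weight τ (power ρ₀ a) (power α₀ b) t) :
    ∃ c : ℝ, 0 < c ∧ ∀ t, tbar ≤ t →
      c * ((t : ℝ) + 1) ^ (2 * a - b) ≤ weight τ (power ρ₀ a) (power α₀ b) t := by
  obtain ⟨κ₀, hκ₀, hlim⟩ := tendsto_weight_div hρ₀ hρ hα ha hab hb
  obtain ⟨N, hN⟩ := eventually_atTop.1 (hlim.eventually (lt_mem_nhds (half_lt_self hκ₀)))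
  have hx : ∀ t : ℕ, (0 : ℝ) < ((t : ℝ) + 1) ^ (2 * a - b) := fun t => by positivity
  have hfin : ∃ c : ℝ, 0 < c ∧ ∀ t ∈ Finset.Icc tbar N,
      c ≤ weight τ (power ρ₀ a) (power α₀ b) t / ((t : ℝ) + 1) ^ (2 * a - b) := by
    rcases (Finset.Icc tbar N).eq_empty_or_nonempty with h | h
    · exact ⟨1, one_pos, by simp [h]⟩
    · obtain ⟨s, hs, hmin⟩ := Finset.exists_min_image _
        (fun t : ℕ => weight τ (power ρ₀ a) (power α₀ b) t / ((t : ℝ) + 1) ^ (2 * a - b)) h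
      exact ⟨_, div_pos (hpos s (Finset.mem_Icc.1 hs).1) (hx s), hmin⟩
  obtain ⟨c, hc, hcle⟩ := hfin
  refine ⟨min c (κ₀ / 2), lt_min hc (half_pos hκ₀), fun t ht => ?_⟩
  rw [← le_div_iff₀ (hx t)]
  rcases le_total t N with h | h
  · exact (min_le_left _ _).trans (hcle t (Finset.mem_Icc.2 ⟨ht, h⟩))
  · exact (min_le_right _ _).trans (hN t h).le

/-- A discrete form of integrating `x^p`, for every real exponent. After factoring out `x^(p+1)`, it
is Bernoulli's inequality when `p + 1 ≥ 1`, and `y ≤ y^(p+1)` on `[0, 1]` otherwise. -/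
lemma rpow_add_one_sub_le {p x : ℝ} (hx : 1 ≤ x) :
    x ^ (p + 1) - (x - 1) ^ (p + 1) ≤ max (p + 1) 1 * x ^ p := by
  have hx0 : 0 < x := by linarith
  have hy : 0 ≤ 1 - x⁻¹ := sub_nonneg.2 (inv_le_one_of_one_le₀ hx)
  have hfac : (x - 1) ^ (p + 1) = x ^ (p + 1) * (1 - x⁻¹) ^ (p + 1) := by
    rw [← Real.mul_rpow hx0.le hy]
    congr 1
    field_simp
  have hkey : 1 - max (p + 1) 1 * x⁻¹ ≤ (1 - x⁻¹) ^ (p + 1) := by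
    rcases le_total 1 (p + 1) with h | h
    · rw [max_eq_left h]
      have := one_add_mul_self_le_rpow_one_add (s := -x⁻¹) (by linarith) h
      simpa [sub_eq_add_neg] using this
    · rw [max_eq_right h, one_mul]
      exact Real.self_le_rpow_of_le_one hy (by simp [hx0.le]) h
  rw [hfac]
  have h2 : x ^ (p + 1) = x * x ^ p := by rw [Real.rpow_add hx0, Real.rpow_one, mul_comm]
  have h3 : 0 < x ^ p := by positivity
  calc x ^ (p + 1) - x ^ (p + 1) * (1 - x⁻¹) ^ (p + 1)
      ≤ x ^ (p + 1) - x ^ (p + 1) * (1 - max (p + 1) 1 * x⁻¹) := by gcongr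
    _ = max (p + 1) 1 * x ^ p := by rw [h2]; field_simp; ring

lemma exists_lower_bound_sum_rpow (p : ℝ) (tbar : ℕ) :
    ∃ c : ℝ, 0 < c ∧ ∀ T, tbar ≤ T →
      c * ((T : ℝ) + 1) ^ (p + 1) ≤ ∑ t ∈ Finset.Icc tbar T, ((t : ℝ) + 1) ^ p := by
  have hM : (0 : ℝ) < max (p + 1) 1 := lt_max_of_lt_right one_pos
  -- The first constant serves the base case `T = tbar`, the second the increment of `(T+1)^(p+1)`
  -- in the induction step.
  refine ⟨min (1 / ((tbar : ℝ) + 1)) (1 / max (p + 1) 1), by positivity, fun T hT => ?_⟩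
  set c := min (1 / ((tbar : ℝ) + 1)) (1 / max (p + 1) 1)
  induction T, hT using Nat.le_induction with
  | base =>
    have hx : (0 : ℝ) < (tbar : ℝ) + 1 := by positivity
    rw [Finset.Icc_self, Finset.sum_singleton, Real.rpow_add hx, Real.rpow_one]
    calc c * (((tbar : ℝ) + 1) ^ p * ((tbar : ℝ) + 1))
        ≤ 1 / ((tbar : ℝ) + 1) * (((tbar : ℝ) + 1) ^ p * ((tbar : ℝ) + 1)) := by
          gcongr; exact min_le_left _ _
      _ = ((tbar : ℝ) + 1) ^ p := by field_simp
  | succ T hT ih =>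
    rw [Finset.sum_Icc_succ_top (by omega)]
    have h1 := rpow_add_one_sub_le (p := p) (x := ((T + 1 : ℕ) : ℝ) + 1)
      (by have : (0 : ℝ) ≤ ((T + 1 : ℕ) : ℝ) := Nat.cast_nonneg _
          linarith)
    have h2 : (((T + 1 : ℕ) : ℝ) + 1 - 1) = (T : ℝ) + 1 := by push_cast; ring
    rw [h2] at h1
    have hc : c ≤ 1 / max (p + 1) 1 := min_le_right _ _
    have h4 : (0 : ℝ) ≤ (((T + 1 : ℕ) : ℝ) + 1) ^ p := by positivity
    have hc0 : 0 < c := by positivity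
    have h5 : c * max (p + 1) 1 ≤ 1 := (le_div_iff₀ hM).1 hc
    nlinarith [mul_le_mul_of_nonneg_left h1 hc0.le, mul_le_mul_of_nonneg_right h5 h4]

lemma exists_lower_bound_sum_weight {τ ρ₀ α₀ a b : ℝ} (hρ₀ : τ < ρ₀) (hρ : 0 < ρ₀)
    (hα : 0 < α₀) (ha : 0 ≤ a) (hab : a ≤ b) (hb : b < 1) {tbar : ℕ}
    (hpos : ∀ t, tbar ≤ t → 0 < weight τ (power ρ₀ a) (power α₀ b) t) :
    ∃ c : ℝ, 0 < c ∧ ∀ T, tbar ≤ T → c * ((T : ℝ) + 1) ^ (1 + 2 * a - b)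
      ≤ ∑ t ∈ Finset.Icc tbar T, weight τ (power ρ₀ a) (power α₀ b) t := by
  obtain ⟨c, hc, h⟩ := exists_lower_bound_weight hρ₀ hρ hα ha hab hb hpos
  obtain ⟨c', hc', h'⟩ := exists_lower_bound_sum_rpow (2 * a - b) tbar
  refine ⟨c * c', by positivity, fun T hT => ?_⟩
  calc c * c' * ((T : ℝ) + 1) ^ (1 + 2 * a - b)
      = c * (c' * ((T : ℝ) + 1) ^ (2 * a - b + 1)) := by
        rw [mul_assoc]; congr 3; ring
    _ ≤ c * ∑ t ∈ Finset.Icc tbar T, ((t : ℝ) + 1) ^ (2 * a - b) := by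
        gcongr; exact h' T hT
    _ ≤ _ := by
        rw [Finset.mul_sum]
        exact Finset.sum_le_sum fun t ht => h t (Finset.mem_Icc.1 ht).1

/-- The factor `u` is the weight divided by its asymptotic equivalent, so only the normalization by
the sum depends on `T`. -/
lemma exists_avgProb_eq {τ ρ₀ α₀ a b : ℝ} (hρ₀ : τ < ρ₀) (hρ : 0 < ρ₀) (hα : 0 < α₀)
    (ha : 0 ≤ a) (hab : a ≤ b) (hb : b < 1) {tbar : ℕ}
    (hpos : ∀ t, tbar ≤ t → 0 < weight τ (power ρ₀ a) (power α₀ b) t) :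
    ∃ u : ℕ → ℝ, (∀ t, tbar ≤ t → 0 < u t) ∧ Tendsto u atTop (𝓝 1) ∧
      ∀ T, tbar ≤ T → ∃ κ : ℝ, 0 < κ ∧ ∀ t, tbar ≤ t → t ≤ T →
        avgProb τ (power ρ₀ a) (power α₀ b) tbar T t
          = κ * u t * ((t : ℝ) + 1) ^ (2 * a - b) := by
  obtain ⟨κ₀, hκ₀, hlim⟩ := tendsto_weight_div hρ₀ hρ hα ha hab hb
  have hx : ∀ t : ℕ, (0 : ℝ) < ((t : ℝ) + 1) ^ (2 * a - b) := fun t => by positivity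
  refine ⟨fun t => weight τ (power ρ₀ a) (power α₀ b) t / ((t : ℝ) + 1) ^ (2 * a - b) / κ₀,
    fun t ht => div_pos (div_pos (hpos t ht) (hx t)) hκ₀, ?_, fun T hT => ?_⟩
  · simpa [hκ₀.ne'] using hlim.div_const κ₀
  · have hS : 0 < ∑ s ∈ Finset.Icc tbar T, weight τ (power ρ₀ a) (power α₀ b) s :=
      Finset.sum_pos (fun s hs => hpos s (Finset.mem_Icc.1 hs).1)
        ⟨tbar, Finset.mem_Icc.2 ⟨le_rfl, hT⟩⟩
    refine ⟨κ₀ / ∑ s ∈ Finset.Icc tbar T, weight τ (power ρ₀ a) (power α₀ b) s,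
      div_pos hκ₀ hS, fun t ht htT => ?_⟩
    rw [avgProb, if_pos ⟨ht, htT⟩]
    have := hx t
    field_simp

/-! ### Sample sizes and error sums -/

lemma le_batchSize (m₀ : ℕ) (j : ℝ) (t : ℕ) :
    (m₀ : ℝ) * ((t : ℝ) + 1) ^ j ≤ batchSize m₀ j t := Nat.le_ceil _

lemma batchSize_pos {m₀ : ℕ} (hm : 0 < m₀) (j : ℝ) (t : ℕ) : 0 < batchSize m₀ j t := by
  unfold batchSize
  have : (0 : ℝ) < m₀ := by exact_mod_cast hm
  rw [Nat.ceil_pos]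
  positivity

lemma exists_bound_sum_of_le_rpow {x : ℕ → ℝ} {c s : ℝ} (hs : 1 < s) (hx : ∀ t, 0 ≤ x t)
    (h : ∀ t : ℕ, x t ≤ c * ((t : ℝ) + 1) ^ (-s)) :
    ∃ K : ℝ, 0 ≤ K ∧ ∀ tbar T, ∑ t ∈ Finset.Icc tbar T, x t ≤ K := by
  have hsum : Summable fun t : ℕ => c * ((t : ℝ) + 1) ^ (-s) := by
    have h1 : Summable fun t : ℕ => (t : ℝ) ^ (-s) := Real.summable_nat_rpow.2 (by linarith)
    have h2 := (summable_nat_add_iff 1).2 h1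
    simpa using h2.mul_left c
  have hsum' : Summable x := Summable.of_nonneg_of_le hx h hsum
  exact ⟨∑' t, x t, tsum_nonneg hx, fun tbar T => hsum'.sum_le_tsum _ fun t _ => hx t⟩

/-- The summand decays like `(t+1)^{a - j - 2b}`, and the condition on `j` says exactly that this
exponent is below `-1`. -/
lemma exists_bound_sum_batch {ρ₀ α₀ a b j : ℝ} (hρ : 0 < ρ₀) (hα : 0 < α₀) (ha : 0 ≤ a)
    {m₀ : ℕ} (hm : 0 < m₀) (hj : 1 + a - 2 * b < j) :
    ∃ K : ℝ, 0 ≤ K ∧ ∀ tbar T, ∑ t ∈ Finset.Icc tbar T,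
      power ρ₀ a (t + 1) / (batchSize m₀ j t * power α₀ b t ^ 2) ≤ K := by
  have hm' : (0 : ℝ) < m₀ := by exact_mod_cast hm
  refine exists_bound_sum_of_le_rpow (c := ρ₀ * 2 ^ a / (m₀ * α₀ ^ 2)) (s := j + 2 * b - a)
    (by linarith) (fun t => ?_) (fun t => ?_)
  · have h1 := power_pos (a := a) hρ (t + 1)
    positivity
  · have hx : (0 : ℝ) < (t : ℝ) + 1 := by positivity
    have hxa := Real.rpow_pos_of_pos hx a
    have hxb := Real.rpow_pos_of_pos hx b
    have hxj := Real.rpow_pos_of_pos hx j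
    calc power ρ₀ a (t + 1) / (batchSize m₀ j t * power α₀ b t ^ 2)
        ≤ (ρ₀ * 2 ^ a * ((t : ℝ) + 1) ^ a)
            / (m₀ * ((t : ℝ) + 1) ^ j * (α₀ * ((t : ℝ) + 1) ^ b) ^ 2) := by
          refine div_le_div₀ (by positivity) (power_succ_le hρ.le ha t) (by positivity) ?_
          have := le_batchSize m₀ j t
          unfold power
          gcongr
      _ = _ := by
          rw [show -(j + 2 * b - a) = a - (j + (b + b)) by ring, Real.rpow_sub hx,
            Real.rpow_add hx, Real.rpow_add hx]
          field_simp

/-- The summand decays like `(t+1)^{a - b - k r/2}`, and the condition on `k` says exactly that this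
exponent is below `-1`. -/
lemma exists_bound_sum_estimation {ρ₀ α₀ a b k r : ℝ} (hρ : 0 < ρ₀) (hα : 0 < α₀) (ha : 0 ≤ a)
    (hr : 0 < r) {n₀ : ℕ} (hn : 0 < n₀) (hk : 2 * (1 + a - b) / r < k) :
    ∃ K : ℝ, 0 ≤ K ∧ ∀ tbar T, ∑ t ∈ Finset.Icc tbar T,
      power ρ₀ a (t + 1) / ((batchSize n₀ k t : ℝ) ^ (r / 2) * power α₀ b t) ≤ K := by
  have hn' : (0 : ℝ) < n₀ := by exact_mod_cast hn
  have hk' : 2 * (1 + a - b) < k * r := (div_lt_iff₀ hr).1 hk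
  refine exists_bound_sum_of_le_rpow (c := ρ₀ * 2 ^ a / ((n₀ : ℝ) ^ (r / 2) * α₀))
    (s := k * (r / 2) + b - a) (by linarith) (fun t => ?_) (fun t => ?_)
  · have h1 := power_pos (a := a) hρ (t + 1)
    have h2 := power_pos (a := b) hα t
    positivity
  · have hx : (0 : ℝ) < (t : ℝ) + 1 := by positivity
    have hxa := Real.rpow_pos_of_pos hx a
    have hxb := Real.rpow_pos_of_pos hx b
    have hxj := Real.rpow_pos_of_pos hx (k * (r / 2))
    have hnr := Real.rpow_pos_of_pos hn' (r / 2)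
    calc power ρ₀ a (t + 1) / ((batchSize n₀ k t : ℝ) ^ (r / 2) * power α₀ b t)
        ≤ (ρ₀ * 2 ^ a * ((t : ℝ) + 1) ^ a)
            / ((n₀ * ((t : ℝ) + 1) ^ k) ^ (r / 2) * (α₀ * ((t : ℝ) + 1) ^ b)) := by
          refine div_le_div₀ (by positivity) (power_succ_le hρ.le ha t) (by positivity) ?_
          have := le_batchSize n₀ k t
          unfold power
          gcongr
      _ = _ := by
          rw [show -(k * (r / 2) + b - a) = a - (k * (r / 2) + b) by ring, Real.rpow_sub hx,
            Real.rpow_add hx, Real.mul_rpow hn'.le (by positivity), ← Real.rpow_mul hx.le]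
          field_simp

lemma exists_bound_errorBudget {d l : ℕ} (P : Problem d l) {ρ₀ α₀ a b j k r : ℝ} (hρ : 0 < ρ₀)
    (hα : 0 < α₀) (ha : 0 ≤ a) (hr : 0 < r) {m₀ n₀ : ℕ} (hm : 0 < m₀) (hn : 0 < n₀)
    (hj : 1 + a - 2 * b < j) (hk : 2 * (1 + a - b) / r < k) {C : ℝ} (hC : 0 < C) (tbar : ℕ) :
    ∃ K : ℝ, ∀ T, tbar ≤ T → errorBudget P r C (power ρ₀ a) (power α₀ b)
      (batchSize n₀ k) (batchSize m₀ j) tbar T ≤ K := by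
  obtain ⟨K₁, -, h₁⟩ := exists_bound_sum_batch hρ hα ha hm hj
  obtain ⟨K₂, -, h₂⟩ := exists_bound_sum_estimation hρ hα ha hr hn hk
  refine ⟨2 * P.Δ₀ + 4 * P.L ^ 2 * K₁ + 4 * C * K₂, fun T _ => ?_⟩
  unfold errorBudget
  gcongr
  · calc _ = 4 * P.L ^ 2 * ∑ t ∈ Finset.Icc tbar T,
          power ρ₀ a (t + 1) / (batchSize m₀ j t * power α₀ b t ^ 2) := by
          rw [Finset.mul_sum]; exact Finset.sum_congr rfl fun t _ => by ring
      _ ≤ _ := by gcongr; exact h₁ tbar T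
  · calc _ = 4 * C * ∑ t ∈ Finset.Icc tbar T,
          power ρ₀ a (t + 1) / ((batchSize n₀ k t : ℝ) ^ (r / 2) * power α₀ b t) := by
          rw [Finset.mul_sum]; exact Finset.sum_congr rfl fun t _ => by ring
      _ ≤ _ := by gcongr; exact h₂ tbar T

/-! ### Minimizers of strongly convex functions -/

/-- Removing `α/2 ‖x‖²` from the added term leaves an affine function of `x`. -/
lemma strongConvexOn_add_sq {d : ℕ} {X : Set (Vec d)} {g : Vec d → ℝ} (hg : ConvexOn ℝ X g)
    (α : ℝ) (z : Vec d) : StrongConvexOn X α fun x => g x + α / 2 * ‖x - z‖ ^ 2 := by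
  rw [strongConvexOn_iff_convex]
  have haff : ConvexOn ℝ X fun x : Vec d => (-α) * inner ℝ z x + α / 2 * ‖z‖ ^ 2 := by
    have h1 : ConvexOn ℝ X fun x : Vec d => ((-α) • (innerSL ℝ z : Vec d →L[ℝ] ℝ)) x :=
      (((-α) • (innerSL ℝ z : Vec d →L[ℝ] ℝ)).toLinearMap).convexOn hg.1
    refine (h1.add (convexOn_const (α / 2 * ‖z‖ ^ 2) hg.1)).congr fun x _ => ?_
    simp
  refine (hg.add haff).congr fun x _ => ?_
  have := norm_sub_sq_real x z
  simp only [Pi.add_apply]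
  rw [this, real_inner_comm]
  ring

/-- Quadratic growth at a minimizer: compare `y` with the point `t x + (1 - t) y`, divide by `t`,
and let `t` tend to `0`. -/
lemma IsArgmin.add_sq_le {d : ℕ} {X : Set (Vec d)} {h : Vec d → ℝ} {σ : ℝ} {y x : Vec d}
    (hy : IsArgmin X h y) (hh : StrongConvexOn X σ h) (hx : x ∈ X) :
    h y + σ / 2 * ‖x - y‖ ^ 2 ≤ h x := by
  have key : ∀ t ∈ Set.Ioo (0 : ℝ) 1, h y + (1 - t) * (σ / 2 * ‖x - y‖ ^ 2) ≤ h x := by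
    rintro t ⟨ht0, ht1⟩
    have h1 := hh.2 hx hy.1 ht0.le (sub_nonneg.2 ht1.le) (by ring)
    have h2 := hy.2 _ (hh.1 hx hy.1 ht0.le (sub_nonneg.2 ht1.le) (by ring))
    simp only [smul_eq_mul] at h1
    have h3 : t * (h y + (1 - t) * (σ / 2 * ‖x - y‖ ^ 2)) ≤ t * h x := by nlinarith
    exact le_of_mul_le_mul_left h3 ht0
  have hlim : Tendsto (fun t : ℝ => h y + (1 - t) * (σ / 2 * ‖x - y‖ ^ 2)) (𝓝[>] 0)
      (𝓝 (h y + (1 - 0) * (σ / 2 * ‖x - y‖ ^ 2))) := by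
    refine Tendsto.mono_left ?_ nhdsWithin_le_nhds
    exact (Continuous.tendsto (by fun_prop) 0)
  have := le_of_tendsto hlim (Filter.eventually_of_mem (Ioo_mem_nhdsGT one_pos) key)
  simpa using this

lemma IsArgmin.unique {d : ℕ} {X : Set (Vec d)} {h : Vec d → ℝ} {σ : ℝ} {y y' : Vec d}
    (hσ : 0 < σ) (hh : StrongConvexOn X σ h) (hy : IsArgmin X h y) (hy' : IsArgmin X h y') :
    y = y' := by
  have h1 := hy.add_sq_le hh hy'.1
  have h2 := hy'.2 y hy.1
  have h3 : ‖y' - y‖ ^ 2 ≤ 0 := by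
    have : 0 ≤ ‖y' - y‖ ^ 2 := by positivity
    nlinarith
  have h4 : ‖y' - y‖ = 0 := by
    have := sq_nonneg ‖y' - y‖
    exact pow_eq_zero_iff (two_ne_zero) |>.1 (le_antisymm h3 this)
  exact (sub_eq_zero.1 (norm_eq_zero.1 h4)).symm

lemma exists_isArgmin {d : ℕ} {X : Set (Vec d)} (hX : IsCompact X) (hne : X.Nonempty)
    {h : Vec d → ℝ} (hh : ContinuousOn h X) : ∃ y, IsArgmin X h y := by
  obtain ⟨y, hy, hmin⟩ := hX.exists_isMinOn hne hh
  exact ⟨y, hy, fun x hx => hmin hx⟩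

/-- The minimal value is an infimum over a countable dense subset of `X`, hence measurable.
Near-minimizers chosen from that subset are measurable too, and quadratic growth forces them to
converge to the minimizer. -/
lemma measurable_of_isArgmin {d : ℕ} {X : Set (Vec d)} (hne : X.Nonempty) {Θ : Type*}
    [MeasurableSpace Θ] {F : Θ → Vec d → ℝ} (hF : ∀ x ∈ X, Measurable fun θ => F θ x)
    (hc : ∀ θ, ContinuousOn (F θ) X) {σ : ℝ} (hσ : 0 < σ) (hs : ∀ θ, StrongConvexOn X σ (F θ))
    {A : Θ → Vec d} (hA : ∀ θ, IsArgmin X (F θ) (A θ)) : Measurable A := by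
  have : Nonempty X := hne.to_subtype
  let xs : ℕ → X := TopologicalSpace.denseSeq X
  have hdense : ∀ θ, ∀ ε : ℝ, 0 < ε → ∃ i, F θ (xs i) < F θ (A θ) + ε := by
    intro θ ε hε
    have hcont : Continuous fun x : X => F θ x := continuousOn_iff_continuous_domRestrict.1 (hc θ)
    have hopen : IsOpen {x : X | F θ x < F θ (A θ) + ε} := isOpen_lt hcont continuous_const
    obtain ⟨i, hi⟩ := (TopologicalSpace.denseRange_denseSeq X).exists_mem_open hopen
      ⟨⟨A θ, (hA θ).1⟩, by simpa using hε⟩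
    exact ⟨i, hi⟩
  have hxs : ∀ i, Measurable fun θ => F θ (xs i) := fun i => hF _ (xs i).2
  have hmin : Measurable fun θ => F θ (A θ) := by
    refine measurable_of_Iio fun c => ?_
    have : (fun θ => F θ (A θ)) ⁻¹' Set.Iio c = ⋃ i, {θ | F θ (xs i) < c} := by
      ext θ
      simp only [Set.mem_preimage, Set.mem_Iio, Set.mem_iUnion, Set.mem_ofPred_eq]
      constructor
      · intro h
        obtain ⟨i, hi⟩ := hdense θ (c - F θ (A θ)) (sub_pos.2 h)
        exact ⟨i, by linarith⟩
      · rintro ⟨i, hi⟩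
        exact ((hA θ).2 _ (xs i).2).trans_lt hi
    rw [this]
    exact MeasurableSet.iUnion fun i => measurableSet_lt (hxs i) measurable_const
  classical
  -- The first point of the dense sequence that is optimal up to `1/(k+1)`; taking the least index
  -- makes the choice measurable.
  let y : ℕ → Θ → Vec d := fun k θ =>
    xs (Nat.find (hdense θ (1 / ((k : ℝ) + 1)) Nat.one_div_pos_of_nat))
  have hy : ∀ k, Measurable (y k) := fun k =>
    measurable_subtype_coe.comp ((measurable_of_countable xs).comp
      (measurable_find (fun θ => hdense θ (1 / ((k : ℝ) + 1)) Nat.one_div_pos_of_nat)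
        fun i => measurableSet_lt (hxs i) (hmin.add_const _)))
  refine measurable_of_tendsto_metrizable hy (tendsto_pi_nhds.2 fun θ => ?_)
  rw [tendsto_iff_norm_sub_tendsto_zero]
  have hbd : ∀ k : ℕ, ‖y k θ - A θ‖ ≤ Real.sqrt (2 / σ * (1 / ((k : ℝ) + 1))) := by
    intro k
    refine Real.le_sqrt_of_sq_le ?_
    have h1 := (hA θ).add_sq_le (hs θ)
      (xs (Nat.find (hdense θ (1 / ((k : ℝ) + 1)) Nat.one_div_pos_of_nat))).2
    have h2 := Nat.find_spec (hdense θ (1 / ((k : ℝ) + 1)) Nat.one_div_pos_of_nat)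
    have h3 : σ / 2 * ‖y k θ - A θ‖ ^ 2 ≤ 1 / ((k : ℝ) + 1) := by
      simp only [y]; linarith
    calc ‖y k θ - A θ‖ ^ 2 = 2 / σ * (σ / 2 * ‖y k θ - A θ‖ ^ 2) := by field_simp
      _ ≤ _ := by gcongr
  refine squeeze_zero (fun _ => norm_nonneg _) hbd ?_
  have h0 : Tendsto (fun k : ℕ => 2 / σ * (1 / ((k : ℝ) + 1))) atTop (𝓝 (2 / σ * 0)) :=
    tendsto_one_div_add_atTop_nhds_zero_nat.const_mul _
  simpa using h0.sqrt

/-! ### Stability of empirical minimizers -/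

/-- Exchangeability of an i.i.d. sample, the symmetry behind the comparison of in-sample and
out-of-sample values. -/
lemma measurePreserving_comp_perm {ι 𝒲 : Type*} [Fintype ι] [MeasurableSpace 𝒲]
    (ν : Measure 𝒲) [IsProbabilityMeasure ν] (σ : Equiv.Perm ι) :
    MeasurePreserving (fun v : ι → 𝒲 => v ∘ σ) (Measure.pi fun _ => ν)
      (Measure.pi fun _ => ν) := by
  have h := measurePreserving_piCongrLeft (α := fun _ : ι => 𝒲) (fun _ : ι => ν) σ.symm
  have heq : ⇑(MeasurableEquiv.piCongrLeft (fun _ : ι => 𝒲) σ.symm)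
      = fun v : ι → 𝒲 => v ∘ σ := by
    funext v i
    have := MeasurableEquiv.piCongrLeft_apply_apply (β := fun _ : ι => 𝒲) σ.symm v (σ i)
    simpa using this
  rw [heq] at h
  exact h

/-- Views the last of `m + 1` i.i.d. points as a fresh point, independent of a sample of size `m`.
-/
lemma measurePreserving_last_init {𝒲 : Type*} [MeasurableSpace 𝒲] (ν : Measure 𝒲)
    [IsProbabilityMeasure ν] (m : ℕ) :
    MeasurePreserving (fun v : Fin (m + 1) → 𝒲 => (v (Fin.last m), fun j : Fin m => v j.castSucc))
      (Measure.pi fun _ => ν) (ν.prod (Measure.pi fun _ => ν)) := by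
  have h := measurePreserving_piFinSuccAbove (α := fun _ : Fin (m + 1) => 𝒲) (fun _ => ν)
    (Fin.last m)
  convert h using 1
  funext v
  ext j <;> simp [MeasurableEquiv.piFinSuccAbove, Fin.init]

lemma convexOn_average {d m : ℕ} {X : Set (Vec d)} (hX : Convex ℝ X) {h : Fin m → Vec d → ℝ}
    (hh : ∀ i, ConvexOn ℝ X (h i)) : ConvexOn ℝ X fun x => 1 / (m : ℝ) * ∑ i, h i x := by
  refine ⟨hX, fun x hx y hy a b ha hb hab => ?_⟩
  simp only [smul_eq_mul]
  calc 1 / (m : ℝ) * ∑ i, h i (a • x + b • y)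
      ≤ 1 / (m : ℝ) * ∑ i, (a * h i x + b * h i y) := by
        gcongr with i _
        simpa using (hh i).2 hx hy ha hb hab
    _ = _ := by rw [Finset.sum_add_distrib, ← Finset.mul_sum, ← Finset.mul_sum]; ring

lemma average_add_const {m : ℕ} (hm : 0 < m) (h : Fin m → ℝ) (c : ℝ) :
    1 / (m : ℝ) * ∑ i, (h i + c) = 1 / (m : ℝ) * ∑ i, h i + c := by
  have : (m : ℝ) ≠ 0 := by exact_mod_cast hm.ne'
  rw [Finset.sum_add_distrib, Finset.sum_const, Finset.card_univ, Fintype.card_fin, nsmul_eq_mul]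
  field_simp

lemma strongConvexOn_average {d m : ℕ} (hm : 0 < m) {X : Set (Vec d)} (hX : Convex ℝ X)
    {h : Fin m → Vec d → ℝ} (hh : ∀ i, ConvexOn ℝ X (h i)) (α : ℝ) (z : Vec d) :
    StrongConvexOn X α fun x => 1 / (m : ℝ) * ∑ i, (h i x + α / 2 * ‖x - z‖ ^ 2) := by
  have := strongConvexOn_add_sq (convexOn_average hX hh) α z
  simpa only [average_add_const hm] using this

/-- Replacing one summand of a regularized empirical objective changes the value of a Lipschitz
function at the minimizer only a little. -/
lemma argmin_stability {d m : ℕ} (hm : 0 < m) {X : Set (Vec d)} (hX : Convex ℝ X)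
    {h h' : Fin m → Vec d → ℝ} (hh : ∀ i, ConvexOn ℝ X (h i)) (hh' : ∀ i, ConvexOn ℝ X (h' i))
    {α : ℝ} (hα : 0 < α) {z a a' : Vec d}
    (ha : IsArgmin X (fun x => 1 / (m : ℝ) * ∑ i, (h i x + α / 2 * ‖x - z‖ ^ 2)) a)
    (ha' : IsArgmin X (fun x => 1 / (m : ℝ) * ∑ i, (h' i x + α / 2 * ‖x - z‖ ^ 2)) a')
    (i₀ : Fin m) (heq : ∀ i, i ≠ i₀ → h' i = h i) {g₁ g₂ : Vec d → ℝ} {L e₁ e₂ : ℝ}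
    (h₁ : ∀ x ∈ X, |h i₀ x - g₁ x| ≤ e₁) (h₂ : ∀ x ∈ X, |h' i₀ x - g₂ x| ≤ e₂)
    (hL₁ : ∀ x ∈ X, ∀ y ∈ X, |g₁ x - g₁ y| ≤ L * ‖x - y‖)
    (hL₂ : ∀ x ∈ X, ∀ y ∈ X, |g₂ x - g₂ y| ≤ L * ‖x - y‖) :
    g₁ a' - g₁ a ≤ 2 * L ^ 2 / (m * α) + (e₁ + e₂) := by
  have hm' : (0 : ℝ) < m := by exact_mod_cast hm
  have e1 := ha.add_sq_le (strongConvexOn_average hm hX hh α z) ha'.1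
  have e2 := ha'.add_sq_le (strongConvexOn_average hm hX hh' α z) ha.1
  have hdiff : ∀ x, 1 / (m : ℝ) * ∑ i, (h' i x + α / 2 * ‖x - z‖ ^ 2)
      = 1 / (m : ℝ) * ∑ i, (h i x + α / 2 * ‖x - z‖ ^ 2) + 1 / (m : ℝ) * (h' i₀ x - h i₀ x) := by
    intro x
    rw [← mul_add]
    congr 1
    rw [← Finset.add_sum_erase _ _ (Finset.mem_univ i₀),
      ← Finset.add_sum_erase _ (fun i => h i x + α / 2 * ‖x - z‖ ^ 2) (Finset.mem_univ i₀),
      Finset.sum_congr rfl fun i hi => by rw [heq i (Finset.ne_of_mem_erase hi)]]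
    ring
  simp only [hdiff] at e2
  rw [norm_sub_rev a a'] at e2
  set u := ‖a' - a‖ with hu
  have k1 := abs_le.1 (h₁ a ha.1)
  have k2 := abs_le.1 (h₁ a' ha'.1)
  have k3 := abs_le.1 (h₂ a ha.1)
  have k4 := abs_le.1 (h₂ a' ha'.1)
  have k5 := abs_le.1 (hL₁ a' ha'.1 a ha.1)
  have k6 := abs_le.1 (hL₂ a' ha'.1 a ha.1)
  rw [← hu] at k5 k6
  -- Sum of the two growth inequalities: the objectives differ only in the summand `i₀`, so
  -- everything else cancels.
  have s1 : α * u ^ 2 ≤ 1 / (m : ℝ) * ((h i₀ a' - h i₀ a) - (h' i₀ a' - h' i₀ a)) := by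
    linarith
  have s2 : m * α * u ^ 2 ≤ 2 * (L * u) + 2 * (e₁ + e₂) := by
    calc m * α * u ^ 2 = m * (α * u ^ 2) := by ring
      _ ≤ m * (1 / (m : ℝ) * ((h i₀ a' - h i₀ a) - (h' i₀ a' - h' i₀ a))) := by gcongr
      _ = (h i₀ a' - h i₀ a) - (h' i₀ a' - h' i₀ a) := by field_simp
      _ ≤ _ := by linarith
  have hβ : 0 < m * α := by positivity
  set β := m * α
  -- Young's inequality. The weight `β/4` lets half of the quadratic term in `s2` be absorbed, which
  -- yields the constant `2 L²/β`.
  have s3 : L * u ≤ β / 4 * u ^ 2 + L ^ 2 / β := by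
    have : 0 ≤ (β * u / 2 - L) ^ 2 / β := by positivity
    have h2 : (β * u / 2 - L) ^ 2 / β = β / 4 * u ^ 2 + L ^ 2 / β - L * u := by
      field_simp; ring
    linarith
  have s4 : 2 * L ^ 2 / β = 2 * (L ^ 2 / β) := by ring
  rw [s4]
  linarith

/-- The expected difference between the mean of `g` and its empirical average at the minimizer of
a regularized empirical objective that is uniformly close to the average of `g`. -/
lemma integral_argmin_le {d m : ℕ} (hm : 0 < m) {X : Set (Vec d)} (hX : Convex ℝ X)
    {𝒲 : Type*} [MeasurableSpace 𝒲] (ν : Measure 𝒲) [IsProbabilityMeasure ν]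
    {gh g : Vec d → 𝒲 → ℝ} {e : 𝒲 → ℝ} (hconv : ∀ w, ConvexOn ℝ X fun x => gh x w)
    {α : ℝ} (hα : 0 < α) {z : Vec d} {A : (Fin m → 𝒲) → Vec d} (hAm : Measurable A)
    (hA : ∀ w, IsArgmin X (fun x => 1 / (m : ℝ) * ∑ i, (gh x (w i) + α / 2 * ‖x - z‖ ^ 2)) (A w))
    (hg : Measurable (Function.uncurry g)) (he : Integrable e ν) {L M : ℝ}
    (hclose : ∀ᵐ w ∂ν, ∀ x ∈ X, |gh x w - g x w| ≤ e w)
    (hlip : ∀ᵐ w ∂ν, ∀ x ∈ X, ∀ y ∈ X, |g x w - g y w| ≤ L * ‖x - y‖)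
    (hbd : ∀ᵐ w ∂ν, ∀ x ∈ X, |g x w| ≤ M) :
    ∫ w, (∫ w', g (A w) w' ∂ν) ∂(Measure.pi fun _ : Fin m => ν)
      ≤ ∫ w, 1 / (m : ℝ) * ∑ i, g (A w) (w i) ∂(Measure.pi fun _ : Fin m => ν)
        + (2 * L ^ 2 / (m * α) + 2 * ∫ w, e w ∂ν) := by
  have hm' : (0 : ℝ) < m := by exact_mod_cast hm
  have hAX : ∀ w, A w ∈ X := fun w => (hA w).1
  set μs : Measure (Fin (m + 1) → 𝒲) := Measure.pi fun _ => ν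
  set μm : Measure (Fin m → 𝒲) := Measure.pi fun _ => ν
  let ini : (Fin (m + 1) → 𝒲) → (Fin m → 𝒲) := fun v j => v j.castSucc
  have hini : Measurable ini := by fun_prop
  have hae : ∀ {p : 𝒲 → Prop}, (∀ᵐ w ∂ν, p w) → ∀ i, ∀ᵐ v ∂μs, p (v i) := fun hp i =>
    (Measure.tendsto_eval_ae_ae (μ := fun _ : Fin (m + 1) => ν) (i := i)).eventually hp
  have haem : ∀ {p : 𝒲 → Prop}, (∀ᵐ w ∂ν, p w) → ∀ i, ∀ᵐ v ∂μm, p (v i) := fun hp i =>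
    (Measure.tendsto_eval_ae_ae (μ := fun _ : Fin m => ν) (i := i)).eventually hp
  have hmp := measurePreserving_last_init ν m
  have hinip : MeasurePreserving ini μs μm := measurePreserving_snd.comp hmp
  have hgA : ∀ {f : (Fin (m + 1) → 𝒲) → (Fin m → 𝒲)}, Measurable f → ∀ i,
      Integrable (fun v => g (A (f v)) (v i)) μs := fun {f} hf i => by
    refine Integrable.of_bound (C := M)
      (hg.comp ((hAm.comp hf).prodMk (measurable_pi_apply i))).aestronglyMeasurable ?_
    filter_upwards [hae hbd i] with v hv
    exact hv _ (hAX _)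
  have hgAm : ∀ i, Integrable (fun w => g (A w) (w i)) μm := fun i => by
    refine Integrable.of_bound (C := M)
      (hg.comp (hAm.prodMk (measurable_pi_apply i))).aestronglyMeasurable ?_
    filter_upwards [haem hbd i] with v hv
    exact hv _ (hAX _)
  have hfresh : ∫ w, (∫ w', g (A w) w' ∂ν) ∂μm = ∫ v, g (A (ini v)) (v (Fin.last m)) ∂μs := by
    have hmeas : Measurable fun p : 𝒲 × (Fin m → 𝒲) => g (A p.2) p.1 :=
      hg.comp ((hAm.comp measurable_snd).prodMk measurable_fst)
    have h1 : Integrable (fun p : 𝒲 × (Fin m → 𝒲) => g (A p.2) p.1) (ν.prod μm) := by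
      refine Integrable.of_bound (C := M) hmeas.aestronglyMeasurable ?_
      filter_upwards [Measure.quasiMeasurePreserving_fst.ae hbd] with p hp
      exact hp _ (hAX _)
    rw [← integral_prod_symm (fun p : 𝒲 × (Fin m → 𝒲) => g (A p.2) p.1) h1, ← hmp.map_eq,
      integral_map hmp.measurable.aemeasurable hmeas.aestronglyMeasurable]
  have hone : ∀ i : Fin m, ∫ v, g (A (ini v)) (v (Fin.last m)) ∂μs
      ≤ ∫ w, g (A w) (w i) ∂μm + (2 * L ^ 2 / (m * α) + 2 * ∫ w, e w ∂ν) := by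
    intro i
    let σ : Equiv.Perm (Fin (m + 1)) := Equiv.swap i.castSucc (Fin.last m)
    have hσ : MeasurePreserving (fun v : Fin (m + 1) → 𝒲 => v ∘ σ) μs μs :=
      measurePreserving_comp_perm ν σ
    -- Exchanging the fresh point with sample `i` turns the out-of-sample value into an in-sample
    -- one, for the minimizer fitted with entry `i` replaced.
    have hswap : ∫ v, g (A (ini v)) (v (Fin.last m)) ∂μs
        = ∫ v, g (A (ini (v ∘ σ))) (v i.castSucc) ∂μs := by
      conv_lhs => rw [← hσ.map_eq]
      rw [integral_map hσ.measurable.aemeasurable]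
      · simp [σ]
      · rw [hσ.map_eq]; exact (hgA hini _).aestronglyMeasurable
    have hemp : ∫ w, g (A w) (w i) ∂μm = ∫ v, g (A (ini v)) (v i.castSucc) ∂μs := by
      rw [← hinip.map_eq, integral_map hini.aemeasurable]
      rw [hinip.map_eq]; exact (hgAm i).aestronglyMeasurable
    have heint : ∀ k, Integrable (fun v : Fin (m + 1) → 𝒲 => e (v k)) μs := fun k =>
      integrable_comp_eval (μ := fun _ : Fin (m + 1) => ν) he
    have hee : ∀ k, ∫ v : Fin (m + 1) → 𝒲, e (v k) ∂μs = ∫ w, e w ∂ν := fun k =>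
      integral_comp_eval (μ := fun _ : Fin (m + 1) => ν) he.aestronglyMeasurable
    have hE₂ : Integrable (fun v : Fin (m + 1) → 𝒲 => e (v i.castSucc) + e (v (Fin.last m))) μs :=
      (heint _).add (heint _)
    have hE : Integrable (fun v : Fin (m + 1) → 𝒲 =>
        2 * L ^ 2 / (m * α) + (e (v i.castSucc) + e (v (Fin.last m)))) μs :=
      (integrable_const _).add hE₂
    rw [hswap, hemp]
    calc ∫ v, g (A (ini (v ∘ σ))) (v i.castSucc) ∂μs
        ≤ ∫ v, (g (A (ini v)) (v i.castSucc)
            + (2 * L ^ 2 / (m * α) + (e (v i.castSucc) + e (v (Fin.last m))))) ∂μs := by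
          refine integral_mono_ae (hgA (hini.comp hσ.measurable) _)
            ((hgA hini _).add hE) ?_
          filter_upwards [hae hclose i.castSucc, hae hclose (Fin.last m), hae hlip i.castSucc,
            hae hlip (Fin.last m)] with v v1 v2 v3 v4
          have key := argmin_stability hm hX (h := fun j x => gh x (ini v j))
            (h' := fun j x => gh x (ini (v ∘ σ) j)) (fun j => hconv _) (fun j => hconv _) hα
            (hA (ini v)) (hA (ini (v ∘ σ))) i
            (fun j hj => by
              have hne : σ j.castSucc = j.castSucc :=
                Equiv.swap_apply_of_ne_of_ne (fun h => hj (Fin.castSucc_injective m h))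
                  (Fin.castSucc_lt_last j).ne
              simp [ini, hne])
            (g₁ := fun x => g x (v i.castSucc)) (g₂ := fun x => g x (v (Fin.last m)))
            v1 (by simpa [ini, σ] using v2) v3 v4
          linarith
      _ = _ := by
          rw [integral_add (hgA hini _) hE, integral_add (integrable_const _) hE₂,
            integral_add (heint _) (heint _), hee, hee]
          simp
          ring
  rw [hfresh, integral_const_mul, integral_finsetSum _ fun i _ => hgAm i]
  have hsum := Finset.sum_le_sum fun (i : Fin m) (_ : i ∈ Finset.univ) => hone i
  rw [Finset.sum_add_distrib, Finset.sum_const, Finset.sum_const, Finset.card_univ,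
    Fintype.card_fin, nsmul_eq_mul, nsmul_eq_mul] at hsum
  have h3 := mul_le_mul_of_nonneg_left hsum (show (0 : ℝ) ≤ 1 / m by positivity)
  rw [mul_add, ← mul_assoc, ← mul_assoc, one_div_mul_cancel hm'.ne', one_mul, one_mul] at h3
  exact h3

/-- One step of the surrogate method contracts the distance to a proximal point `y` of `f`, up to
errors from sampling and from the estimation of the model `g`. -/
lemma integral_sq_dist_argmin_le {d m : ℕ} (hm : 0 < m) {X : Set (Vec d)} (hX : Convex ℝ X)
    {𝒲 : Type*} [MeasurableSpace 𝒲] (ν : Measure 𝒲) [IsProbabilityMeasure ν]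
    {gh g : Vec d → 𝒲 → ℝ} {e : 𝒲 → ℝ} (hconv : ∀ w, ConvexOn ℝ X fun x => gh x w)
    {α : ℝ} (hα : 0 < α) {z : Vec d} {A : (Fin m → 𝒲) → Vec d} (hAm : Measurable A)
    (hA : ∀ w, IsArgmin X (fun x => 1 / (m : ℝ) * ∑ i, (gh x (w i) + α / 2 * ‖x - z‖ ^ 2)) (A w))
    (hg : Measurable (Function.uncurry g)) (he : Integrable e ν) {L M D : ℝ}
    (hclose : ∀ᵐ w ∂ν, ∀ x ∈ X, |gh x w - g x w| ≤ e w)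
    (hlip : ∀ᵐ w ∂ν, ∀ x ∈ X, ∀ y ∈ X, |g x w - g y w| ≤ L * ‖x - y‖)
    (hbd : ∀ᵐ w ∂ν, ∀ x ∈ X, |g x w| ≤ M) (hD : ∀ x ∈ X, ∀ y ∈ X, ‖x - y‖ ≤ D)
    {f : Vec d → ℝ} {τ ρ : ℝ} {y : Vec d} (hy : y ∈ X) (hρ : τ < ρ)
    (hρα : ρ + τ ≤ α)
    (hlow : ∀ x ∈ X, f x - τ / 2 * ‖x - z‖ ^ 2 ≤ ∫ w, g x w ∂ν)
    (hup : ∫ w, g y w ∂ν ≤ f y + τ / 2 * ‖y - z‖ ^ 2)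
    (hprox : ∀ x ∈ X, f y + ρ / 2 * ‖y - z‖ ^ 2 + (ρ - τ) / 2 * ‖x - y‖ ^ 2
      ≤ f x + ρ / 2 * ‖x - z‖ ^ 2) :
    ∫ w, ‖A w - y‖ ^ 2 ∂(Measure.pi fun _ : Fin m => ν)
      ≤ (α + τ - ρ) / (α + ρ - τ) * ‖y - z‖ ^ 2
        + 2 / (α + ρ - τ) * (2 * L ^ 2 / (m * α) + 4 * ∫ w, e w ∂ν) := by
  have hm' : (0 : ℝ) < m := by exact_mod_cast hm
  have hAX : ∀ w, A w ∈ X := fun w => (hA w).1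
  have hgap := integral_argmin_le hm hX ν hconv hα hAm hA hg he hclose hlip hbd
  set μm : Measure (Fin m → 𝒲) := Measure.pi fun _ => ν
  have haem : ∀ {p : 𝒲 → Prop}, (∀ᵐ w ∂ν, p w) → ∀ᵐ v ∂μm, ∀ i, p (v i) := fun hp =>
    eventually_all.2 fun i =>
      (Measure.tendsto_eval_ae_ae (μ := fun _ : Fin m => ν) (i := i)).eventually hp
  have hI1 : Integrable (fun w => ‖A w - y‖ ^ 2) μm := by
    refine Integrable.of_bound (C := D ^ 2) (by fun_prop) (ae_of_all _ fun w => ?_)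
    rw [Real.norm_of_nonneg (by positivity)]
    gcongr
    exact hD _ (hAX w) _ hy
  have hI2 : Integrable (fun w => ∫ w', g (A w) w' ∂ν) μm := by
    have hmeas : Measurable fun p : (Fin m → 𝒲) × 𝒲 => g (A p.1) p.2 :=
      hg.comp ((hAm.comp measurable_fst).prodMk measurable_snd)
    refine Integrable.of_bound (C := M)
      hmeas.stronglyMeasurable.integral_prod_right.aestronglyMeasurable (ae_of_all _ fun w => ?_)
    refine (norm_integral_le_of_norm_le_const (C := M) ?_).trans (by simp)
    filter_upwards [hbd] with w' hw'
    exact hw' _ (hAX w)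
  have hI3 : Integrable (fun w => 1 / (m : ℝ) * ∑ i, g (A w) (w i)) μm := by
    refine (integrable_finsetSum _ fun i _ => ?_).const_mul _
    refine Integrable.of_bound (C := M)
      (hg.comp (hAm.prodMk (measurable_pi_apply i))).aestronglyMeasurable ?_
    filter_upwards [haem hbd] with v hv
    exact hv i _ (hAX _)
  have hgy : Integrable (fun w => g y w) ν := by
    refine Integrable.of_bound (C := M) hg.of_uncurry_left.aestronglyMeasurable ?_
    filter_upwards [hbd] with v hv
    exact hv _ hy
  have havg : ∀ {h : 𝒲 → ℝ}, Integrable h ν →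
      Integrable (fun w : Fin m → 𝒲 => 1 / (m : ℝ) * ∑ i, h (w i)) μm ∧
      ∫ w : Fin m → 𝒲, 1 / (m : ℝ) * ∑ i, h (w i) ∂μm = ∫ w, h w ∂ν := fun {h} hh => by
    have h1 : ∀ i : Fin m, Integrable (fun w : Fin m → 𝒲 => h (w i)) μm := fun i =>
      integrable_comp_eval (μ := fun _ : Fin m => ν) hh
    refine ⟨(integrable_finsetSum _ fun i _ => h1 i).const_mul _, ?_⟩
    rw [integral_const_mul, integral_finsetSum _ fun i _ => h1 i,
      Finset.sum_congr rfl fun i _ =>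
        integral_comp_eval (μ := fun _ : Fin m => ν) (i := i) hh.aestronglyMeasurable]
    simp [hm'.ne']
  -- Adds the growth of the surrogate at `A w`, tested at `y`, to the growth of `f + ρ/2 ‖· - z‖²`
  -- at `y`, tested at `A w`. The leftover multiple `(ρ + τ - α)/2` of `‖A w - z‖²` is nonpositive
  -- and is dropped.
  have hpt : ∀ᵐ w ∂μm, (α + ρ - τ) / 2 * ‖A w - y‖ ^ 2
      ≤ ((∫ w', g (A w) w' ∂ν) - 1 / (m : ℝ) * ∑ i, g (A w) (w i))
        + (1 / (m : ℝ) * ∑ i, g y (w i) + (((α - ρ) / 2 * ‖y - z‖ ^ 2 - f y)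
        + 2 * (1 / (m : ℝ) * ∑ i, e (w i)))) := by
    filter_upwards [haem hclose] with w hw
    have h1 := (hA w).add_sq_le (strongConvexOn_average hm hX (fun i => hconv (w i)) α z) hy
    rw [average_add_const hm, average_add_const hm] at h1
    have h2 : 1 / (m : ℝ) * ∑ i, g (A w) (w i)
        ≤ 1 / (m : ℝ) * ∑ i, gh (A w) (w i) + 1 / (m : ℝ) * ∑ i, e (w i) := by
      rw [← mul_add, ← Finset.sum_add_distrib]
      gcongr with i _
      have := abs_le.1 (hw i _ (hAX w))
      linarith
    have h3 : 1 / (m : ℝ) * ∑ i, gh y (w i)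
        ≤ 1 / (m : ℝ) * ∑ i, g y (w i) + 1 / (m : ℝ) * ∑ i, e (w i) := by
      rw [← mul_add, ← Finset.sum_add_distrib]
      gcongr with i _
      have := abs_le.1 (hw i _ hy)
      linarith
    have h4 := hlow _ (hAX w)
    have h5 := hprox _ (hAX w)
    have h6 : 0 ≤ ‖A w - z‖ ^ 2 := by positivity
    rw [norm_sub_rev y (A w)] at h1
    nlinarith
  have hE := havg he
  have hG := havg hgy
  have hint := integral_mono_ae (hI1.const_mul ((α + ρ - τ) / 2))
    ((hI2.sub hI3).add (hG.1.add ((integrable_const ((α - ρ) / 2 * ‖y - z‖ ^ 2 - f y)).add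
      (hE.1.const_mul 2)))) hpt
  rw [integral_const_mul, integral_add' (hI2.sub hI3) (hG.1.add ((integrable_const _).add
      (hE.1.const_mul 2))), integral_add' hG.1 ((integrable_const _).add (hE.1.const_mul 2)),
    integral_add' (integrable_const _) (hE.1.const_mul 2), integral_sub' hI2 hI3,
    integral_const_mul (2 : ℝ), hE.2, hG.2] at hint
  simp only [integral_const, probReal_univ, smul_eq_mul, one_mul] at hint
  have hpos : 0 < α + ρ - τ := by linarith
  -- Of the four copies of the mean of `e`, two come from replacing `gh` by `g` at `A w` and at `y`,
  -- and two from the stability estimate.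
  have hfin : (α + ρ - τ) / 2 * ∫ w, ‖A w - y‖ ^ 2 ∂μm ≤ (α + τ - ρ) / 2 * ‖y - z‖ ^ 2
      + (2 * L ^ 2 / (m * α) + 4 * ∫ w, e w ∂ν) := by linarith
  calc ∫ w, ‖A w - y‖ ^ 2 ∂μm
      = 2 / (α + ρ - τ) * ((α + ρ - τ) / 2 * ∫ w, ‖A w - y‖ ^ 2 ∂μm) := by
        field_simp
    _ ≤ 2 / (α + ρ - τ) * ((α + τ - ρ) / 2 * ‖y - z‖ ^ 2
          + (2 * L ^ 2 / (m * α) + 4 * ∫ w, e w ∂ν)) := by gcongr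
    _ = _ := by field_simp

/-! ### Linear algebra of the regression model -/

lemma act_eq {l : ℕ} (A : Matrix (Fin l) (Fin l) ℝ) (v : Vec l) :
    act A v = Matrix.toEuclideanCLM (n := Fin l) (𝕜 := ℝ) A v := rfl

/-- The norm of a matrix induced by the `ℓ₂`-norm. -/
def opNorm {l : ℕ} (A : Matrix (Fin l) (Fin l) ℝ) : ℝ :=
  ‖Matrix.toEuclideanCLM (n := Fin l) (𝕜 := ℝ) A‖

lemma norm_act_le {l : ℕ} (A : Matrix (Fin l) (Fin l) ℝ) (v : Vec l) :
    ‖act A v‖ ≤ opNorm A * ‖v‖ := by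
  rw [act_eq]; exact ContinuousLinearMap.le_opNorm _ _

lemma opNorm_nonneg {l : ℕ} (A : Matrix (Fin l) (Fin l) ℝ) : 0 ≤ opNorm A := norm_nonneg _

lemma opENorm_eq {l : ℕ} (A : Matrix (Fin l) (Fin l) ℝ) :
    opENorm A = ENNReal.ofReal (opNorm A) := (ofReal_norm _).symm

lemma act_add {l : ℕ} (A : Matrix (Fin l) (Fin l) ℝ) (v w : Vec l) :
    act A (v + w) = act A v + act A w := by simp only [act_eq, map_add]

lemma act_sub {l : ℕ} (A : Matrix (Fin l) (Fin l) ℝ) (v w : Vec l) :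
    act A (v - w) = act A v - act A w := by simp only [act_eq, map_sub]

lemma sub_act {l : ℕ} (A A' : Matrix (Fin l) (Fin l) ℝ) (v : Vec l) :
    act (A - A') v = act A v - act A' v := by
  simp only [act_eq, map_sub, sub_apply]

lemma act_mul {l : ℕ} (A A' : Matrix (Fin l) (Fin l) ℝ) (v : Vec l) :
    act (A * A') v = act A (act A' v) := by
  simp only [act_eq, map_mul, mul_apply_eq_comp]

lemma act_one {l : ℕ} (v : Vec l) : act (1 : Matrix (Fin l) (Fin l) ℝ) v = v := by
  simp [act]

lemma act_rows_apply {l : ℕ} (v : Fin l → Vec l) (e : Vec l) (j : Fin l) :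
    act (rows v) e j = inner ℝ e (v j) := by
  simp [act, rows, Matrix.mulVec, dotProduct, PiLp.inner_apply]

lemma continuous_rows {l : ℕ} : Continuous fun v : Fin l → Vec l => rows v := by
  unfold rows
  refine continuous_pi fun j => continuous_pi fun k => ?_
  simp only [Matrix.of_apply]
  fun_prop

lemma continuous_toEuclideanCLM {l : ℕ} :
    Continuous fun A : Matrix (Fin l) (Fin l) ℝ => Matrix.toEuclideanCLM (n := Fin l) (𝕜 := ℝ) A :=
  LinearMap.continuous_of_finiteDimensional
    (⟨⟨Matrix.toEuclideanCLM (n := Fin l) (𝕜 := ℝ), map_add _⟩, map_smul _⟩ :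
      Matrix (Fin l) (Fin l) ℝ →ₗ[ℝ] (Vec l →L[ℝ] Vec l))

/-- Also valid for singular matrices, where both sides vanish. Continuity and measurability of the
inverse thereby reduce to those of the determinant and the adjugate. -/
lemma toEuclideanCLM_inv {l : ℕ} (A : Matrix (Fin l) (Fin l) ℝ) :
    Matrix.toEuclideanCLM (n := Fin l) (𝕜 := ℝ) A⁻¹
      = (A.det)⁻¹ • Matrix.toEuclideanCLM (n := Fin l) (𝕜 := ℝ) A.adjugate := by
  rw [Matrix.inv_def, Ring.inverse_eq_inv', map_smul]

lemma continuous_toEuclideanCLM_rows {l : ℕ} : Continuous fun v : Fin l → Vec l =>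
    Matrix.toEuclideanCLM (n := Fin l) (𝕜 := ℝ) (rows v) :=
  continuous_toEuclideanCLM.comp continuous_rows

lemma measurable_toEuclideanCLM_rows_inv {l : ℕ} : Measurable fun v : Fin l → Vec l =>
    Matrix.toEuclideanCLM (n := Fin l) (𝕜 := ℝ) (rows v)⁻¹ := by
  simp only [toEuclideanCLM_inv]
  exact continuous_rows.matrix_det.measurable.inv.smul
    (continuous_toEuclideanCLM.comp continuous_rows.matrix_adjugate).measurable

lemma norm_toLp_le_sum {l : ℕ} (v : Fin l → ℝ) : ‖(WithLp.toLp 2 v : Vec l)‖ ≤ ∑ j, |v j| := by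
  rw [EuclideanSpace.norm_eq]
  refine Real.sqrt_le_iff.2 ⟨by positivity, ?_⟩
  exact Finset.sum_sq_le_sq_sum_of_nonneg fun i _ => norm_nonneg _

lemma jacAct_add {d l : ℕ} (D : Fin l → Vec d →L[ℝ] Vec l) (e : Vec l) (h h' : Vec d) :
    jacAct D e (h + h') = jacAct D e h + jacAct D e h' := by
  ext j; simp [jacAct, inner_add_right]

lemma jacAct_smul {d l : ℕ} (D : Fin l → Vec d →L[ℝ] Vec l) (e : Vec l) (a : ℝ) (h : Vec d) :
    jacAct D e (a • h) = a • jacAct D e h := by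
  ext j; simp [jacAct, inner_smul_right]

lemma norm_jacAct_le {d l : ℕ} (D : Fin l → Vec d →L[ℝ] Vec l) (e : Vec l) (h : Vec d) :
    ‖jacAct D e h‖ ≤ ‖e‖ * (∑ j, ‖D j‖) * ‖h‖ := by
  refine (norm_toLp_le_sum _).trans ?_
  rw [Finset.mul_sum, Finset.sum_mul]
  gcongr with j _
  calc |inner ℝ e (D j h)| ≤ ‖e‖ * ‖D j h‖ := abs_real_inner_le_norm _ _
    _ ≤ ‖e‖ * (‖D j‖ * ‖h‖) := by gcongr; exact ContinuousLinearMap.le_opNorm _ _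
    _ = _ := by ring

lemma jacAct_sub_jacAct {d l : ℕ} (D D' : Fin l → Vec d →L[ℝ] Vec l) (e e' : Vec l) (h : Vec d) :
    jacAct D e h - jacAct D' e' h
      = jacAct (fun j => D j - D' j) e h + jacAct D' (e - e') h := by
  ext j; simp [jacAct, inner_sub_left, inner_sub_right]

/-- The local model of the response at the reference point `z`. -/
def localModel {d l : ℕ} (c : Vec l) (dc : Vec d →L[ℝ] Vec l) (Q : Matrix (Fin l) (Fin l) ℝ)
    (dq : Fin l → Vec d →L[ℝ] Vec l) (z : Vec d) (e : Vec l) (x : Vec d) : Vec l :=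
  c + dc (x - z) + act Q e + jacAct dq e (x - z)

/-- Affinity in the decision. Composed with the jointly convex `φ`, it makes every model cost
convex, whatever the estimates are. -/
lemma localModel_combo {d l : ℕ} (c : Vec l) (dc : Vec d →L[ℝ] Vec l)
    (Q : Matrix (Fin l) (Fin l) ℝ) (dq : Fin l → Vec d →L[ℝ] Vec l) (z : Vec d) (e : Vec l)
    (x y : Vec d) {a b : ℝ} (hab : a + b = 1) :
    localModel c dc Q dq z e (a • x + b • y)
      = a • localModel c dc Q dq z e x + b • localModel c dc Q dq z e y := by
  have h1 : a • x + b • y - z = a • (x - z) + b • (y - z) := by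
    have : z = (a + b) • z := by rw [hab, one_smul]
    nth_rw 1 [this]
    module
  unfold localModel
  rw [h1, jacAct_add, jacAct_smul, jacAct_smul, map_add, map_smul, map_smul]
  have h2 : ∀ v : Vec l, v = a • v + b • v := fun v => by rw [← add_smul, hab, one_smul]
  nth_rw 1 [h2 c, h2 (act Q e)]
  module

lemma localModel_sub {d l : ℕ} (c : Vec l) (dc : Vec d →L[ℝ] Vec l)
    (Q : Matrix (Fin l) (Fin l) ℝ) (dq : Fin l → Vec d →L[ℝ] Vec l) (z : Vec d) (e : Vec l)
    (x y : Vec d) :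
    localModel c dc Q dq z e x - localModel c dc Q dq z e y = dc (x - y) + jacAct dq e (x - y) := by
  have h1 : x - z = (x - y) + (y - z) := by abel
  unfold localModel
  rw [h1, jacAct_add, map_add]
  abel

lemma localModel_self {d l : ℕ} (c : Vec l) (dc : Vec d →L[ℝ] Vec l)
    (Q : Matrix (Fin l) (Fin l) ℝ) (dq : Fin l → Vec d →L[ℝ] Vec l) (z : Vec d) (e : Vec l) :
    localModel c dc Q dq z e z = c + act Q e := by
  have h : jacAct dq e (0 : Vec d) = 0 := by
    have := jacAct_smul dq e 0 (0 : Vec d)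
    simpa using this
  simp [localModel, h]

lemma continuous_localModel {d l : ℕ} (c : Vec l) (dc : Vec d →L[ℝ] Vec l)
    (Q : Matrix (Fin l) (Fin l) ℝ) (dq : Fin l → Vec d →L[ℝ] Vec l) (z : Vec d) :
    Continuous fun p : Vec d × Vec l => localModel c dc Q dq z p.2 p.1 := by
  unfold localModel jacAct
  simp only [act_eq]
  have : Continuous fun p : Vec d × Vec l =>
      (WithLp.toLp 2 fun j => inner ℝ p.2 (dq j (p.1 - z)) : Vec l) :=
    (PiLp.continuous_toLp 2 _).comp (continuous_pi fun j => by fun_prop)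
  fun_prop

/-- The error of an estimated local model. -/
lemma norm_localModel_sub_le {d l : ℕ} (c c' : Vec l) (dc dc' : Vec d →L[ℝ] Vec l)
    (Q Q' : Matrix (Fin l) (Fin l) ℝ) (dq dq' : Fin l → Vec d →L[ℝ] Vec l) (z : Vec d)
    (e e' : Vec l) (x : Vec d) :
    ‖localModel c dc Q dq z e x - localModel c' dc' Q' dq' z e' x‖
      ≤ ‖c - c'‖ + ‖dc - dc'‖ * ‖x - z‖ + (opNorm (Q - Q') * ‖e‖ + opNorm Q' * ‖e - e'‖)
        + (‖e‖ * (∑ j, ‖dq j - dq' j‖) * ‖x - z‖ + ‖e - e'‖ * (∑ j, ‖dq' j‖) * ‖x - z‖) := by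
  have h : localModel c dc Q dq z e x - localModel c' dc' Q' dq' z e' x
      = (c - c') + (dc - dc') (x - z) + (act (Q - Q') e + act Q' (e - e'))
        + (jacAct (fun j => dq j - dq' j) e (x - z) + jacAct dq' (e - e') (x - z)) := by
    rw [← jacAct_sub_jacAct, sub_act, act_sub, sub_apply]
    unfold localModel
    abel
  rw [h]
  refine norm_add_le_of_le (norm_add_le_of_le (norm_add_le_of_le le_rfl
    (ContinuousLinearMap.le_opNorm _ _)) (norm_add_le_of_le (norm_act_le _ _) (norm_act_le _ _)))
    (norm_add_le_of_le (norm_jacAct_le _ _ _) (norm_jacAct_le _ _ _))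

/-! ### First-order expansions -/

/-- Along the segment from `u` to `x` the first-order remainder has derivative of norm at most `K ‖x
- u‖² t`. The mean value inequality compares it with `K/2 ‖x - u‖² t²`. -/
lemma norm_sub_sub_fderiv_le {d l : ℕ} {O X : Set (Vec d)} (hO : IsOpen O) (hXO : X ⊆ O)
    (hX : Convex ℝ X) {h : Vec d → Vec l} (hh : ContDiffOn ℝ 1 h O) {K : ℝ}
    (hK : ∀ x ∈ O, ∀ y ∈ O, ‖fderiv ℝ h x - fderiv ℝ h y‖ ≤ K * ‖x - y‖) {x u : Vec d}
    (hx : x ∈ X) (hu : u ∈ X) :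
    ‖h x - h u - fderiv ℝ h u (x - u)‖ ≤ K / 2 * ‖x - u‖ ^ 2 := by
  have hmem : ∀ t ∈ Set.Icc (0 : ℝ) 1, u + t • (x - u) ∈ O := fun t ht =>
    hXO (hX.add_smul_sub_mem hu hx ht)
  have hdiff : ∀ t ∈ Set.Icc (0 : ℝ) 1, HasDerivAt (fun t : ℝ =>
      h (u + t • (x - u)) - h u - t • fderiv ℝ h u (x - u))
      (fderiv ℝ h (u + t • (x - u)) (x - u) - fderiv ℝ h u (x - u)) t := by
    intro t ht
    have h1 : HasFDerivAt h (fderiv ℝ h (u + t • (x - u))) (u + t • (x - u)) :=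
      ((hh.differentiableOn one_ne_zero).differentiableAt (hO.mem_nhds (hmem t ht))).hasFDerivAt
    have h2 : HasDerivAt (fun t : ℝ => u + t • (x - u)) (x - u) t := by
      simpa using ((hasDerivAt_id t).smul_const (x - u)).const_add u
    have h3 := h1.comp_hasDerivAt t h2
    have h4 : HasDerivAt (fun t : ℝ => t • fderiv ℝ h u (x - u)) (fderiv ℝ h u (x - u)) t := by
      simpa using (hasDerivAt_id t).smul_const (fderiv ℝ h u (x - u))
    exact (h3.sub_const (h u)).sub h4
  have hB : ∀ t : ℝ, HasDerivAt (fun t : ℝ => K / 2 * ‖x - u‖ ^ 2 * t ^ 2)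
      (K * ‖x - u‖ ^ 2 * t) t := by
    intro t
    have := (hasDerivAt_pow 2 t).const_mul (K / 2 * ‖x - u‖ ^ 2)
    refine this.congr_deriv ?_
    simp
    ring
  have key := image_norm_le_of_norm_deriv_right_le_deriv_boundary'
    (f := fun t : ℝ => h (u + t • (x - u)) - h u - t • fderiv ℝ h u (x - u)) (a := 0) (b := 1)
    (fun t ht => (hdiff t ht).continuousAt.continuousWithinAt)
    (fun t ht => (hdiff t (Set.Ico_subset_Icc_self ht)).hasDerivWithinAt)
    (B := fun t : ℝ => K / 2 * ‖x - u‖ ^ 2 * t ^ 2) (by simp)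
    (fun t _ => (hB t).continuousAt.continuousWithinAt)
    (fun t _ => (hB t).hasDerivWithinAt) (fun t ht => by
      have h0 : u ∈ O := hXO hu
      have h1 := hK _ (hmem t (Set.Ico_subset_Icc_self ht)) u h0
      rw [← sub_apply]
      calc _ ≤ ‖fderiv ℝ h (u + t • (x - u)) - fderiv ℝ h u‖ * ‖x - u‖ :=
            ContinuousLinearMap.le_opNorm _ _
        _ ≤ K * ‖u + t • (x - u) - u‖ * ‖x - u‖ := by gcongr
        _ = K * ‖x - u‖ ^ 2 * t := by
            rw [add_sub_cancel_left, norm_smul, Real.norm_of_nonneg ht.1]; ring)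
    (Set.right_mem_Icc.2 zero_le_one)
  simpa using key

/-! ### The stochastic program -/

namespace Problem

variable {d l : ℕ} {P : Problem d l}

/-- The local model of the response for the exact regression functions. -/
def model (P : Problem d l) (z : Vec d) (e : Vec l) (x : Vec d) : Vec l :=
  localModel (P.c z) (fderiv ℝ P.c z) (P.Q z) (fun j => fderiv ℝ (P.q j) z) z e x

/-- A common bound for the data of the stochastic program on the feasible set. -/
structure BoundedBy (P : Problem d l) (M : ℝ) : Prop where
  nonneg : 0 ≤ M
  norm_sub_le : ∀ x ∈ P.X, ∀ y ∈ P.X, ‖x - y‖ ≤ M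
  norm_c_le : ∀ x ∈ P.X, ‖P.c x‖ ≤ M
  norm_fderiv_c_le : ∀ x ∈ P.X, ‖fderiv ℝ P.c x‖ ≤ M
  opNorm_Q_le : ∀ x ∈ P.X, opNorm (P.Q x) ≤ M
  opNorm_Q_inv_le : ∀ x ∈ P.X, opNorm (P.Q x)⁻¹ ≤ M
  sum_norm_fderiv_q_le : ∀ x ∈ P.X, ∑ j, ‖fderiv ℝ (P.q j) x‖ ≤ M

lemma integral_model_self (P : Problem d l) (u : Vec d) :
    ∫ e, P.φ u (P.model u e u) ∂P.Pε = P.f u := by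
  simp only [model, localModel_self]
  rfl

namespace Regular

lemma abs_φ_sub_le (hP : P.Regular) {x y : Vec d} (hx : x ∈ P.O) (hy : y ∈ P.O) (ξ η : Vec l) :
    |P.φ x ξ - P.φ y η| ≤ P.Lφ * (‖x - y‖ + ‖ξ - η‖) := by
  refine (hP.lipschitz_φ x hx y hy ξ η).trans ?_
  have := hP.Lφ_nonneg
  gcongr
  refine Real.sqrt_le_iff.2 ⟨by positivity, ?_⟩
  nlinarith [norm_nonneg (x - y), norm_nonneg (ξ - η)]

lemma abs_φ_sub_φ_le (hP : P.Regular) {x : Vec d} (hx : x ∈ P.O) (ξ η : Vec l) :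
    |P.φ x ξ - P.φ x η| ≤ P.Lφ * ‖ξ - η‖ := by
  simpa using hP.abs_φ_sub_le hx hx ξ η

lemma continuousOn_φ (hP : P.Regular) : ContinuousOn (fun p : Vec d × Vec l => P.φ p.1 p.2)
    (P.O ×ˢ Set.univ) := by
  refine LipschitzOnWith.continuousOn (K := ⟨P.Lφ * 2, by have := hP.Lφ_nonneg; positivity⟩) ?_
  refine LipschitzOnWith.of_dist_le_mul fun p hp p' hp' => ?_
  rw [Real.dist_eq]
  refine (hP.abs_φ_sub_le hp.1 hp'.1 _ _).trans ?_
  have h1 : ‖p.1 - p'.1‖ ≤ dist p p' := by rw [← dist_eq_norm]; exact le_max_left _ _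
  have h2 : ‖p.2 - p'.2‖ ≤ dist p p' := by rw [← dist_eq_norm]; exact le_max_right _ _
  have := hP.Lφ_nonneg
  calc _ ≤ P.Lφ * (dist p p' + dist p p') := by gcongr
    _ = P.Lφ * 2 * dist p p' := by ring

lemma continuous_φ (hP : P.Regular) {x : Vec d} (hx : x ∈ P.O) : Continuous (P.φ x) := by
  have := hP.continuousOn_φ.comp_continuous (f := fun ξ : Vec l => (x, ξ)) (by fun_prop)
    fun ξ => ⟨hx, trivial⟩
  exact this

lemma continuousOn_c (hP : P.Regular) : ContinuousOn P.c P.O := hP.smooth_c.continuousOn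

lemma continuousOn_Q (hP : P.Regular) : ContinuousOn P.Q P.O :=
  continuous_rows.comp_continuousOn (continuousOn_pi.2 fun j => (hP.smooth_q j).continuousOn)

lemma isUnit_det_Q (hP : P.Regular) {x : Vec d} (hx : x ∈ P.O) : IsUnit (P.Q x).det :=
  (hP.posDef_Q x hx).det_pos.ne'.isUnit

lemma τ_nonneg (hP : P.Regular) : 0 ≤ P.τ := by
  have h1 := hP.Lφ_nonneg
  have h2 := hP.Lc_nonneg
  have h3 := hP.Lq_nonneg
  unfold τ
  positivity

lemma exists_boundedBy (hP : P.Regular) : ∃ M, P.BoundedBy M := by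
  have key : ∀ {F : Type} [NormedAddCommGroup F] (h : Vec d → F), ContinuousOn h P.O →
      ∃ M, 0 ≤ M ∧ ∀ x ∈ P.X, ‖h x‖ ≤ M := fun h hh => by
    obtain ⟨M, hM⟩ := hP.isCompact_X.exists_bound_of_continuousOn (hh.mono hP.X_subset_O)
    exact ⟨max M 0, le_max_right _ _, fun x hx => (hM x hx).trans (le_max_left _ _)⟩
  obtain ⟨M₁, h₁, h₁'⟩ := key (fun x => x) continuousOn_id
  obtain ⟨M₂, h₂, h₂'⟩ := key P.c hP.continuousOn_c
  obtain ⟨M₃, h₃, h₃'⟩ := key (fderiv ℝ P.c)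
    (hP.smooth_c.continuousOn_fderiv_of_isOpen hP.isOpen_O le_rfl)
  obtain ⟨M₄, h₄, h₄'⟩ := key (fun x => Matrix.toEuclideanCLM (n := Fin l) (𝕜 := ℝ) (P.Q x))
    (continuous_toEuclideanCLM.comp_continuousOn hP.continuousOn_Q)
  obtain ⟨M₅, h₅, h₅'⟩ := key (fun x => Matrix.toEuclideanCLM (n := Fin l) (𝕜 := ℝ) (P.Q x)⁻¹) (by
    simp only [toEuclideanCLM_inv]
    have hdet : ContinuousOn (fun x => (P.Q x).det) P.O :=
      (continuous_id.matrix_det).comp_continuousOn hP.continuousOn_Q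
    have hadj : ContinuousOn (fun x => (P.Q x).adjugate) P.O :=
      (continuous_id.matrix_adjugate).comp_continuousOn hP.continuousOn_Q
    exact (hdet.inv₀ fun x hx => (hP.posDef_Q x hx).det_pos.ne').smul
      (continuous_toEuclideanCLM.comp_continuousOn hadj))
  obtain ⟨M₆, h₆, h₆'⟩ := key (fun x => ∑ j, ‖fderiv ℝ (P.q j) x‖)
    (continuousOn_finsetSum _ fun j _ =>
      ((hP.smooth_q j).continuousOn_fderiv_of_isOpen hP.isOpen_O le_rfl).norm)
  refine ⟨2 * M₁ + M₂ + M₃ + M₄ + M₅ + M₆, by positivity, fun x hx y hy => ?_,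
    fun x hx => ?_, fun x hx => ?_, fun x hx => ?_, fun x hx => ?_, fun x hx => ?_⟩
  · have := norm_sub_le_of_le (h₁' x hx) (h₁' y hy)
    linarith
  · have := h₂' x hx
    linarith
  · have := h₃' x hx
    linarith
  · have : opNorm (P.Q x) ≤ M₄ := h₄' x hx
    linarith
  · have : opNorm (P.Q x)⁻¹ ≤ M₅ := h₅' x hx
    linarith
  · have := (le_abs_self _).trans (h₆' x hx)
    linarith

lemma convexOn_φ_localModel (hP : P.Regular) (c : Vec l) (dc : Vec d →L[ℝ] Vec l)
    (Q : Matrix (Fin l) (Fin l) ℝ)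
    (dq : Fin l → Vec d →L[ℝ] Vec l) (z : Vec d) (e : Vec l) :
    ConvexOn ℝ P.X fun x => P.φ x (localModel c dc Q dq z e x) := by
  refine ⟨hP.convex_X, fun x hx y hy a b ha hb hab => ?_⟩
  have := (hP.convex_φ P.X hP.X_subset_O hP.convex_X).2
    (x := (x, localModel c dc Q dq z e x)) ⟨hx, trivial⟩
    (y := (y, localModel c dc Q dq z e y)) ⟨hy, trivial⟩ ha hb hab
  simpa [localModel_combo _ _ _ _ _ _ _ _ hab] using this

lemma abs_φ_localModel_sub_le (hP : P.Regular) (c : Vec l) (dc : Vec d →L[ℝ] Vec l)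
    (Q : Matrix (Fin l) (Fin l) ℝ) (dq : Fin l → Vec d →L[ℝ] Vec l) (z : Vec d) (e : Vec l)
    {x y : Vec d} (hx : x ∈ P.O) (hy : y ∈ P.O) :
    |P.φ x (localModel c dc Q dq z e x) - P.φ y (localModel c dc Q dq z e y)|
      ≤ P.Lφ * (1 + (‖dc‖ + ‖e‖ * ∑ j, ‖dq j‖)) * ‖x - y‖ := by
  refine (hP.abs_φ_sub_le hx hy _ _).trans ?_
  rw [localModel_sub, mul_assoc]
  have := hP.Lφ_nonneg
  gcongr
  have := norm_add_le_of_le (dc.le_opNorm (x - y)) (norm_jacAct_le dq e (x - y))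
  linarith

lemma continuousOn_φ_localModel (hP : P.Regular) (c : Vec l) (dc : Vec d →L[ℝ] Vec l)
    (Q : Matrix (Fin l) (Fin l) ℝ) (dq : Fin l → Vec d →L[ℝ] Vec l) (z : Vec d) :
    ContinuousOn (fun p : Vec d × Vec l => P.φ p.1 (localModel c dc Q dq z p.2 p.1))
      (P.O ×ˢ Set.univ) :=
  hP.continuousOn_φ.comp (f := fun p : Vec d × Vec l => (p.1, localModel c dc Q dq z p.2 p.1))
    (continuous_fst.prodMk (continuous_localModel c dc Q dq z)).continuousOn
    fun _ hp => ⟨hp.1, trivial⟩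

lemma continuous_φ_localModel (hP : P.Regular) (c : Vec l) (dc : Vec d →L[ℝ] Vec l)
    (Q : Matrix (Fin l) (Fin l) ℝ) (dq : Fin l → Vec d →L[ℝ] Vec l) (z : Vec d) {x : Vec d}
    (hx : x ∈ P.O) : Continuous fun e => P.φ x (localModel c dc Q dq z e x) :=
  (hP.continuousOn_φ_localModel c dc Q dq z).comp_continuous (f := fun e : Vec l => (x, e))
    (by fun_prop) fun e => ⟨hx, trivial⟩

lemma continuous_φ_response (hP : P.Regular) {x : Vec d} (hx : x ∈ P.O) :
    Continuous fun e => P.φ x (P.response x e) := by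
  refine (hP.continuous_φ hx).comp ?_
  unfold response
  simp only [act_eq]
  fun_prop

/-- The error is almost surely in a closed ball, which is compact, so a continuous function of it is
almost surely bounded. -/
lemma integrable_of_continuous (hP : P.Regular) {B : ℝ} (hB : ∀ᵐ e ∂P.Pε, ‖e‖ ≤ B) {h : Vec l → ℝ}
    (hh : Continuous h) : Integrable h P.Pε := by
  have := hP.prob_ε
  obtain ⟨K, hK⟩ := (isCompact_closedBall (0 : Vec l) B).exists_bound_of_continuousOn
    hh.continuousOn
  refine Integrable.of_bound (C := K) hh.aestronglyMeasurable ?_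
  filter_upwards [hB] with e he
  exact hK e (by simpa using he)

/-! ### Accuracy of the exact local model, weak convexity of the objective, and its proximal map -/

lemma integral_sq_norm_ε (hP : P.Regular) {B : ℝ} (hB : ∀ᵐ e ∂P.Pε, ‖e‖ ≤ B)
    : ∫ e, ‖e‖ ^ 2 ∂P.Pε = l := by
  have h1 : ∀ e : Vec l, ‖e‖ ^ 2 = ∑ i, e i * e i := fun e => by
    rw [EuclideanSpace.real_norm_sq_eq]
    exact Finset.sum_congr rfl fun i _ => sq _
  simp only [h1]
  rw [integral_finsetSum _ fun i _ => hP.integrable_of_continuous hB (by fun_prop),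
    Finset.sum_congr rfl fun i _ => hP.cov_ε i i]
  simp

/-- The Taylor remainders of the rows contribute at most `√l ‖e‖` times their common bound.
Replacing `√l ‖e‖` by `(l + ‖e‖²)/2` costs nothing in the mean, since the expectation of `‖ε‖²` is
`l`; this reproduces exactly the modulus `τ`. -/
lemma norm_response_sub_model_le (hP : P.Regular) {x u : Vec d} (hx : x ∈ P.X) (hu : u ∈ P.X)
    (e : Vec l) :
    ‖P.response x e - P.model u e x‖
      ≤ (P.Lc / 2 + P.Lq / 2 * ((l + ‖e‖ ^ 2) / 2)) * ‖x - u‖ ^ 2 := by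
  let v : Fin l → Vec l := fun j => P.q j x - P.q j u - fderiv ℝ (P.q j) u (x - u)
  have h : P.response x e - P.model u e x
      = (P.c x - P.c u - fderiv ℝ P.c u (x - u)) + WithLp.toLp 2 fun j => inner ℝ e (v j) := by
    ext j
    simp only [response, model, localModel, Problem.Q, jacAct, PiLp.add_apply, PiLp.sub_apply,
      act_rows_apply, v, inner_sub_right]
    ring
  have hc := norm_sub_sub_fderiv_le hP.isOpen_O hP.X_subset_O hP.convex_X hP.smooth_c
    hP.lipschitz_c hx hu
  have hv : ∀ j, ‖v j‖ ≤ P.Lq / 2 * ‖x - u‖ ^ 2 := fun j =>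
    norm_sub_sub_fderiv_le hP.isOpen_O hP.X_subset_O hP.convex_X (hP.smooth_q j)
      (hP.lipschitz_q j) hx hu
  have hLq := hP.Lq_nonneg
  set β := P.Lq / 2 * ‖x - u‖ ^ 2 with hβ
  have hβ0 : 0 ≤ β := by positivity
  have hw : ‖(WithLp.toLp 2 fun j => inner ℝ e (v j) : Vec l)‖ ≤ (l + ‖e‖ ^ 2) / 2 * β := by
    have h1 : ‖(WithLp.toLp 2 fun j => inner ℝ e (v j) : Vec l)‖ ^ 2 ≤ l * (‖e‖ * β) ^ 2 := by
      rw [EuclideanSpace.real_norm_sq_eq]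
      calc ∑ j, (inner ℝ e (v j)) ^ 2 ≤ ∑ _j : Fin l, (‖e‖ * β) ^ 2 := by
            refine Finset.sum_le_sum fun j _ => ?_
            rw [sq_le_sq, abs_of_nonneg (show 0 ≤ ‖e‖ * β by positivity)]
            exact (abs_real_inner_le_norm _ _).trans (by gcongr; exact hv j)
        _ = l * (‖e‖ * β) ^ 2 := by simp
    refine (sq_le_sq₀ (norm_nonneg _) (by positivity)).1 (h1.trans ?_)
    have h2 : (l : ℝ) * ‖e‖ ^ 2 ≤ ((l + ‖e‖ ^ 2) / 2) ^ 2 := by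
      nlinarith [sq_nonneg ((l : ℝ) - ‖e‖ ^ 2)]
    calc (l : ℝ) * (‖e‖ * β) ^ 2 = (l * ‖e‖ ^ 2) * β ^ 2 := by ring
      _ ≤ ((l + ‖e‖ ^ 2) / 2) ^ 2 * β ^ 2 := by gcongr
      _ = _ := by ring
  rw [h]
  refine (norm_add_le_of_le hc hw).trans (le_of_eq ?_)
  rw [hβ]
  ring

/-- Integrates the pointwise error of the model through the Lipschitz bound of `φ`. This two-sided
estimate is the source of weak convexity, of continuity, and of the comparison of surrogates with
`f`. -/
lemma abs_f_sub_integral_model_le (hP : P.Regular) {B : ℝ} (hB : ∀ᵐ e ∂P.Pε, ‖e‖ ≤ B) {x u : Vec d}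
    (hx : x ∈ P.X) (hu : u ∈ P.X) :
    |P.f x - ∫ e, P.φ x (P.model u e x) ∂P.Pε| ≤ P.τ / 2 * ‖x - u‖ ^ 2 := by
  have := hP.prob_ε
  have hxO := hP.X_subset_O hx
  have hLφ := hP.Lφ_nonneg
  have hi : Integrable (fun e => P.φ x (P.model u e x)) P.Pε :=
    hP.integrable_of_continuous hB (hP.continuous_φ_localModel _ _ _ _ _ hxO)
  unfold f
  rw [← integral_sub (hP.integrable_of_continuous hB (hP.continuous_φ_response hxO)) hi]
  calc |∫ e, (P.φ x (P.response x e) - P.φ x (P.model u e x)) ∂P.Pε|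
      ≤ ∫ e, |P.φ x (P.response x e) - P.φ x (P.model u e x)| ∂P.Pε := abs_integral_le_integral_abs
    _ ≤ ∫ e, P.Lφ * ((P.Lc / 2 + P.Lq / 2 * ((l + ‖e‖ ^ 2) / 2)) * ‖x - u‖ ^ 2) ∂P.Pε := by
        refine integral_mono (hP.integrable_of_continuous hB
          ((hP.continuous_φ_response hxO).sub (hP.continuous_φ_localModel _ _ _ _ _ hxO)).abs)
          (hP.integrable_of_continuous hB (by fun_prop)) fun e => ?_
        refine (hP.abs_φ_sub_φ_le hxO _ _).trans ?_
        gcongr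
        exact hP.norm_response_sub_model_le hx hu e
    _ = P.τ / 2 * ‖x - u‖ ^ 2 := by
        have hi : Integrable (fun e : Vec l => ‖e‖ ^ 2) P.Pε :=
          hP.integrable_of_continuous hB (by fun_prop)
        have h2 : ∀ e : Vec l, P.Lφ * ((P.Lc / 2 + P.Lq / 2 * ((l + ‖e‖ ^ 2) / 2)) * ‖x - u‖ ^ 2)
            = P.Lφ * (P.Lc / 2 + P.Lq / 4 * l) * ‖x - u‖ ^ 2
              + P.Lφ * (P.Lq / 4) * ‖x - u‖ ^ 2 * ‖e‖ ^ 2 := fun e => by ring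
        simp only [h2]
        rw [integral_add (integrable_const _) (hi.const_mul _), integral_const,
          integral_const_mul, hP.integral_sq_norm_ε hB]
        simp only [probReal_univ, smul_eq_mul, one_mul, τ]
        ring

/-- The exact model at the intermediate point `u` is convex, equals `f` at `u`, and exceeds `f` at
`x` and `y` by at most `τ/2` times the squared distances to `u`. The identity `a b² + b a² = a b`
turns these errors into the modulus of weak convexity. -/
lemma strongConvexOn_f (hP : P.Regular) {B : ℝ} (hB : ∀ᵐ e ∂P.Pε, ‖e‖ ≤ B) (ρ : ℝ) (z : Vec d) :
    StrongConvexOn P.X (ρ - P.τ) fun y => P.f y + ρ / 2 * ‖y - z‖ ^ 2 := by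
  refine ⟨hP.convex_X, fun x hx y hy a b ha hb hab => ?_⟩
  set u := a • x + b • y with hu
  have huX : u ∈ P.X := hP.convex_X hx hy ha hb hab
  have hi : ∀ x ∈ P.X, Integrable (fun e => P.φ x (P.model u e x)) P.Pε := fun x hx =>
    hP.integrable_of_continuous hB (hP.continuous_φ_localModel _ _ _ _ _ (hP.X_subset_O hx))
  have h1 : P.f u ≤ a * ∫ e, P.φ x (P.model u e x) ∂P.Pε
      + b * ∫ e, P.φ y (P.model u e y) ∂P.Pε := by
    rw [← P.integral_model_self u, ← integral_const_mul, ← integral_const_mul,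
      ← integral_add ((hi x hx).const_mul a) ((hi y hy).const_mul b)]
    refine integral_mono (hi u huX) (((hi x hx).const_mul a).add ((hi y hy).const_mul b))
      fun e => ?_
    exact (hP.convexOn_φ_localModel (P.c u) (fderiv ℝ P.c u) (P.Q u)
      (fun j => fderiv ℝ (P.q j) u) u e).2 hx hy ha hb hab
  have h2 := (abs_le.1 (hP.abs_f_sub_integral_model_le hB hx huX)).1
  have h3 := (abs_le.1 (hP.abs_f_sub_integral_model_le hB hy huX)).1
  have hxu : ‖x - u‖ = b * ‖x - y‖ := by
    have : x - u = b • (x - y) := by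
      have hx1 : x = (a + b) • x := by rw [hab, one_smul]
      rw [hu]; nth_rw 1 [hx1]; module
    rw [this, norm_smul, Real.norm_of_nonneg hb]
  have hyu : ‖y - u‖ = a * ‖x - y‖ := by
    have : y - u = a • (y - x) := by
      have hy1 : y = (a + b) • y := by rw [hab, one_smul]
      rw [hu]; nth_rw 1 [hy1]; module
    rw [this, norm_smul, Real.norm_of_nonneg ha, norm_sub_rev]
  rw [hxu] at h2
  rw [hyu] at h3
  have h4 := (strongConvexOn_add_sq (convexOn_const 0 hP.convex_X) ρ z).2 hx hy ha hb hab
  simp only [smul_eq_mul, zero_add, ← hu] at h4 ⊢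
  have h5 : a * b ^ 2 + b * a ^ 2 = a * b := by
    calc a * b ^ 2 + b * a ^ 2 = a * b * (a + b) := by ring
      _ = a * b := by rw [hab, mul_one]
  have h6 : a * (P.τ / 2 * (b * ‖x - y‖) ^ 2) + b * (P.τ / 2 * (a * ‖x - y‖) ^ 2)
      = a * b * (P.τ / 2 * ‖x - y‖ ^ 2) := by
    rw [← h5]; ring
  have h7 := mul_le_mul_of_nonneg_left h2 ha
  have h8 := mul_le_mul_of_nonneg_left h3 hb
  linarith

/-- Near `y`, `f` differs quadratically from the averaged model at `y`, which is Lipschitz because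
the bounded error has an integrable Lipschitz factor. -/
lemma continuousOn_f (hP : P.Regular) {B : ℝ}
    (hB : ∀ᵐ e ∂P.Pε, ‖e‖ ≤ B) : ContinuousOn P.f P.X := by
  intro y hy
  have hi : ∀ x ∈ P.X, Integrable (fun e => P.φ x (P.model y e x)) P.Pε := fun x hx =>
    hP.integrable_of_continuous hB (hP.continuous_φ_localModel _ _ _ _ _ (hP.X_subset_O hx))
  let k : Vec l → ℝ := fun e => P.Lφ * (1 + (‖fderiv ℝ P.c y‖ + ‖e‖ * ∑ j, ‖fderiv ℝ (P.q j) y‖))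
  have hk : Integrable k P.Pε := hP.integrable_of_continuous hB (by fun_prop)
  have hbound : ∀ x ∈ P.X, ‖P.f x - P.f y‖
      ≤ P.τ / 2 * ‖x - y‖ ^ 2 + (∫ e, k e ∂P.Pε) * ‖x - y‖ := by
    intro x hx
    have h1 := hP.abs_f_sub_integral_model_le hB hx hy
    have h2 : |(∫ e, P.φ x (P.model y e x) ∂P.Pε) - P.f y| ≤ (∫ e, k e ∂P.Pε) * ‖x - y‖ := by
      rw [← P.integral_model_self y, ← integral_sub (hi x hx) (hi y hy), ← integral_mul_const]
      refine abs_integral_le_integral_abs.trans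
        (integral_mono ((hi x hx).sub (hi y hy)).abs (hk.mul_const _) fun e => ?_)
      exact hP.abs_φ_localModel_sub_le _ _ _ _ _ _ (hP.X_subset_O hx) (hP.X_subset_O hy)
    rw [Real.norm_eq_abs]
    exact (abs_sub_le _ _ _).trans (add_le_add h1 h2)
  have hlim : Tendsto (fun x : Vec d => P.τ / 2 * ‖x - y‖ ^ 2 + (∫ e, k e ∂P.Pε) * ‖x - y‖)
      (𝓝[P.X] y) (𝓝 0) := by
    have : Continuous fun x : Vec d =>
        P.τ / 2 * ‖x - y‖ ^ 2 + (∫ e, k e ∂P.Pε) * ‖x - y‖ := by fun_prop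
    have := this.tendsto y
    simp only [sub_self, norm_zero] at this
    simpa using this.mono_left nhdsWithin_le_nhds
  rw [ContinuousWithinAt, tendsto_iff_norm_sub_tendsto_zero]
  exact squeeze_zero' (Eventually.of_forall fun _ => norm_nonneg _)
    (eventually_nhdsWithin_of_forall hbound) hlim

lemma exists_abs_f_le (hP : P.Regular) {B : ℝ} (hB : ∀ᵐ e ∂P.Pε, ‖e‖ ≤ B) :
    ∃ F : ℝ, 0 ≤ F ∧ ∀ x ∈ P.X, |P.f x| ≤ F := by
  obtain ⟨F, hF⟩ := hP.isCompact_X.exists_bound_of_continuousOn (hP.continuousOn_f hB)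
  exact ⟨max F 0, le_max_right _ _, fun x hx => (hF x hx).trans (le_max_left _ _)⟩

/-- Continuity and compactness give existence of a minimizer, so the choice operator in `prox` does
select one. No lower bound on `ρ` is needed at this point. -/
lemma isArgmin_prox (hP : P.Regular) {B : ℝ} (hB : ∀ᵐ e ∂P.Pε, ‖e‖ ≤ B) (hne : P.X.Nonempty) {ρ : ℝ}
    (x : Vec d) :
    IsArgmin P.X (fun y => P.f y + ρ / 2 * ‖y - x‖ ^ 2) (P.prox (1 / ρ) x) := by
  have h : (fun y : Vec d => P.f y + 1 / (2 * (1 / ρ)) * ‖y - x‖ ^ 2)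
      = fun y => P.f y + ρ / 2 * ‖y - x‖ ^ 2 := by
    funext y
    have : 1 / (2 * (1 / ρ)) = ρ / 2 := by simp [div_eq_mul_inv, mul_comm]
    rw [this]
  have hc : ContinuousOn (fun y => P.f y + ρ / 2 * ‖y - x‖ ^ 2) P.X :=
    (hP.continuousOn_f hB).add (Continuous.continuousOn (by fun_prop))
  have hex := exists_isArgmin hP.isCompact_X hne hc
  rw [← h] at hex ⊢
  exact Classical.epsilon_spec hex

/-- For `ρ > τ` strong convexity makes the chosen minimizer unique, so the choice in `prox` cannot
spoil measurability. -/
lemma measurable_prox (hP : P.Regular) {B : ℝ} (hB : ∀ᵐ e ∂P.Pε, ‖e‖ ≤ B)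
    (hne : P.X.Nonempty) {ρ : ℝ}
    (hρ : P.τ < ρ) : Measurable (P.prox (1 / ρ)) :=
  measurable_of_isArgmin hne (F := fun x y => P.f y + ρ / 2 * ‖y - x‖ ^ 2)
    (fun _ _ => by fun_prop)
    (fun _ => (hP.continuousOn_f hB).add (Continuous.continuousOn (by fun_prop)))
    (sub_pos.2 hρ) (fun x => hP.strongConvexOn_f hB ρ x) fun x => hP.isArgmin_prox hB hne x

end Regular

end Problem

/-! ### Laws of the observations -/

lemma measurable_clm_apply {d l : ℕ} {Θ : Type*} [MeasurableSpace Θ]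
    {D : Θ → Vec d →L[ℝ] Vec l} {v : Θ → Vec d} (hD : Measurable D) (hv : Measurable v) :
    Measurable fun θ => D θ (v θ) := by
  have h : ProperSpace (Vec d →L[ℝ] Vec l) := FiniteDimensional.proper ℝ _
  exact Continuous.measurable2 (c := fun (A : Vec d →L[ℝ] Vec l) x => A x)
    isBoundedBilinearMap_apply.continuous hD hv

namespace Problem

variable {d l : ℕ} {P : Problem d l}

/-- The stochastic program with the regression functions replaced by `0` outside `O`. -/
def trunc (P : Problem d l) : Problem d l :=
  { P with
    c := P.O.indicator P.c
    q := fun j => P.O.indicator (P.q j) }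

lemma trunc_c {x : Vec d} (hx : x ∈ P.O) : P.trunc.c x = P.c x := Set.indicator_of_mem hx _

lemma trunc_Q {x : Vec d} (hx : x ∈ P.O) : P.trunc.Q x = P.Q x := by
  unfold Problem.Q
  congr 1
  funext j
  exact Set.indicator_of_mem hx _

lemma trunc_response {x : Vec d} (hx : x ∈ P.O) (e : Vec l) :
    P.trunc.response x e = P.response x e := by
  rw [response, response, trunc_c hx, trunc_Q hx]

/-- The error recovered from an observation. -/
def error (P : Problem d l) (w : Obs d l) : Vec l := act (P.Q w.1)⁻¹ (w.2 - P.c w.1)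

namespace Regular

lemma measurable_trunc_c (hP : P.Regular) : Measurable P.trunc.c := by
  classical
  have h := ContinuousOn.measurable_piecewise (g := 0) hP.continuousOn_c
    continuous_zero.continuousOn hP.isOpen_O.measurableSet
  rwa [Set.piecewise_eq_indicator] at h

lemma measurable_trunc_q (hP : P.Regular) : Measurable fun x j => P.trunc.q j x := by
  classical
  refine measurable_pi_lambda _ fun j => ?_
  have h := ContinuousOn.measurable_piecewise (g := 0)
    (hP.smooth_q j).continuousOn continuous_zero.continuousOn hP.isOpen_O.measurableSet
  rwa [Set.piecewise_eq_indicator] at h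

lemma measurable_trunc_response (hP : P.Regular) :
    Measurable fun p : Vec d × Vec l => (p.1, P.trunc.response p.1 p.2) := by
  have hc := hP.measurable_trunc_c
  have hQ : Measurable fun x =>
      Matrix.toEuclideanCLM (n := Fin l) (𝕜 := ℝ) (P.trunc.Q x) :=
    continuous_toEuclideanCLM_rows.measurable.comp hP.measurable_trunc_q
  refine measurable_fst.prodMk ((hc.comp measurable_fst).add ?_)
  simp only [act_eq]
  exact measurable_clm_apply (hQ.comp measurable_fst) measurable_snd

lemma measurable_trunc_error (hP : P.Regular) : Measurable P.trunc.error := by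
  have hQ : Measurable fun x =>
      Matrix.toEuclideanCLM (n := Fin l) (𝕜 := ℝ) (P.trunc.Q x)⁻¹ :=
    measurable_toEuclideanCLM_rows_inv.comp hP.measurable_trunc_q
  unfold error
  simp only [act_eq]
  exact measurable_clm_apply (hQ.comp measurable_fst)
    (measurable_snd.sub (hP.measurable_trunc_c.comp measurable_fst))

lemma trunc_error_response (hP : P.Regular) {x : Vec d} (hx : x ∈ P.O) (e : Vec l) :
    P.trunc.error (x, P.response x e) = e := by
  unfold error
  rw [trunc_c hx, trunc_Q hx, response, add_sub_cancel_left, ← act_mul,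
    Matrix.nonsing_inv_mul _ (hP.isUnit_det_Q hx), act_one]

/-- The regression functions are regular only on `O`, so the map defining `obsLaw` need not be
measurable everywhere. When the design is carried by `O`, the truncated functions give an almost
everywhere equal, measurable map and therefore the same law. -/
lemma obsLaw_trunc (hP : P.Regular) {ν : Measure (Vec d)} (hν : ν P.Oᶜ = 0) :
    P.trunc.obsLaw ν = P.obsLaw ν := by
  have := hP.prob_ε
  refine Measure.map_congr ?_
  have h : ∀ᵐ x ∂ν, x ∈ P.O := mem_ae_iff.2 hν
  filter_upwards [Measure.quasiMeasurePreserving_fst.ae h] with p hp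
  rw [trunc_response hp]

lemma isProbabilityMeasure_obsLaw_trunc (hP : P.Regular) (ν : Measure (Vec d))
    [IsProbabilityMeasure ν] : IsProbabilityMeasure (P.trunc.obsLaw ν) := by
  have : IsProbabilityMeasure P.trunc.Pε := hP.prob_ε
  exact Measure.isProbabilityMeasure_map hP.measurable_trunc_response.aemeasurable

/-- Because `Q` is invertible on `O`, the error can be recovered from an observation; its law does
not depend on the design. -/
lemma map_error_obsLaw (hP : P.Regular) {ν : Measure (Vec d)} [IsProbabilityMeasure ν]
    (hν : ν P.Oᶜ = 0) : (P.obsLaw ν).map P.trunc.error = P.Pε := by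
  have : IsProbabilityMeasure P.Pε := hP.prob_ε
  rw [← hP.obsLaw_trunc hν, obsLaw,
    Measure.map_map hP.measurable_trunc_error hP.measurable_trunc_response]
  have h : ∀ᵐ x ∂ν, x ∈ P.O := mem_ae_iff.2 hν
  have heq : P.trunc.error ∘ (fun p : Vec d × Vec l => (p.1, P.trunc.response p.1 p.2))
      =ᵐ[ν.prod P.Pε] Prod.snd := by
    filter_upwards [Measure.quasiMeasurePreserving_fst.ae h] with p hp
    simp only [Function.comp_apply, trunc_response hp, hP.trunc_error_response hp]
  refine (Measure.map_congr heq).trans ?_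
  simp [Measure.map_snd_prod]

lemma map_fst_obsLaw (hP : P.Regular) {ν : Measure (Vec d)} [IsProbabilityMeasure ν]
    (hν : ν P.Oᶜ = 0) : (P.obsLaw ν).map Prod.fst = ν := by
  have : IsProbabilityMeasure P.Pε := hP.prob_ε
  have : IsProbabilityMeasure P.trunc.Pε := hP.prob_ε
  rw [← hP.obsLaw_trunc hν, obsLaw,
    Measure.map_map measurable_fst hP.measurable_trunc_response]
  change (ν.prod P.Pε).map Prod.fst = ν
  simp [Measure.map_fst_prod]

lemma ae_obsLaw (hP : P.Regular) {B : ℝ} (hB : ∀ᵐ e ∂P.Pε, ‖e‖ ≤ B) {ν : Measure (Vec d)}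
    [IsProbabilityMeasure ν] (hν : ν P.Xᶜ = 0) :
    ∀ᵐ w ∂P.obsLaw ν, w.1 ∈ P.X ∧ ‖P.trunc.error w‖ ≤ B
      ∧ w.2 = P.response w.1 (P.trunc.error w) := by
  have : IsProbabilityMeasure P.Pε := hP.prob_ε
  have : IsProbabilityMeasure P.trunc.Pε := hP.prob_ε
  have hνO : ν P.Oᶜ = 0 :=
    measure_mono_null (Set.compl_subset_compl.2 hP.X_subset_O) hν
  have h1 : ∀ᵐ w ∂P.obsLaw ν, w.1 ∈ P.X ∧ ‖P.trunc.error w‖ ≤ B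
      ∧ w.2 = P.trunc.response w.1 (P.trunc.error w) := by
    have hm := hP.measurable_trunc_error
    rw [← hP.obsLaw_trunc hνO, obsLaw, ae_map_iff hP.measurable_trunc_response.aemeasurable]
    · have hX : ∀ᵐ x ∂ν, x ∈ P.X := mem_ae_iff.2 hν
      have hB' : ∀ᵐ e ∂P.trunc.Pε, ‖e‖ ≤ B := hB
      filter_upwards [Measure.quasiMeasurePreserving_fst.ae hX,
        Measure.quasiMeasurePreserving_snd.ae hB'] with p hp hp'
      have hO := hP.X_subset_O hp
      refine ⟨hp, ?_, ?_⟩ <;> simp only [trunc_response hO, hP.trunc_error_response hO]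
      exact hp'
    · refine (hP.isCompact_X.isClosed.measurableSet.preimage measurable_fst).inter
        ((measurableSet_le hm.norm measurable_const).inter (measurableSet_eq_fun measurable_snd ?_))
      exact measurable_snd.comp (hP.measurable_trunc_response.comp (measurable_fst.prodMk hm))
  filter_upwards [h1] with w hw
  exact ⟨hw.1, hw.2.1, hw.2.2.trans (trunc_response (hP.X_subset_O hw.1) _)⟩

end Regular

end Problem

/-! ### Errors of the estimated local model -/

namespace Estimators

variable {d l : ℕ} (est : Estimators d l) {P : Problem d l}

/-- The surrogate function without its proximal term. -/
def modelCost (P : Problem d l) (n : ℕ) (s : Fin n → Obs d l) (z : Vec d) (e : Vec l)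
    (x : Vec d) : ℝ :=
  P.φ x (localModel (est.c n s z) (est.dc n s z) (est.Q n s z) (fun j => est.dq j n s z) z e x)

lemma batchSurrogate_eq (P : Problem d l) (α : ℝ) (n m : ℕ) (s : Fin n → Obs d l)
    (w : Fin m → Obs d l) (z x : Vec d) :
    est.batchSurrogate P α n m s w z x = 1 / (m : ℝ) *
      ∑ i, (est.modelCost P n s z (est.residual n s (w i)) x + α / 2 * ‖x - z‖ ^ 2) := rfl

/-- The size of the estimation errors at the reference point. -/
def localError (P : Problem d l) (n : ℕ) (s : Fin n → Obs d l) (z : Vec d) : ℝ :=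
  ‖est.c n s z - P.c z‖ + ‖est.dc n s z - fderiv ℝ P.c z‖ + opNorm (est.Q n s z - P.Q z)
    + ∑ j, ‖est.dq j n s z - fderiv ℝ (P.q j) z‖

/-- The size of the estimation errors that enter a residual. -/
def residError (P : Problem d l) (n : ℕ) (s : Fin n → Obs d l) (y : Vec d) : ℝ :=
  ‖est.c n s y - P.c y‖ + opNorm ((est.Q n s y)⁻¹ - (P.Q y)⁻¹)

lemma residError_nonneg (P : Problem d l) (n : ℕ) (s : Fin n → Obs d l) (y : Vec d) :
    0 ≤ est.residError P n s y := by
  have := opNorm_nonneg ((est.Q n s y)⁻¹ - (P.Q y)⁻¹)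
  unfold residError
  positivity

/-- The difference is `(Q̂⁻¹ - Q⁻¹)(η - ĉ) - Q⁻¹(ĉ - c)`. The bounds on the error and on `ĉ` keep `η
- ĉ` bounded, so the result is linear in the estimation errors. -/
lemma norm_residual_sub_le (hP : P.Regular) {M B : ℝ} (hM : P.BoundedBy M) {n : ℕ}
    {s : Fin n → Obs d l} {w : Obs d l} {e : Vec l} (hw : w.1 ∈ P.X) (he : ‖e‖ ≤ B)
    (hw2 : w.2 = P.response w.1 e) (hc : ‖est.c n s w.1‖ ≤ B) :
    ‖est.residual n s w - e‖ ≤ (M + M * B + B) * est.residError P n s w.1 := by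
  have hB : 0 ≤ B := (norm_nonneg _).trans he
  have hM0 := hM.nonneg
  have hO := hP.X_subset_O hw
  have he' : e = act (P.Q w.1)⁻¹ (w.2 - P.c w.1) := by
    rw [hw2, Problem.response, add_sub_cancel_left, ← act_mul,
      Matrix.nonsing_inv_mul _ (hP.isUnit_det_Q hO), act_one]
  have hdec : est.residual n s w - e
      = act ((est.Q n s w.1)⁻¹ - (P.Q w.1)⁻¹) (w.2 - est.c n s w.1)
        - act (P.Q w.1)⁻¹ (est.c n s w.1 - P.c w.1) := by
    nth_rw 1 [he']
    rw [residual, sub_act, sub_sub, ← act_add]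
    congr 2
    abel
  have h1 : ‖w.2 - est.c n s w.1‖ ≤ M + M * B + B := by
    refine norm_sub_le_of_le ?_ hc
    rw [hw2]
    refine norm_add_le_of_le (hM.norm_c_le _ hw) ((norm_act_le _ _).trans ?_)
    have := opNorm_nonneg (P.Q w.1)
    gcongr
    exact hM.opNorm_Q_le _ hw
  rw [hdec]
  calc _ ≤ opNorm ((est.Q n s w.1)⁻¹ - (P.Q w.1)⁻¹) * ‖w.2 - est.c n s w.1‖
        + opNorm (P.Q w.1)⁻¹ * ‖est.c n s w.1 - P.c w.1‖ :=
        norm_sub_le_of_le (norm_act_le _ _) (norm_act_le _ _)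
    _ ≤ opNorm ((est.Q n s w.1)⁻¹ - (P.Q w.1)⁻¹) * (M + M * B + B)
        + (M + M * B + B) * ‖est.c n s w.1 - P.c w.1‖ := by
        have := opNorm_nonneg ((est.Q n s w.1)⁻¹ - (P.Q w.1)⁻¹)
        have h2 := hM.opNorm_Q_inv_le _ hw
        have h3 : opNorm (P.Q w.1)⁻¹ ≤ M + M * B + B := by
          have : 0 ≤ M * B := by positivity
          linarith
        gcongr
    _ = _ := by unfold residError; ring

/-- A constant for the error of the estimated local model. -/
def modelConst (P : Problem d l) (M B : ℝ) : ℝ :=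
  P.Lφ * ((1 + M) * (1 + M + B) * (1 + (M + M * B + B)))

lemma modelConst_nonneg (hP : P.Regular) {M B : ℝ} (hM : 0 ≤ M) (hB : 0 ≤ B) :
    0 ≤ modelConst P M B := by
  have := hP.Lφ_nonneg
  unfold modelConst
  positivity

/-- Pure bookkeeping: after inserting the bounds, the right side minus the left side expands into
monomials with nonnegative coefficients. -/
lemma model_error_polynomial_le {M B N V a₁ a₂ a₃ a₄ δ η ζ q D : ℝ} (hM : 0 ≤ M) (hB : 0 ≤ B)
    (hN : 0 ≤ N) (hV : 0 ≤ V) (h₁ : 0 ≤ a₁) (h₂ : 0 ≤ a₂) (h₃ : 0 ≤ a₃) (h₄ : 0 ≤ a₄)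
    (hδ₀ : 0 ≤ δ) (hδ : δ ≤ M) (hη : η ≤ B + N * V) (hζ₀ : 0 ≤ ζ) (hζ : ζ ≤ N * V)
    (hq : q ≤ M) (hD₀ : 0 ≤ D) (hD : D ≤ M) :
    a₁ + a₂ * δ + (a₃ * η + q * ζ) + (η * a₄ * δ + ζ * D * δ)
      ≤ (1 + M) * (1 + M + B) * (1 + N) * (a₁ + a₂ + a₃ + a₄ + V
        + (a₁ + a₂ + a₃ + a₄) * V) := by
  calc _ ≤ a₁ + a₂ * M + (a₃ * (B + N * V) + M * (N * V))
        + ((B + N * V) * a₄ * M + N * V * M * M) := by gcongr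
    _ ≤ _ := by
        rw [← sub_nonneg]
        ring_nf
        positivity

/-- The product term appears because the estimates of `Q` and of its derivatives act on the
estimated residual, whose norm may exceed `B` by a multiple of the residual error. -/
lemma abs_modelCost_sub_le (hP : P.Regular) {M B : ℝ} (hM : P.BoundedBy M) {n : ℕ}
    {s : Fin n → Obs d l} {w : Obs d l} {e : Vec l} (hw : w.1 ∈ P.X) (he : ‖e‖ ≤ B)
    (hw2 : w.2 = P.response w.1 e) (hc : ‖est.c n s w.1‖ ≤ B) {z x : Vec d} (hz : z ∈ P.X)
    (hx : x ∈ P.X) :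
    |est.modelCost P n s z (est.residual n s w) x - P.φ x (P.model z e x)|
      ≤ modelConst P M B * (est.localError P n s z + est.residError P n s w.1
        + est.localError P n s z * est.residError P n s w.1) := by
  have hB : 0 ≤ B := (norm_nonneg _).trans he
  have hM0 := hM.nonneg
  have hLφ := hP.Lφ_nonneg
  have hres := est.norm_residual_sub_le hP hM hw he hw2 hc
  have hV0 := est.residError_nonneg P n s w.1
  set V := est.residError P n s w.1
  set N := M + M * B + B with hN
  have hN0 : 0 ≤ N := by positivity
  have hrn : ‖est.residual n s w‖ ≤ B + N * V := by
    have := norm_le_norm_add_norm_sub' (est.residual n s w) e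
    linarith
  refine (hP.abs_φ_sub_φ_le (hP.X_subset_O hx) _ _).trans ?_
  rw [modelConst, mul_assoc]
  gcongr
  refine (norm_localModel_sub_le _ _ _ _ _ _ _ _ _ _ _ _).trans ?_
  exact model_error_polynomial_le hM0 hB hN0 hV0 (norm_nonneg _) (norm_nonneg _)
    (opNorm_nonneg _) (by positivity) (norm_nonneg _) (hM.norm_sub_le x hx z hz) hrn
    (norm_nonneg _) hres (hM.opNorm_Q_le z hz) (by positivity) (hM.sum_norm_fderiv_q_le z hz)

/-- With `κ = n^{r/2}`, second moments of order `n^{-r}` give a mean of order `n^{-r/2}`. The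
product is absorbed into the squares, so `U` and `V` need not be independent. -/
lemma add_add_mul_le_quadratic {κ : ℝ} (hκ : 1 ≤ κ) (U V : ℝ) :
    U + V + U * V ≤ κ * (U ^ 2 + V ^ 2) + 1 / κ := by
  have hκ0 : 0 < κ := by linarith
  have hs : ∀ x : ℝ, x ≤ κ * x ^ 2 / 2 + 1 / κ / 2 := fun x => by
    have h1 : 0 ≤ (κ * x - 1) ^ 2 / (2 * κ) := by positivity
    have h2 : (κ * x - 1) ^ 2 / (2 * κ) = κ * x ^ 2 / 2 + 1 / κ / 2 - x := by
      field_simp; ring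
    linarith
  have h3 : U * V ≤ κ * ((U ^ 2 + V ^ 2) / 2) := by
    nlinarith [sq_nonneg (U - V), sq_nonneg U, sq_nonneg V,
      mul_nonneg (sub_nonneg.2 hκ) (add_nonneg (sq_nonneg U) (sq_nonneg V))]
  have h1 := hs U
  have h2 := hs V
  linarith

lemma localError_sq_le (P : Problem d l) (n : ℕ) (s : Fin n → Obs d l) (z : Vec d) :
    est.localError P n s z ^ 2 ≤ 4 * (‖est.c n s z - P.c z‖ ^ 2
      + ‖est.dc n s z - fderiv ℝ P.c z‖ ^ 2 + opNorm (est.Q n s z - P.Q z) ^ 2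
      + l * ∑ j, ‖est.dq j n s z - fderiv ℝ (P.q j) z‖ ^ 2) := by
  have h := sq_sum_le_card_mul_sum_sq (s := (Finset.univ : Finset (Fin l)))
    (f := fun j => ‖est.dq j n s z - fderiv ℝ (P.q j) z‖)
  rw [Finset.card_univ, Fintype.card_fin] at h
  unfold localError
  set a := ‖est.c n s z - P.c z‖
  set b := ‖est.dc n s z - fderiv ℝ P.c z‖
  set c := opNorm (est.Q n s z - P.Q z)
  set e := ∑ j, ‖est.dq j n s z - fderiv ℝ (P.q j) z‖
  nlinarith [sq_nonneg (a - b), sq_nonneg (a - c), sq_nonneg (a - e), sq_nonneg (b - c),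
    sq_nonneg (b - e), sq_nonneg (c - e)]

lemma residError_sq_le (P : Problem d l) (n : ℕ) (s : Fin n → Obs d l) (y : Vec d) :
    est.residError P n s y ^ 2 ≤ 2 * (‖est.c n s y - P.c y‖ ^ 2
      + opNorm ((est.Q n s y)⁻¹ - (P.Q y)⁻¹) ^ 2) := by
  unfold residError
  nlinarith [sq_nonneg (‖est.c n s y - P.c y‖ - opNorm ((est.Q n s y)⁻¹ - (P.Q y)⁻¹))]

end Estimators

/-! ### Expected estimation errors -/

lemma integrable_sq_and_integral_le {Ω : Type*} [MeasurableSpace Ω] {μ : Measure Ω} {F : Ω → ℝ}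
    (hF : Measurable F) (h0 : ∀ ω, 0 ≤ F ω) {δ : ℝ} (hδ : 0 ≤ δ)
    (h : ∫⁻ ω, ENNReal.ofReal (F ω) ^ 2 ∂μ ≤ ENNReal.ofReal δ) :
    Integrable (fun ω => F ω ^ 2) μ ∧ ∫ ω, F ω ^ 2 ∂μ ≤ δ := by
  have heq : ∀ ω, ENNReal.ofReal (F ω ^ 2) = ENNReal.ofReal (F ω) ^ 2 := fun ω =>
    ENNReal.ofReal_pow (h0 ω) 2
  have hlin : ∫⁻ ω, ENNReal.ofReal (F ω ^ 2) ∂μ ≤ ENNReal.ofReal δ := by simpa only [heq] using h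
  refine ⟨⟨by fun_prop, ?_⟩, ?_⟩
  · rw [hasFiniteIntegral_iff_ofReal (ae_of_all _ fun ω => sq_nonneg _)]
    exact hlin.trans_lt ENNReal.ofReal_lt_top
  · rw [integral_eq_lintegral_of_nonneg_ae (ae_of_all _ fun ω => sq_nonneg _) (by fun_prop)]
    exact ENNReal.toReal_le_of_le_ofReal hδ hlin

lemma opNorm_sub {l : ℕ} (A A' : Matrix (Fin l) (Fin l) ℝ) :
    opNorm (A - A') = ‖Matrix.toEuclideanCLM (n := Fin l) (𝕜 := ℝ) A
      - Matrix.toEuclideanCLM (n := Fin l) (𝕜 := ℝ) A'‖ := by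
  rw [opNorm, map_sub]

namespace Oracle

variable {d l : ℕ} {P : Problem d l} {𝒪 : Oracle d}

lemma Valid.isProbabilityMeasure_learnDesign (h𝒪 : 𝒪.Valid P) (n : ℕ) (z : Vec d) :
    IsProbabilityMeasure (𝒪.learnDesign n z) := by
  cases 𝒪 with
  | adaptive M => have := (h𝒪 n).1; exact this.isProbabilityMeasure z
  | static ν => exact h𝒪.1

lemma Valid.learnDesign_compl (h𝒪 : 𝒪.Valid P) (hP : P.Regular) (n : ℕ) {z : Vec d}
    (hz : z ∈ P.X) : 𝒪.learnDesign n z P.Oᶜ = 0 := by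
  cases 𝒪 with
  | adaptive M => exact (h𝒪 n).2 z hz
  | static ν => exact measure_mono_null (Set.compl_subset_compl.2 hP.X_subset_O) h𝒪.2

lemma Valid.isProbabilityMeasure_residDesign (h𝒪 : 𝒪.Valid P) (z : Vec d) :
    IsProbabilityMeasure (𝒪.residDesign z) := by
  cases 𝒪 with
  | adaptive M => exact Measure.dirac.isProbabilityMeasure
  | static ν => exact h𝒪.1

lemma Valid.residDesign_compl (h𝒪 : 𝒪.Valid P) (hP : P.Regular) {z : Vec d} (hz : z ∈ P.X) :
    𝒪.residDesign z P.Xᶜ = 0 := by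
  cases 𝒪 with
  | adaptive M =>
    rw [residDesign, Measure.dirac_apply' _ hP.isCompact_X.isClosed.measurableSet.compl]
    simp [hz]
  | static ν => exact h𝒪.2

/-- Residuals use estimates at `y` built from data drawn at `z`, while the error rates concern data
drawn at `y`. The two laws agree: the adaptive oracle has `y = z`, and the static law ignores the
reference point. -/
lemma ae_learnLaw_eq (P : Problem d l) (𝒪 : Oracle d) (n : ℕ) (z : Vec d) :
    ∀ᵐ y ∂𝒪.residDesign z, 𝒪.learnLaw P n y = 𝒪.learnLaw P n z := by
  cases 𝒪 with
  | adaptive M =>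
    have h : ∀ᵐ y ∂Measure.dirac z, y = z := (ae_dirac_iff (measurableSet_singleton z)).2 rfl
    filter_upwards [h] with y hy
    rw [hy]
  | static ν => exact ae_of_all _ fun _ => rfl

lemma Valid.isProbabilityMeasure_obsLaw_learn (h𝒪 : 𝒪.Valid P) (hP : P.Regular) (n : ℕ)
    {z : Vec d} (hz : z ∈ P.X) : IsProbabilityMeasure (P.obsLaw (𝒪.learnDesign n z)) := by
  have := h𝒪.isProbabilityMeasure_learnDesign n z
  rw [← hP.obsLaw_trunc (h𝒪.learnDesign_compl hP n hz)]
  exact hP.isProbabilityMeasure_obsLaw_trunc _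

lemma Valid.residDesign_compl_O (h𝒪 : 𝒪.Valid P) (hP : P.Regular) {z : Vec d} (hz : z ∈ P.X) :
    𝒪.residDesign z P.Oᶜ = 0 :=
  measure_mono_null (Set.compl_subset_compl.2 hP.X_subset_O) (h𝒪.residDesign_compl hP hz)

lemma Valid.isProbabilityMeasure_obsLaw_resid (h𝒪 : 𝒪.Valid P) (hP : P.Regular)
    {z : Vec d} (hz : z ∈ P.X) : IsProbabilityMeasure (P.obsLaw (𝒪.residDesign z)) := by
  have := h𝒪.isProbabilityMeasure_residDesign z
  rw [← hP.obsLaw_trunc (h𝒪.residDesign_compl_O hP hz)]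
  exact hP.isProbabilityMeasure_obsLaw_trunc _

lemma Valid.isProbabilityMeasure_learnLaw (h𝒪 : 𝒪.Valid P) (hP : P.Regular) (n : ℕ)
    {z : Vec d} (hz : z ∈ P.X) : IsProbabilityMeasure (𝒪.learnLaw P n z) := by
  have := h𝒪.isProbabilityMeasure_obsLaw_learn hP n hz
  unfold learnLaw
  infer_instance

/-- The design points of the residual data set lie in the feasible set, and the learning data set
at the reference point has the law that it would have there. -/
lemma Valid.ae_obsLaw_resid (h𝒪 : 𝒪.Valid P) (hP : P.Regular) (n : ℕ) {z : Vec d}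
    (hz : z ∈ P.X) : ∀ᵐ w ∂P.obsLaw (𝒪.residDesign z),
      w.1 ∈ P.X ∧ 𝒪.learnLaw P n w.1 = 𝒪.learnLaw P n z := by
  have := h𝒪.isProbabilityMeasure_residDesign z
  have h1 : ∀ᵐ y ∂𝒪.residDesign z, y ∈ P.X := mem_ae_iff.2 (h𝒪.residDesign_compl hP hz)
  have h2 := h1.and (ae_learnLaw_eq P 𝒪 n z)
  rw [← hP.map_fst_obsLaw (h𝒪.residDesign_compl_O hP hz)] at h2
  exact ae_of_ae_map measurable_fst.aemeasurable h2

end Oracle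

namespace Estimators

variable {d l : ℕ} {est : Estimators d l} {P : Problem d l} {𝒪 : Oracle d}

lemma WellPosed.measurable_rows (hest : est.WellPosed P 𝒪) (n : ℕ) :
    Measurable fun p : (Fin n → Obs d l) × Vec d => fun j => est.q j n p.1 p.2 :=
  measurable_pi_lambda _ fun j => hest.meas_q j n

lemma WellPosed.measurable_Q (hest : est.WellPosed P 𝒪) (n : ℕ) :
    Measurable fun p : (Fin n → Obs d l) × Vec d =>
      Matrix.toEuclideanCLM (n := Fin l) (𝕜 := ℝ) (est.Q n p.1 p.2) :=
  continuous_toEuclideanCLM_rows.measurable.comp (hest.measurable_rows n)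

lemma WellPosed.measurable_Q_inv (hest : est.WellPosed P 𝒪) (n : ℕ) :
    Measurable fun p : (Fin n → Obs d l) × Vec d =>
      Matrix.toEuclideanCLM (n := Fin l) (𝕜 := ℝ) (est.Q n p.1 p.2)⁻¹ :=
  measurable_toEuclideanCLM_rows_inv.comp (hest.measurable_rows n)

lemma WellPosed.measurable_localError (hest : est.WellPosed P 𝒪) (n : ℕ) (z : Vec d) :
    Measurable fun s => est.localError P n s z := by
  have hz : Measurable fun s : Fin n → Obs d l => (s, z) := by fun_prop
  have h1 := (hest.meas_c n).comp hz
  have h2 := (hest.meas_dc n).comp hz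
  have h3 := (hest.measurable_Q n).comp hz
  have h4 := fun j => (hest.meas_dq j n).comp hz
  unfold localError
  simp only [opNorm_sub]
  exact (((h1.sub_const _).norm.add (h2.sub_const _).norm).add (h3.sub_const _).norm).add
    (Finset.measurable_sum _ fun j _ => ((h4 j).sub_const _).norm)

/-- The mean squared estimation error at the reference point. -/
lemma Rate.integral_localError_sq_le (hest : est.WellPosed P 𝒪) {r C : ℝ}
    (hrate : est.Rate P 𝒪 r C) (hC : 0 ≤ C) {n : ℕ} (hn : 0 < n) {z : Vec d} (hz : z ∈ P.X) :
    Integrable (fun s => est.localError P n s z ^ 2) (𝒪.learnLaw P n z) ∧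
      ∫ s, est.localError P n s z ^ 2 ∂𝒪.learnLaw P n z
        ≤ 4 * (3 + l * l) * (C * (n : ℝ) ^ (-r)) := by
  have hz' : Measurable fun s : Fin n → Obs d l => (s, z) := by fun_prop
  have hδ : 0 ≤ C * (n : ℝ) ^ (-r) := by positivity
  set δ := C * (n : ℝ) ^ (-r) with hδdef
  obtain ⟨i1, b1⟩ := integrable_sq_and_integral_le (μ := 𝒪.learnLaw P n z)
    (F := fun s => ‖est.c n s z - P.c z‖) (((hest.meas_c n).comp hz').sub_const _).norm
    (fun _ => norm_nonneg _) hδ (by simpa only [ofReal_norm] using hrate.mse_c n hn z hz)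
  obtain ⟨i2, b2⟩ := integrable_sq_and_integral_le (μ := 𝒪.learnLaw P n z)
    (F := fun s => ‖est.dc n s z - fderiv ℝ P.c z‖)
    (((hest.meas_dc n).comp hz').sub_const _).norm
    (fun _ => norm_nonneg _) hδ (by simpa only [ofReal_norm] using hrate.mse_dc n hn z hz)
  obtain ⟨i3, b3⟩ := integrable_sq_and_integral_le (μ := 𝒪.learnLaw P n z)
    (F := fun s => opNorm (est.Q n s z - P.Q z))
    (by simp only [opNorm_sub]; exact (((hest.measurable_Q n).comp hz').sub_const _).norm)
    (fun _ => opNorm_nonneg _) hδ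
    (by simpa only [opENorm_eq] using hrate.mse_Q n hn z hz)
  have h4 := fun j => integrable_sq_and_integral_le (μ := 𝒪.learnLaw P n z)
    (F := fun s => ‖est.dq j n s z - fderiv ℝ (P.q j) z‖)
    (((hest.meas_dq j n).comp hz').sub_const _).norm
    (fun _ => norm_nonneg _) hδ (by simpa only [ofReal_norm] using hrate.mse_dq j n hn z hz)
  have i4 : Integrable (fun s => ∑ j, ‖est.dq j n s z - fderiv ℝ (P.q j) z‖ ^ 2)
      (𝒪.learnLaw P n z) := integrable_finsetSum _ fun j _ => (h4 j).1
  have b4 : ∫ s, ∑ j, ‖est.dq j n s z - fderiv ℝ (P.q j) z‖ ^ 2 ∂𝒪.learnLaw P n z ≤ l * δ := by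
    rw [integral_finsetSum _ fun j _ => (h4 j).1]
    calc _ ≤ ∑ _j : Fin l, δ := Finset.sum_le_sum fun j _ => (h4 j).2
      _ = l * δ := by simp
  have hdom := (((i1.add i2).add i3).add (i4.const_mul (l : ℝ))).const_mul 4
  have hint : Integrable (fun s => est.localError P n s z ^ 2) (𝒪.learnLaw P n z) := by
    refine hdom.mono' ((hest.measurable_localError n z).pow_const 2).aestronglyMeasurable
      (ae_of_all _ fun s => ?_)
    rw [Real.norm_of_nonneg (sq_nonneg _)]
    exact est.localError_sq_le P n s z
  refine ⟨hint, (integral_mono hint hdom fun s => est.localError_sq_le P n s z).trans ?_⟩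
  rw [integral_const_mul, integral_add' ((i1.add i2).add i3) (i4.const_mul _),
    integral_add' (i1.add i2) i3, integral_add' i1 i2, integral_const_mul]
  have : (l : ℝ) * ∫ s, ∑ j, ‖est.dq j n s z - fderiv ℝ (P.q j) z‖ ^ 2 ∂𝒪.learnLaw P n z
      ≤ l * (l * δ) := by gcongr
  linarith

lemma WellPosed.measurable_residError (hest : est.WellPosed P 𝒪) (hP : P.Regular) (n : ℕ) :
    Measurable fun p : (Fin n → Obs d l) × Obs d l => est.residError P.trunc n p.1 p.2.1 := by
  have hy : Measurable fun p : (Fin n → Obs d l) × Obs d l => (p.1, p.2.1) := by fun_prop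
  have hy' : Measurable fun p : (Fin n → Obs d l) × Obs d l => p.2.1 := by fun_prop
  have h1 := (hest.meas_c n).comp hy
  have h2 := (hest.measurable_Q_inv n).comp hy
  have h3 := hP.measurable_trunc_c.comp hy'
  have h4 := (measurable_toEuclideanCLM_rows_inv.comp hP.measurable_trunc_q).comp hy'
  unfold residError
  simp only [opNorm_sub]
  exact (h1.sub h3).norm.add (h2.sub h4).norm

lemma residError_trunc {n : ℕ} {s : Fin n → Obs d l} {y : Vec d} (hy : y ∈ P.O) :
    est.residError P.trunc n s y = est.residError P n s y := by
  rw [residError, residError, Problem.trunc_c hy, Problem.trunc_Q hy]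

/-- The mean squared estimation error at the design points of the residual data set. -/
lemma Rate.integral_residError_sq_le (hest : est.WellPosed P 𝒪) (hP : P.Regular)
    (h𝒪 : 𝒪.Valid P) {r C : ℝ} (hrate : est.Rate P 𝒪 r C) (hC : 0 ≤ C) {n : ℕ} (hn : 0 < n)
    {z : Vec d} (hz : z ∈ P.X) :
    Integrable (fun p : (Fin n → Obs d l) × Obs d l => est.residError P.trunc n p.1 p.2.1 ^ 2)
        ((𝒪.learnLaw P n z).prod (P.obsLaw (𝒪.residDesign z))) ∧
      ∫ p, est.residError P.trunc n p.1 p.2.1 ^ 2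
        ∂((𝒪.learnLaw P n z).prod (P.obsLaw (𝒪.residDesign z)))
        ≤ 4 * (C * (n : ℝ) ^ (-r)) := by
  have hΛ := h𝒪.isProbabilityMeasure_learnLaw hP n hz
  have hν := h𝒪.isProbabilityMeasure_obsLaw_resid hP hz
  have hae := h𝒪.ae_obsLaw_resid hP n hz
  have hδ : 0 ≤ C * (n : ℝ) ^ (-r) := by positivity
  set δ := C * (n : ℝ) ^ (-r) with hδdef
  set Λ := 𝒪.learnLaw P n z
  set ν := P.obsLaw (𝒪.residDesign z)
  have hy : Measurable fun p : (Fin n → Obs d l) × Obs d l => (p.1, p.2.1) := by fun_prop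
  have hy' : Measurable fun p : (Fin n → Obs d l) × Obs d l => p.2.1 := by fun_prop
  have m1 : Measurable fun p : (Fin n → Obs d l) × Obs d l =>
      ‖est.c n p.1 p.2.1 - P.trunc.c p.2.1‖ :=
    (((hest.meas_c n).comp hy).sub (hP.measurable_trunc_c.comp hy')).norm
  have m2 : Measurable fun p : (Fin n → Obs d l) × Obs d l =>
      opNorm ((est.Q n p.1 p.2.1)⁻¹ - (P.trunc.Q p.2.1)⁻¹) := by
    simp only [opNorm_sub]
    exact (((hest.measurable_Q_inv n).comp hy).sub
      ((measurable_toEuclideanCLM_rows_inv.comp hP.measurable_trunc_q).comp hy')).norm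
  have key : ∀ F : (Fin n → Obs d l) × Obs d l → ℝ, Measurable F → (∀ p, 0 ≤ F p) →
      (∀ᵐ w ∂ν, ∫⁻ s, ENNReal.ofReal (F (s, w)) ^ 2 ∂Λ ≤ ENNReal.ofReal δ) →
      Integrable (fun p => F p ^ 2) (Λ.prod ν) ∧ ∫ p, F p ^ 2 ∂(Λ.prod ν) ≤ δ := by
    intro F hF h0 hle
    refine integrable_sq_and_integral_le hF h0 hδ ?_
    -- Integrating over the learning data first, for a fixed residual point, is what makes the
    -- pointwise error rates applicable.
    rw [lintegral_prod_symm' _ (hF.ennreal_ofReal.pow_const 2)]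
    calc _ ≤ ∫⁻ _w, ENNReal.ofReal δ ∂ν := lintegral_mono_ae hle
      _ = ENNReal.ofReal δ := by simp
  obtain ⟨i1, b1⟩ := key _ m1 (fun _ => norm_nonneg _) (by
    filter_upwards [hae] with w hw
    have := hrate.mse_c n hn w.1 hw.1
    rw [hw.2] at this
    simpa only [ofReal_norm, Problem.trunc_c (hP.X_subset_O hw.1)] using this)
  obtain ⟨i2, b2⟩ := key _ m2 (fun _ => opNorm_nonneg _) (by
    filter_upwards [hae] with w hw
    have := hrate.mse_Qinv n hn w.1 hw.1
    rw [hw.2] at this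
    simpa only [opENorm_eq, Problem.trunc_Q (hP.X_subset_O hw.1)] using this)
  have hdom := (i1.add i2).const_mul 2
  have hint : Integrable (fun p : (Fin n → Obs d l) × Obs d l =>
      est.residError P.trunc n p.1 p.2.1 ^ 2) (Λ.prod ν) := by
    refine hdom.mono' ((hest.measurable_residError hP n).pow_const 2).aestronglyMeasurable
      (ae_of_all _ fun p => ?_)
    rw [Real.norm_of_nonneg (sq_nonneg _)]
    exact est.residError_sq_le P.trunc n p.1 p.2.1
  refine ⟨hint, (integral_mono hint hdom
    fun p => est.residError_sq_le P.trunc n p.1 p.2.1).trans ?_⟩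
  rw [integral_const_mul, integral_add' i1 i2]
  linarith

end Estimators

/-! ### One iteration of the algorithm -/

lemma integral_trunc_error {d l : ℕ} {P : Problem d l} (hP : P.Regular) {ν : Measure (Vec d)}
    [IsProbabilityMeasure ν] (hν : ν P.Oᶜ = 0) {h : Vec l → ℝ} (hh : Continuous h) :
    ∫ w, h (P.trunc.error w) ∂P.obsLaw ν = ∫ e, h e ∂P.Pε := by
  rw [← hP.map_error_obsLaw hν,
    integral_map hP.measurable_trunc_error.aemeasurable hh.aestronglyMeasurable]

/-- The constant of the estimation error in the bound for one iteration. -/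
def estimationConst {d l : ℕ} (P : Problem d l) (M B C : ℝ) : ℝ :=
  4 * (Estimators.modelConst P M B * (4 * (4 + l * l) * C + 1))

/-- The bound for the Lipschitz constants of the local models. -/
def lipConst {d l : ℕ} (P : Problem d l) (M B : ℝ) : ℝ := P.Lφ * (1 + (M + B * M))

/-- For fixed learning data the residual observations are still i.i.d., so the stability estimate
applies to the estimated model. Integrating over the learning data afterwards turns its random error
into the estimation rate. -/
lemma integral_sq_dist_prox_le {d l : ℕ} {P : Problem d l} {𝒪 : Oracle d} {est : Estimators d l}
    {r C B M : ℝ} (hr : 0 < r) (hP : P.Regular) (h𝒪 : 𝒪.Valid P) (hest : est.WellPosed P 𝒪)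
    (hbdd : est.Bounded P 𝒪 B) (hrate : est.Rate P 𝒪 r C) (hC : 0 ≤ C) (hM : P.BoundedBy M)
    {n m : ℕ} (hn : 0 < n) (hm : 0 < m) {α ρ : ℝ} (hα : 0 < α) (hρ : P.τ < ρ)
    (hρα : ρ + P.τ ≤ α) {z : Vec d} (hz : z ∈ P.X)
    {A : (Fin n → Obs d l) × (Fin m → Obs d l) → Vec d} (hAm : Measurable A)
    (hA : ∀ p, IsArgmin P.X (est.batchSurrogate P α n m p.1 p.2 z) (A p)) :
    ∫ p, ‖A p - P.prox (1 / ρ) z‖ ^ 2 ∂𝒪.dataLaw P n m z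
      ≤ (α + P.τ - ρ) / (α + ρ - P.τ) * ‖P.prox (1 / ρ) z - z‖ ^ 2
        + 2 / (α + ρ - P.τ) * (2 * lipConst P M B ^ 2 / (m * α)
          + estimationConst P M B C / (n : ℝ) ^ (r / 2)) := by
  have hB := hbdd.bdd_ε
  have hPε := hP.prob_ε
  have hB0 : 0 ≤ B := by
    obtain ⟨e, he⟩ := hB.exists
    exact (norm_nonneg _).trans he
  have hLφ := hP.Lφ_nonneg
  have hΛ := h𝒪.isProbabilityMeasure_learnLaw hP n hz
  have hν := h𝒪.isProbabilityMeasure_obsLaw_resid hP hz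
  have hdes := h𝒪.isProbabilityMeasure_residDesign z
  have hdesO := h𝒪.residDesign_compl_O hP hz
  have hae := h𝒪.ae_obsLaw_resid hP n hz
  have hobs := hP.ae_obsLaw hB (h𝒪.residDesign_compl hP hz)
  obtain ⟨iU, bU⟩ := hrate.integral_localError_sq_le hest hC hn hz
  obtain ⟨iV, bV⟩ := hrate.integral_residError_sq_le hest hP h𝒪 hC hn hz
  have hprox : IsArgmin P.X (fun y => P.f y + ρ / 2 * ‖y - z‖ ^ 2) (P.prox (1 / ρ) z) :=
    hP.isArgmin_prox hB ⟨z, hz⟩ z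
  set y := P.prox (1 / ρ) z
  set Λ := 𝒪.learnLaw P n z
  set ν := P.obsLaw (𝒪.residDesign z)
  have hn' : (1 : ℝ) ≤ n := by exact_mod_cast hn
  -- This weight balances `κ n^{-r}` against `1/κ`.
  set κ := (n : ℝ) ^ (r / 2) with hκdef
  have hκ : 1 ≤ κ := Real.one_le_rpow hn' (by positivity)
  have hκ0 : 0 < κ := by linarith
  set K := Estimators.modelConst P M B with hK
  have hK0 : 0 ≤ K := Estimators.modelConst_nonneg hP hM.nonneg hB0
  let err : (Fin n → Obs d l) × Obs d l → ℝ := fun p =>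
    K * (κ * (est.localError P n p.1 z ^ 2 + est.residError P.trunc n p.1 p.2.1 ^ 2) + 1 / κ)
  have iU' : Integrable (fun p : (Fin n → Obs d l) × Obs d l => est.localError P n p.1 z ^ 2)
      (Λ.prod ν) := iU.comp_fst ν
  have ierr : Integrable err (Λ.prod ν) :=
    (((iU'.add iV).const_mul κ).add (integrable_const _)).const_mul K
  have berr : ∫ p, err p ∂(Λ.prod ν) ≤ K * (4 * (4 + l * l) * C + 1) / κ := by
    have hUeq : ∫ p : (Fin n → Obs d l) × Obs d l, est.localError P n p.1 z ^ 2 ∂(Λ.prod ν)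
        = ∫ s, est.localError P n s z ^ 2 ∂Λ := by
      rw [integral_prod _ iU']
      simp
    have h1 : ∫ p, err p ∂(Λ.prod ν) = K * (κ * ((∫ s, est.localError P n s z ^ 2 ∂Λ)
        + ∫ p : (Fin n → Obs d l) × Obs d l, est.residError P.trunc n p.1 p.2.1 ^ 2 ∂(Λ.prod ν))
        + 1 / κ) := by
      have iUV : Integrable (fun p : (Fin n → Obs d l) × Obs d l => κ *
          (est.localError P n p.1 z ^ 2 + est.residError P.trunc n p.1 p.2.1 ^ 2)) (Λ.prod ν) :=
        (iU'.add iV).const_mul κ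
      rw [integral_const_mul, integral_add iUV (integrable_const _), integral_const_mul,
        integral_add iU' iV, hUeq]
      simp
    have hn2 : (n : ℝ) ^ (-r) = 1 / (κ * κ) := by
      rw [hκdef, ← Real.rpow_add (by linarith), Real.rpow_neg (by linarith), one_div]
      congr 2
      ring
    rw [h1, mul_div_assoc]
    refine mul_le_mul_of_nonneg_left ?_ hK0
    calc _ ≤ κ * (4 * (3 + l * l) * (C * (n : ℝ) ^ (-r)) + 4 * (C * (n : ℝ) ^ (-r))) + 1 / κ := by
          gcongr
      _ = _ := by rw [hn2]; field_simp; ring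
  have hcost : ContinuousOn (fun p : Vec d × Vec l => P.φ p.1 (P.model z p.2 p.1))
      (P.O ×ˢ Set.univ) := hP.continuousOn_φ_localModel _ _ _ _ _
  have hXO : P.X ×ˢ (Set.univ : Set (Vec l)) ⊆ P.O ×ˢ Set.univ :=
    Set.prod_mono hP.X_subset_O subset_rfl
  -- Cutting off outside `X` makes the exact model cost jointly measurable on the whole space
  -- without changing it where it is used.
  let g : Vec d → Obs d l → ℝ := fun x w =>
    (P.X ×ˢ (Set.univ : Set (Vec l))).indicator
      (fun p : Vec d × Vec l => P.φ p.1 (P.model z p.2 p.1)) (x, P.trunc.error w)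
  have hgX : ∀ x ∈ P.X, ∀ w, g x w = P.φ x (P.model z (P.trunc.error w) x) := fun x hx w =>
    Set.indicator_of_mem (s := P.X ×ˢ (Set.univ : Set (Vec l))) ⟨hx, trivial⟩ _
  have hg : Measurable (Function.uncurry g) := by
    classical
    have h1 := ContinuousOn.measurable_piecewise (g := 0) (hcost.mono hXO)
      continuous_zero.continuousOn
      (hP.isCompact_X.isClosed.measurableSet.prod MeasurableSet.univ)
    rw [Set.piecewise_eq_indicator] at h1
    exact h1.comp (measurable_fst.prodMk (hP.measurable_trunc_error.comp measurable_snd))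
  obtain ⟨G, hG⟩ := (hP.isCompact_X.prod
    (isCompact_closedBall (0 : Vec l) B)).exists_bound_of_continuousOn
      (hcost.mono (Set.prod_mono hP.X_subset_O (Set.subset_univ _)))
  have hbd : ∀ᵐ w ∂ν, ∀ x ∈ P.X, |g x w| ≤ G := by
    filter_upwards [hobs] with w hw x hx
    rw [hgX x hx]
    exact hG (x, P.trunc.error w) ⟨hx, by simpa using hw.2.1⟩
  have hlip : ∀ᵐ w ∂ν, ∀ x ∈ P.X, ∀ y ∈ P.X, |g x w - g y w| ≤ lipConst P M B * ‖x - y‖ := by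
    filter_upwards [hobs] with w hw x hx x' hx'
    rw [hgX x hx, hgX x' hx']
    refine (hP.abs_φ_localModel_sub_le _ _ _ _ _ _ (hP.X_subset_O hx)
      (hP.X_subset_O hx')).trans ?_
    have h1 := hM.norm_fderiv_c_le z hz
    have h2 := hM.sum_norm_fderiv_q_le z hz
    have h3 := hw.2.1
    unfold lipConst
    gcongr
  have hint : ∀ x ∈ P.X, ∫ w, g x w ∂ν = ∫ e, P.φ x (P.model z e x) ∂P.Pε := fun x hx => by
    simp only [hgX x hx]
    exact integral_trunc_error hP hdesO
      (hP.continuous_φ_localModel _ _ _ _ _ (hP.X_subset_O hx))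
  have hgood : ∀ᵐ s ∂Λ, ∀ᵐ w ∂ν, ‖est.c n s w.1‖ ≤ B := by
    have hmeas : MeasurableSet {p : (Fin n → Obs d l) × Obs d l | ‖est.c n p.1 p.2.1‖ ≤ B} :=
      measurableSet_le ((hest.meas_c n).comp
        (by fun_prop : Measurable fun p : (Fin n → Obs d l) × Obs d l => (p.1, p.2.1))).norm
        measurable_const
    -- The hypothesis bounds the estimate for each point, for almost every learning sample; the
    -- reverse order of the quantifiers is needed and follows from joint measurability.
    rw [Measure.ae_ae_comm (p := fun s (w : Obs d l) => ‖est.c n s w.1‖ ≤ B) hmeas]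
    filter_upwards [hae] with w hw
    have := hbdd.bdd_c n hn w.1 hw.1
    rwa [hw.2] at this
  have hmain : ∀ᵐ s ∂Λ, ∫ w, ‖A (s, w) - y‖ ^ 2 ∂(Measure.pi fun _ : Fin m => ν)
      ≤ (α + P.τ - ρ) / (α + ρ - P.τ) * ‖y - z‖ ^ 2
        + 2 / (α + ρ - P.τ) * (2 * lipConst P M B ^ 2 / (m * α)
          + 4 * ∫ w, err (s, w) ∂ν) := by
    filter_upwards [hgood, ierr.prod_right_ae] with s hs hi
    refine integral_sq_dist_argmin_le hm hP.convex_X ν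
      (gh := fun x w => est.modelCost P n s z (est.residual n s w) x) (g := g)
      (e := fun w => err (s, w)) (fun w => hP.convexOn_φ_localModel _ _ _ _ _ _) hα
      (hAm.comp measurable_prodMk_left) (fun w => hA (s, w)) hg hi ?_ hlip hbd hM.norm_sub_le
      (f := P.f) hprox.1 hρ hρα ?_ ?_ ?_
    · filter_upwards [hs, hobs] with w hw hw' x hx
      rw [hgX x hx]
      refine (est.abs_modelCost_sub_le hP hM hw'.1 hw'.2.1 hw'.2.2 hw hz hx).trans ?_
      rw [← Estimators.residError_trunc (hP.X_subset_O hw'.1)]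
      exact mul_le_mul_of_nonneg_left (Estimators.add_add_mul_le_quadratic hκ _ _) hK0
    · intro x hx
      rw [hint x hx]
      have := (abs_le.1 (hP.abs_f_sub_integral_model_le hB hx hz)).2
      linarith
    · rw [hint y hprox.1]
      have := (abs_le.1 (hP.abs_f_sub_integral_model_le hB hprox.1 hz)).1
      linarith
    · exact fun x hx => hprox.add_sq_le (hP.strongConvexOn_f hB ρ z) hx
  have hAint : Integrable (fun p => ‖A p - y‖ ^ 2)
      (Λ.prod (Measure.pi fun _ : Fin m => ν)) := by
    refine Integrable.of_bound (C := M ^ 2) (by fun_prop) (ae_of_all _ fun p => ?_)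
    rw [Real.norm_of_nonneg (by positivity)]
    gcongr
    exact hM.norm_sub_le _ (hA p).1 _ hprox.1
  have hpos : 0 < α + ρ - P.τ := by linarith
  have hfin := integral_mono_ae hAint.integral_prod_left
    ((integrable_const ((α + P.τ - ρ) / (α + ρ - P.τ) * ‖y - z‖ ^ 2)).add
      (((integrable_const (2 * lipConst P M B ^ 2 / (m * α))).add
        (ierr.integral_prod_left.const_mul 4)).const_mul (2 / (α + ρ - P.τ)))) hmain
  rw [← integral_prod _ hAint, integral_add' (integrable_const _)
      (((integrable_const _).add (ierr.integral_prod_left.const_mul 4)).const_mul _),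
    integral_const_mul (2 / (α + ρ - P.τ)),
    integral_add' (integrable_const _) (ierr.integral_prod_left.const_mul 4),
    integral_const_mul (4 : ℝ), ← integral_prod _ ierr] at hfin
  simp only [integral_const, probReal_univ, smul_eq_mul, one_mul] at hfin
  refine hfin.trans ?_
  unfold estimationConst
  rw [← hK]
  gcongr
  calc 4 * ∫ p, err p ∂(Λ.prod ν) ≤ 4 * (K * (4 * (4 + l * l) * C + 1) / κ) := by gcongr
    _ = _ := by ring

/-! ### The sampling kernel -/

/-- By the π-λ theorem it suffices to test on boxes, where the product measure is a finite product
of measurable functions. -/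
lemma measurable_measure_pi {α β : Type*} [MeasurableSpace α] [MeasurableSpace β] {ι : Type*}
    [Fintype ι] {κ : α → Measure β} [∀ a, IsProbabilityMeasure (κ a)] (hκ : Measurable κ) :
    Measurable fun a => Measure.pi fun _ : ι => κ a := by
  refine Measurable.measure_of_isPiSystem_of_isProbabilityMeasure generateFrom_pi.symm
    isPiSystem_pi ?_
  rintro _ ⟨s, hs, rfl⟩
  simp only [Measure.pi_pi]
  exact Finset.measurable_prod _ fun i _ =>
    (Measure.measurable_coe (hs i (Set.mem_univ i))).comp hκ

lemma measurable_measure_prod {α β γ : Type*} [MeasurableSpace α] [MeasurableSpace β]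
    [MeasurableSpace γ] {κ : α → Measure β} {η : α → Measure γ}
    [∀ a, IsProbabilityMeasure (κ a)] [∀ a, IsProbabilityMeasure (η a)] (hκ : Measurable κ)
    (hη : Measurable η) : Measurable fun a => (κ a).prod (η a) := by
  refine Measurable.measure_of_isPiSystem_of_isProbabilityMeasure generateFrom_prod.symm
    isPiSystem_prod ?_
  rintro _ ⟨s, hs, t, ht, rfl⟩
  simp only [Measure.prod_prod]
  exact ((Measure.measurable_coe hs).comp hκ).mul ((Measure.measurable_coe ht).comp hη)

namespace Oracle

variable {d l : ℕ} {P : Problem d l} {𝒪 : Oracle d}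

lemma Valid.measurable_learnDesign (h𝒪 : 𝒪.Valid P) (n : ℕ) :
    Measurable fun z => 𝒪.learnDesign n z := by
  cases 𝒪 with
  | adaptive M => exact (M n).measurable
  | static ν => exact measurable_const

lemma measurable_residDesign (𝒪 : Oracle d) : Measurable fun z => 𝒪.residDesign z := by
  cases 𝒪 with
  | adaptive M => exact Measure.measurable_dirac
  | static ν => exact measurable_const

lemma measurable_obsLaw_trunc (hP : P.Regular) {D : Vec d → Measure (Vec d)}
    [∀ z, IsProbabilityMeasure (D z)] (hD : Measurable D) :
    Measurable fun z => P.trunc.obsLaw (D z) := by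
  have : IsProbabilityMeasure P.trunc.Pε := hP.prob_ε
  exact (Measure.measurable_map _ hP.measurable_trunc_response).comp
    (measurable_measure_prod hD measurable_const)

/-- Truncation makes this hold at every reference point, including those outside `X`, so that a
Markov kernel on the whole space results. -/
lemma Valid.isProbabilityMeasure_dataLaw_trunc (h𝒪 : 𝒪.Valid P) (hP : P.Regular) (n m : ℕ)
    (z : Vec d) : IsProbabilityMeasure (𝒪.dataLaw P.trunc n m z) := by
  have h1 := h𝒪.isProbabilityMeasure_learnDesign n z
  have h2 := h𝒪.isProbabilityMeasure_residDesign z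
  have h3 := hP.isProbabilityMeasure_obsLaw_trunc (𝒪.learnDesign n z)
  have h4 := hP.isProbabilityMeasure_obsLaw_trunc (𝒪.residDesign z)
  unfold dataLaw learnLaw residLaw
  infer_instance

lemma Valid.measurable_dataLaw_trunc (h𝒪 : 𝒪.Valid P) (hP : P.Regular) (n m : ℕ) :
    Measurable fun z => 𝒪.dataLaw P.trunc n m z := by
  have h1 := fun z => h𝒪.isProbabilityMeasure_learnDesign n z
  have h2 := fun z => h𝒪.isProbabilityMeasure_residDesign z
  have h3 := fun z => hP.isProbabilityMeasure_obsLaw_trunc (𝒪.learnDesign n z)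
  have h4 := fun z => hP.isProbabilityMeasure_obsLaw_trunc (𝒪.residDesign z)
  have h5 : ∀ z, IsProbabilityMeasure (𝒪.learnLaw P.trunc n z) := fun z => by
    unfold learnLaw; infer_instance
  have h6 : ∀ z, IsProbabilityMeasure (𝒪.residLaw P.trunc m z) := fun z => by
    unfold residLaw; infer_instance
  exact measurable_measure_prod
    (measurable_measure_pi (measurable_obsLaw_trunc hP (h𝒪.measurable_learnDesign n)))
    (measurable_measure_pi (measurable_obsLaw_trunc hP 𝒪.measurable_residDesign))

lemma Valid.dataLaw_trunc (h𝒪 : 𝒪.Valid P) (hP : P.Regular) (n m : ℕ) {z : Vec d}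
    (hz : z ∈ P.X) : 𝒪.dataLaw P.trunc n m z = 𝒪.dataLaw P n m z := by
  unfold dataLaw learnLaw residLaw
  rw [hP.obsLaw_trunc (h𝒪.learnDesign_compl hP n hz),
    hP.obsLaw_trunc (h𝒪.residDesign_compl_O hP hz)]

/-- The law of the data sets as a function of the reference point. -/
def dataKernel (h𝒪 : 𝒪.Valid P) (hP : P.Regular) (n m : ℕ) :
    Kernel (Vec d) ((Fin n → Obs d l) × (Fin m → Obs d l)) :=
  ⟨fun z => 𝒪.dataLaw P.trunc n m z, h𝒪.measurable_dataLaw_trunc hP n m⟩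

lemma isMarkovKernel_dataKernel (h𝒪 : 𝒪.Valid P) (hP : P.Regular) (n m : ℕ) :
    IsMarkovKernel (dataKernel h𝒪 hP n m) :=
  ⟨fun z => h𝒪.isProbabilityMeasure_dataLaw_trunc hP n m z⟩

lemma dataKernel_apply (h𝒪 : 𝒪.Valid P) (hP : P.Regular) (n m : ℕ) {z : Vec d}
    (hz : z ∈ P.X) : dataKernel h𝒪 hP n m z = 𝒪.dataLaw P n m z :=
  h𝒪.dataLaw_trunc hP n m hz

end Oracle

/-! ### The update map of the algorithm -/

namespace Estimators

variable {d l : ℕ} {est : Estimators d l} {P : Problem d l} {𝒪 : Oracle d}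

lemma WellPosed.measurable_batchSurrogate (hest : est.WellPosed P 𝒪) (hP : P.Regular) (α : ℝ)
    (n m : ℕ) {x : Vec d} (hx : x ∈ P.X) :
    Measurable fun θ : Vec d × (Fin n → Obs d l) × (Fin m → Obs d l) =>
      est.batchSurrogate P α n m θ.2.1 θ.2.2 θ.1 x := by
  have hz : Measurable fun θ : Vec d × (Fin n → Obs d l) × (Fin m → Obs d l) => (θ.2.1, θ.1) := by
    fun_prop
  have hx' : Measurable fun θ : Vec d × (Fin n → Obs d l) × (Fin m → Obs d l) => x - θ.1 := by
    fun_prop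
  have hres : ∀ i, Measurable fun θ : Vec d × (Fin n → Obs d l) × (Fin m → Obs d l) =>
      est.residual n θ.2.1 (θ.2.2 i) := by
    intro i
    have hy : Measurable fun θ : Vec d × (Fin n → Obs d l) × (Fin m → Obs d l) =>
        (θ.2.1, (θ.2.2 i).1) := by fun_prop
    have hQ := (hest.measurable_Q_inv n).comp hy
    have hc := (hest.meas_c n).comp hy
    have hη : Measurable fun θ : Vec d × (Fin n → Obs d l) × (Fin m → Obs d l) => (θ.2.2 i).2 := by
      fun_prop
    have hv := hη.sub hc
    exact measurable_clm_apply hQ hv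
  simp only [batchSurrogate_eq]
  refine (Finset.measurable_sum _ fun i _ => ?_).const_mul _
  refine Measurable.add ?_ (by fun_prop)
  refine (hP.continuous_φ (hP.X_subset_O hx)).measurable.comp ?_
  have h1 := (hest.meas_c n).comp hz
  have h2 := measurable_clm_apply ((hest.meas_dc n).comp hz) hx'
  have h3 := measurable_clm_apply ((hest.measurable_Q n).comp hz) (hres i)
  have h4 : Measurable fun θ : Vec d × (Fin n → Obs d l) × (Fin m → Obs d l) =>
      jacAct (fun j => est.dq j n θ.2.1 θ.1) (est.residual n θ.2.1 (θ.2.2 i)) (x - θ.1) :=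
    (PiLp.continuous_toLp 2 _).measurable.comp (measurable_pi_lambda _ fun j =>
      (hres i).inner (measurable_clm_apply ((hest.meas_dq j n).comp hz) hx'))
  exact ((h1.add h2).add h3).add h4

lemma strongConvexOn_batchSurrogate (hP : P.Regular) (α : ℝ) {n m : ℕ} (hm : 0 < m)
    (s : Fin n → Obs d l) (w : Fin m → Obs d l) (z : Vec d) :
    StrongConvexOn P.X α (est.batchSurrogate P α n m s w z) :=
  strongConvexOn_average hm hP.convex_X (fun _ => hP.convexOn_φ_localModel _ _ _ _ _ _) α z

lemma continuousOn_batchSurrogate (hP : P.Regular) (α : ℝ) {n m : ℕ}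
    (s : Fin n → Obs d l) (w : Fin m → Obs d l) (z : Vec d) :
    ContinuousOn (est.batchSurrogate P α n m s w z) P.X := by
  refine continuousOn_const.mul (continuousOn_finsetSum _ fun i _ => ContinuousOn.add ?_
    (Continuous.continuousOn (by fun_prop)))
  exact (hP.continuousOn_φ_localModel _ _ _ _ _).comp
    (f := fun x : Vec d => (x, est.residual n s (w i))) (by fun_prop)
    fun x hx => ⟨hP.X_subset_O hx, trivial⟩

/-- Expresses the update as a measurable function of the reference point and the data, which lets
the next iterate be integrated against the sampling kernel. -/
lemma WellPosed.exists_measurable_argmin (hest : est.WellPosed P 𝒪) (hP : P.Regular)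
    (hne : P.X.Nonempty) {α : ℝ} (hα : 0 < α) (n : ℕ) {m : ℕ} (hm : 0 < m) :
    ∃ A : Vec d × (Fin n → Obs d l) × (Fin m → Obs d l) → Vec d, Measurable A ∧
      ∀ θ, IsArgmin P.X (est.batchSurrogate P α n m θ.2.1 θ.2.2 θ.1) (A θ) := by
  choose A hA using fun θ : Vec d × (Fin n → Obs d l) × (Fin m → Obs d l) =>
    exists_isArgmin hP.isCompact_X hne
      (continuousOn_batchSurrogate (est := est) hP α θ.2.1 θ.2.2 θ.1)
  refine ⟨A, ?_, hA⟩
  refine measurable_of_isArgmin (σ := α) hne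
    (F := fun θ x => est.batchSurrogate P α n m θ.2.1 θ.2.2 θ.1 x) ?_ ?_ hα ?_ ?_
  · exact fun x hx => hest.measurable_batchSurrogate hP α n m hx
  · exact fun θ => continuousOn_batchSurrogate hP α θ.2.1 θ.2.2 θ.1
  · exact fun θ => strongConvexOn_batchSurrogate hP α hm θ.2.1 θ.2.2 θ.1
  · exact hA

end Estimators

/-! ### Runs of the algorithm -/

namespace Run

variable {d l : ℕ} {P : Problem d l} {𝒪 : Oracle d} {est : Estimators d l} {n m : ℕ → ℕ}
  {α : ℕ → ℝ} {T : ℕ} {Ω : Type*} [mΩ : MeasurableSpace Ω] {μ : Measure Ω}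

lemma nonempty_X (R : Run P 𝒪 est n m α T μ) : P.X.Nonempty :=
  let ⟨x, hx, _⟩ := R.z_init
  ⟨x, hx⟩

lemma measurable_z (R : Run P 𝒪 est n m α T μ) {t : ℕ} (ht : t ≤ T + 1) : Measurable (R.z t) :=
  (R.z_adapted t ht).mono (R.ℱ.le t) le_rfl

lemma measurable_data (R : Run P 𝒪 est n m α T μ) {t : ℕ} (ht : t ≤ T) :
    Measurable fun ω => (R.S t ω, R.W t ω) :=
  ((R.S_adapted t ht).mono (R.ℱ.le (t + 1)) le_rfl).prodMk
    ((R.W_adapted t ht).mono (R.ℱ.le (t + 1)) le_rfl)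

lemma ae_z_mem (R : Run P 𝒪 est n m α T μ) {t : ℕ} (ht : t ≤ T + 1) : ∀ᵐ ω ∂μ, R.z t ω ∈ P.X := by
  cases t with
  | zero =>
    obtain ⟨x, hx, h⟩ := R.z_init
    exact ae_of_all _ fun ω => by rw [h]; exact hx
  | succ t =>
    filter_upwards [R.step t (by omega)] with ω hω
    exact hω.1

/-- Conditional sampling, rewritten as a disintegration: the events `z t ∈ E` belong to the past,
and rectangles determine the joint law. The kernel only has to agree with the data law on `X`, where
the iterate lies almost surely. -/
lemma map_z_data (R : Run P 𝒪 est n m α T μ) [IsProbabilityMeasure μ] (hP : P.Regular)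
    (h𝒪 : 𝒪.Valid P) {t : ℕ} (ht : t ≤ T) :
    μ.map (fun ω => (R.z t ω, R.S t ω, R.W t ω))
      = (μ.map (R.z t)) ⊗ₘ Oracle.dataKernel h𝒪 hP (n t) (m t) := by
  have hz := R.measurable_z (show t ≤ T + 1 by omega)
  have hd := R.measurable_data ht
  have hmk := Oracle.isMarkovKernel_dataKernel h𝒪 hP (n t) (m t)
  have hpm : IsProbabilityMeasure (μ.map (R.z t)) :=
    Measure.isProbabilityMeasure_map hz.aemeasurable
  have hpm2 : IsProbabilityMeasure (μ.map fun ω => (R.z t ω, R.S t ω, R.W t ω)) :=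
    Measure.isProbabilityMeasure_map (hz.prodMk hd).aemeasurable
  refine Measure.ext_prod fun {E A} hE hA => ?_
  rw [Measure.map_apply (hz.prodMk hd) (hE.prod hA), Measure.compProd_apply_prod hE hA,
    setLIntegral_map hE (Kernel.measurable_coe _ hA) hz]
  have hD : MeasurableSet[R.ℱ t] (R.z t ⁻¹' E) := R.z_adapted t (by omega) hE
  refine Eq.trans ?_ ((R.sampling t ht _ hD A hA).trans ?_)
  · rfl
  · refine lintegral_congr_ae (ae_restrict_of_ae ?_)
    filter_upwards [R.ae_z_mem (show t ≤ T + 1 by omega)] with ω hω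
    rw [Oracle.dataKernel_apply h𝒪 hP _ _ hω]

end Run

namespace Problem.Regular

variable {d l : ℕ} {P : Problem d l}

/-- Only the values of `f` on `X` are controlled; since proximal points lie in `X`, `f` may be
replaced by a measurable extension. -/
lemma measurable_f_prox (hP : P.Regular) {B : ℝ} (hB : ∀ᵐ e ∂P.Pε, ‖e‖ ≤ B)
    (hne : P.X.Nonempty) {ρ : ℝ} (hρ : P.τ < ρ) :
    Measurable fun x => P.f (P.prox (1 / ρ) x) := by
  classical
  have h := ContinuousOn.measurable_piecewise (g := 0) (hP.continuousOn_f hB)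
    continuous_zero.continuousOn hP.isCompact_X.isClosed.measurableSet
  have heq : (fun x => P.f (P.prox (1 / ρ) x))
      = fun x => P.X.piecewise P.f 0 (P.prox (1 / ρ) x) := by
    funext x
    rw [Set.piecewise_eq_of_mem _ _ _ (hP.isArgmin_prox hB hne (ρ := ρ) x).1]
  rw [heq]
  exact h.comp (hP.measurable_prox hB hne hρ)

end Problem.Regular

/-- The bound for the errors of one iteration. -/
def stepError {d l : ℕ} (P : Problem d l) (M B C r : ℝ) (n m : ℕ) (α : ℝ) : ℝ :=
  2 * lipConst P M B ^ 2 / (m * α) + estimationConst P M B C / (n : ℝ) ^ (r / 2)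

namespace Run

variable {d l : ℕ} {P : Problem d l} {𝒪 : Oracle d} {est : Estimators d l} {n m : ℕ → ℕ}
  {α : ℕ → ℝ} {T : ℕ} {Ω : Type*} [mΩ : MeasurableSpace Ω] {μ : Measure Ω} [IsProbabilityMeasure μ]

/-! ### Expected progress of one iteration and descent of the Moreau envelope -/

lemma integrable_sq_dist_prox (R : Run P 𝒪 est n m α T μ) (hP : P.Regular) {B M : ℝ}
    (hB : ∀ᵐ e ∂P.Pε, ‖e‖ ≤ B) (hM : P.BoundedBy M) {ρ : ℝ} (hρ : P.τ < ρ) {s t : ℕ}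
    (hs : s ≤ T + 1) (ht : t ≤ T + 1) :
    Integrable (fun ω => ‖R.z s ω - P.prox (1 / ρ) (R.z t ω)‖ ^ 2) μ := by
  have h1 := R.measurable_z hs
  have h2 := (hP.measurable_prox hB R.nonempty_X hρ).comp (R.measurable_z ht)
  refine Integrable.of_bound (C := M ^ 2) ((h1.sub h2).norm.pow_const 2).aestronglyMeasurable ?_
  filter_upwards [R.ae_z_mem hs] with ω hω
  rw [Real.norm_of_nonneg (by positivity)]
  gcongr
  exact hM.norm_sub_le _ hω _ (hP.isArgmin_prox hB R.nonempty_X _).1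

lemma integrable_f_prox (R : Run P 𝒪 est n m α T μ) (hP : P.Regular) {B : ℝ}
    (hB : ∀ᵐ e ∂P.Pε, ‖e‖ ≤ B) {ρ : ℝ} (hρ : P.τ < ρ) {t : ℕ} (ht : t ≤ T + 1) :
    Integrable (fun ω => P.f (P.prox (1 / ρ) (R.z t ω))) μ := by
  obtain ⟨F, -, hF⟩ := hP.exists_abs_f_le hB
  refine Integrable.of_bound (C := F)
    ((hP.measurable_f_prox hB R.nonempty_X hρ).comp (R.measurable_z ht)).aestronglyMeasurable
    (ae_of_all _ fun ω => ?_)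
  exact hF _ (hP.isArgmin_prox hB R.nonempty_X _).1

/-- Disintegrating over the current iterate reduces the claim to a fixed reference point, where
`integral_sq_dist_prox_le` applies. -/
lemma integral_sq_dist_succ_le {r C B M : ℝ} (R : Run P 𝒪 est n m α T μ) (hr : 0 < r)
    (hP : P.Regular) (h𝒪 : 𝒪.Valid P) (hest : est.WellPosed P 𝒪) (hbdd : est.Bounded P 𝒪 B)
    (hrate : est.Rate P 𝒪 r C) (hC : 0 ≤ C) (hM : P.BoundedBy M) {t : ℕ} (ht : t ≤ T)
    (hn : 0 < n t) (hm : 0 < m t) (hα : 0 < α t) {ρ : ℝ} (hρ : P.τ < ρ) (hρα : ρ + P.τ ≤ α t) :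
    ∫ ω, ‖R.z (t + 1) ω - P.prox (1 / ρ) (R.z t ω)‖ ^ 2 ∂μ
      ≤ (α t + P.τ - ρ) / (α t + ρ - P.τ) * ∫ ω, ‖R.z t ω - P.prox (1 / ρ) (R.z t ω)‖ ^ 2 ∂μ
        + 2 / (α t + ρ - P.τ) * stepError P M B C r (n t) (m t) (α t) := by
  have hB := hbdd.bdd_ε
  have hne := R.nonempty_X
  have hz := R.measurable_z (show t ≤ T + 1 by omega)
  have hd := R.measurable_data ht
  have hmk := Oracle.isMarkovKernel_dataKernel h𝒪 hP (n t) (m t)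
  have hpm : IsProbabilityMeasure (μ.map (R.z t)) :=
    Measure.isProbabilityMeasure_map hz.aemeasurable
  have hproxm := hP.measurable_prox hB hne hρ
  obtain ⟨A, hAm, hA⟩ := hest.exists_measurable_argmin hP hne hα (n t) hm
  -- Strong convexity makes the minimizer unique, so the iterate of the run coincides with the
  -- measurable update map almost surely.
  have hstep : ∀ᵐ ω ∂μ, R.z (t + 1) ω = A (R.z t ω, R.S t ω, R.W t ω) := by
    filter_upwards [R.step t ht] with ω hω
    have h1 := Estimators.strongConvexOn_batchSurrogate (est := est) hP (α t) hm (R.S t ω)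
      (R.W t ω) (R.z t ω)
    have h2 := hA (R.z t ω, R.S t ω, R.W t ω)
    exact hω.unique hα h1 h2
  let H : Vec d × (Fin (n t) → Obs d l) × (Fin (m t) → Obs d l) → ℝ := fun θ =>
    ‖A θ - P.prox (1 / ρ) θ.1‖ ^ 2
  have hH : Measurable H := (hAm.sub (hproxm.comp measurable_fst)).norm.pow_const 2
  have hHint : Integrable H ((μ.map (R.z t)) ⊗ₘ Oracle.dataKernel h𝒪 hP (n t) (m t)) := by
    refine Integrable.of_bound (C := M ^ 2) hH.aestronglyMeasurable (ae_of_all _ fun θ => ?_)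
    rw [Real.norm_of_nonneg (by positivity)]
    simp only [H]
    gcongr
    exact hM.norm_sub_le _ (hA θ).1 _ (hP.isArgmin_prox hB hne _).1
  have hXae : ∀ᵐ z ∂μ.map (R.z t), z ∈ P.X :=
    (ae_map_iff hz.aemeasurable hP.isCompact_X.isClosed.measurableSet).2
      (R.ae_z_mem (show t ≤ T + 1 by omega))
  have hGm : Measurable fun z : Vec d => ‖z - P.prox (1 / ρ) z‖ ^ 2 :=
    (measurable_id.sub hproxm).norm.pow_const 2
  have hGint : Integrable (fun z => ‖z - P.prox (1 / ρ) z‖ ^ 2) (μ.map (R.z t)) := by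
    refine Integrable.of_bound (C := M ^ 2) hGm.aestronglyMeasurable ?_
    filter_upwards [hXae] with z hz
    rw [Real.norm_of_nonneg (by positivity)]
    gcongr
    exact hM.norm_sub_le _ hz _ (hP.isArgmin_prox hB hne _).1
  calc ∫ ω, ‖R.z (t + 1) ω - P.prox (1 / ρ) (R.z t ω)‖ ^ 2 ∂μ
      = ∫ ω, H (R.z t ω, R.S t ω, R.W t ω) ∂μ := by
        refine integral_congr_ae ?_
        filter_upwards [hstep] with ω hω
        simp only [H, hω]
    _ = ∫ z, ∫ p, H (z, p) ∂Oracle.dataKernel h𝒪 hP (n t) (m t) z ∂μ.map (R.z t) := by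
        rw [← Measure.integral_compProd hHint, ← R.map_z_data hP h𝒪 ht,
          integral_map (hz.prodMk hd).aemeasurable hH.aestronglyMeasurable]
    _ ≤ ∫ z, ((α t + P.τ - ρ) / (α t + ρ - P.τ) * ‖z - P.prox (1 / ρ) z‖ ^ 2
        + 2 / (α t + ρ - P.τ) * stepError P M B C r (n t) (m t) (α t)) ∂μ.map (R.z t) := by
        refine integral_mono_ae hHint.integral_compProd
          ((hGint.const_mul _).add (integrable_const _)) ?_
        filter_upwards [hXae] with z hz
        rw [Oracle.dataKernel_apply h𝒪 hP _ _ hz, norm_sub_rev z]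
        exact integral_sq_dist_prox_le hr hP h𝒪 hest hbdd hrate hC hM hn hm hα hρ hρα hz
          (A := fun p => A (z, p)) (hAm.comp measurable_prodMk_left) fun p => hA (z, p)
    _ = _ := by
        rw [integral_add (hGint.const_mul _) (integrable_const _), integral_const_mul,
          integral_map hz.aemeasurable hGm.aestronglyMeasurable]
        simp

/-- The expected value of the Moreau envelope at an iterate. -/
def envelope (R : Run P 𝒪 est n m α T μ) (ρ : ℝ) (t : ℕ) : ℝ :=
  ∫ ω, P.f (P.prox (1 / ρ) (R.z t ω)) ∂μ
    + ρ / 2 * ∫ ω, ‖R.z t ω - P.prox (1 / ρ) (R.z t ω)‖ ^ 2 ∂μ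

/-- The envelope is at least the value of `f` at the proximal point, and at most `f(z)`, by testing
the proximal problem at `z` itself. The bound does not depend on `ρ`, so the varying `ρ t` cause no
loss in the telescoping sum. -/
lemma abs_envelope_bounds (R : Run P 𝒪 est n m α T μ) (hP : P.Regular) {B M F : ℝ}
    (hB : ∀ᵐ e ∂P.Pε, ‖e‖ ≤ B) (hM : P.BoundedBy M) (hF : ∀ x ∈ P.X, |P.f x| ≤ F) {ρ : ℝ}
    (hρ : P.τ < ρ) {t : ℕ} (ht : t ≤ T + 1) : |R.envelope ρ t| ≤ F := by
  have hρ0 : 0 ≤ ρ := hP.τ_nonneg.trans hρ.le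
  have i1 := R.integrable_f_prox hP hB hρ ht
  have i2 := (R.integrable_sq_dist_prox hP hB hM hρ ht ht).const_mul (ρ / 2)
  unfold envelope
  rw [← integral_const_mul, ← integral_add i1 i2]
  suffices h : ∀ᵐ ω ∂μ, ‖P.f (P.prox (1 / ρ) (R.z t ω))
      + ρ / 2 * ‖R.z t ω - P.prox (1 / ρ) (R.z t ω)‖ ^ 2‖ ≤ F by
    simpa using norm_integral_le_of_norm_le_const h
  filter_upwards [R.ae_z_mem ht] with ω hω
  have h1 := hP.isArgmin_prox hB R.nonempty_X (ρ := ρ) (R.z t ω)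
  have h2 := h1.2 _ hω
  simp only [sub_self, norm_zero] at h2
  rw [norm_sub_rev] at h2
  have h3 := abs_le.1 (hF _ hω)
  have h4 := abs_le.1 (hF _ h1.1)
  have h5 : 0 ≤ ρ / 2 * ‖R.z t ω - P.prox (1 / ρ) (R.z t ω)‖ ^ 2 := by positivity
  rw [Real.norm_eq_abs, abs_le]
  constructor <;> linarith

/-- The proximal point of `z t` with parameter `ρ` is a feasible competitor in the proximal problem
of `z s` with parameter `ρ'`. -/
lemma envelope_le (R : Run P 𝒪 est n m α T μ) (hP : P.Regular) {B M : ℝ}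
    (hB : ∀ᵐ e ∂P.Pε, ‖e‖ ≤ B) (hM : P.BoundedBy M) {ρ ρ' : ℝ} (hρ : P.τ < ρ) (hρ' : P.τ < ρ')
    {s t : ℕ} (hs : s ≤ T + 1) (ht : t ≤ T + 1) :
    R.envelope ρ' s ≤ ∫ ω, P.f (P.prox (1 / ρ) (R.z t ω)) ∂μ
      + ρ' / 2 * ∫ ω, ‖R.z s ω - P.prox (1 / ρ) (R.z t ω)‖ ^ 2 ∂μ := by
  have i1 := R.integrable_f_prox hP hB hρ' hs
  have i2 := (R.integrable_sq_dist_prox hP hB hM hρ' hs hs).const_mul (ρ' / 2)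
  have j1 := R.integrable_f_prox hP hB hρ ht
  have j2 := (R.integrable_sq_dist_prox hP hB hM hρ hs ht).const_mul (ρ' / 2)
  unfold envelope
  rw [← integral_const_mul, ← integral_add i1 i2, ← integral_const_mul, ← integral_add j1 j2]
  refine integral_mono (i1.add i2) (j1.add j2) fun ω => ?_
  have h := (hP.isArgmin_prox hB R.nonempty_X (ρ := ρ') (R.z s ω)).2 _
    (hP.isArgmin_prox hB R.nonempty_X (ρ := ρ) (R.z t ω)).1
  beta_reduce at h
  rw [norm_sub_rev _ (R.z s ω), norm_sub_rev _ (R.z s ω)] at h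
  exact h

/-- Descent of the expected envelope. The weight is the contraction gain `ρ_{t+1} (ρ_t - τ)/α_t`
minus the cost `ρ_{t+1} - ρ_t` of raising the proximal parameter. -/
lemma weight_mul_le {r C B M : ℝ} (R : Run P 𝒪 est n m α T μ) (hr : 0 < r)
    (hP : P.Regular) (h𝒪 : 𝒪.Valid P) (hest : est.WellPosed P 𝒪) (hbdd : est.Bounded P 𝒪 B)
    (hrate : est.Rate P 𝒪 r C) (hC : 0 ≤ C) (hM : P.BoundedBy M) {t : ℕ} (ht : t ≤ T)
    (hn : 0 < n t) (hm : 0 < m t) (hα : 0 < α t) {ρ : ℕ → ℝ} (hρ : ∀ t, P.τ < ρ t)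
    (hρα : ρ t + P.τ ≤ α t) (herr : 0 ≤ stepError P M B C r (n t) (m t) (α t)) :
    weight P.τ ρ α t / 2 * ∫ ω, ‖R.z t ω - P.prox (1 / ρ t) (R.z t ω)‖ ^ 2 ∂μ
      ≤ R.envelope (ρ t) t - R.envelope (ρ (t + 1)) (t + 1)
        + ρ (t + 1) / α t * stepError P M B C r (n t) (m t) (α t) := by
  have h1 := R.integral_sq_dist_succ_le hr hP h𝒪 hest hbdd hrate hC hM ht hn hm hα (hρ t) hρα
  have h2 := R.envelope_le hP hbdd.bdd_ε hM (hρ t) (hρ (t + 1)) (show t + 1 ≤ T + 1 by omega)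
    (show t ≤ T + 1 by omega)
  have hτ := hP.τ_nonneg
  have hρt := hρ t
  have hρ' : 0 < ρ (t + 1) := hτ.trans_lt (hρ (t + 1))
  have hD : 0 ≤ ∫ ω, ‖R.z t ω - P.prox (1 / ρ t) (R.z t ω)‖ ^ 2 ∂μ := by positivity
  unfold weight
  rw [envelope]
  set D := ∫ ω, ‖R.z t ω - P.prox (1 / ρ t) (R.z t ω)‖ ^ 2 ∂μ
  set E := stepError P M B C r (n t) (m t) (α t)
  set β := α t + ρ t - P.τ with hβ
  have hβ0 : 0 < β := by linarith
  have hβα : α t ≤ β := by linarith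
  have hβ2 : β ≤ 2 * α t := by linarith
  have hq : (α t + P.τ - ρ t) / β = 1 - 2 * ((ρ t - P.τ) / β) := by
    field_simp
    rw [hβ]; ring
  rw [hq] at h1
  -- Bounding `β` above by `2 α t` weakens the contraction factor to `1 - (ρ t - τ)/α t`, the form
  -- that appears in the weight.
  have h3 : (ρ t - P.τ) / (2 * α t) ≤ (ρ t - P.τ) / β := by
    have := sub_nonneg.2 hρt.le
    gcongr
  have h4 : 2 / β * E ≤ 2 / α t * E := by gcongr
  have h5 : ρ (t + 1) / 2 * ∫ ω, ‖R.z (t + 1) ω - P.prox (1 / ρ t) (R.z t ω)‖ ^ 2 ∂μ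
      ≤ ρ (t + 1) / 2 * ((1 - 2 * ((ρ t - P.τ) / (2 * α t))) * D + 2 / α t * E) := by
    refine mul_le_mul_of_nonneg_left (h1.trans (add_le_add ?_ h4)) (by positivity)
    gcongr
  have h6 : ρ (t + 1) / 2 * ((1 - 2 * ((ρ t - P.τ) / (2 * α t))) * D + 2 / α t * E)
      = ρ (t + 1) / 2 * D - ρ (t + 1) * (ρ t - P.τ) / α t / 2 * D + ρ (t + 1) / α t * E := by
    field_simp
  linarith

/-- The weighted sum of the expected squared distances to the proximal points. -/
lemma sum_weight_mul_le {r C B M F : ℝ} (R : Run P 𝒪 est n m α T μ) (hr : 0 < r)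
    (hP : P.Regular) (h𝒪 : 𝒪.Valid P) (hest : est.WellPosed P 𝒪) (hbdd : est.Bounded P 𝒪 B)
    (hrate : est.Rate P 𝒪 r C) (hC : 0 ≤ C) (hM : P.BoundedBy M)
    (hF : ∀ x ∈ P.X, |P.f x| ≤ F) (hn : ∀ t, 0 < n t) (hm : ∀ t, 0 < m t) (hα : ∀ t, 0 < α t)
    {ρ : ℕ → ℝ} (hρ : ∀ t, P.τ < ρ t) (hρα : ∀ t, ρ t + P.τ ≤ α t)
    (herr : ∀ t, 0 ≤ stepError P M B C r (n t) (m t) (α t)) {tbar : ℕ} (htbar : tbar ≤ T) :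
    ∑ t ∈ Finset.Icc tbar T,
        weight P.τ ρ α t * ∫ ω, ‖R.z t ω - P.prox (1 / ρ t) (R.z t ω)‖ ^ 2 ∂μ
      ≤ 2 * (2 * F + ∑ t ∈ Finset.Icc tbar T,
          ρ (t + 1) / α t * stepError P M B C r (n t) (m t) (α t)) := by
  -- The sum telescopes although the parameter changes with the index, because the envelope at `t +
  -- 1` is taken with `ρ (t + 1)`.
  have htel : ∑ t ∈ Finset.Icc tbar T, (R.envelope (ρ t) t - R.envelope (ρ (t + 1)) (t + 1))
      = R.envelope (ρ tbar) tbar - R.envelope (ρ (T + 1)) (T + 1) := by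
    rw [← Finset.Ico_add_one_right_eq_Icc]
    have h := Finset.sum_Ico_sub (fun t => R.envelope (ρ t) t) (show tbar ≤ T + 1 by omega)
    have h2 : ∑ t ∈ Finset.Ico tbar (T + 1), (R.envelope (ρ t) t - R.envelope (ρ (t + 1)) (t + 1))
        = - ∑ t ∈ Finset.Ico tbar (T + 1),
          (R.envelope (ρ (t + 1)) (t + 1) - R.envelope (ρ t) t) := by
      rw [← Finset.sum_neg_distrib]
      exact Finset.sum_congr rfl fun t _ => by ring
    rw [h2, h]
    ring
  have hsum := Finset.sum_le_sum fun t (ht : t ∈ Finset.Icc tbar T) =>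
    R.weight_mul_le hr hP h𝒪 hest hbdd hrate hC hM (Finset.mem_Icc.1 ht).2 (hn t) (hm t) (hα t)
      hρ (hρα t) (herr t)
  rw [Finset.sum_add_distrib, htel] at hsum
  have h1 := abs_le.1 (R.abs_envelope_bounds hP hbdd.bdd_ε hM hF (hρ tbar)
    (show tbar ≤ T + 1 by omega))
  have h2 := abs_le.1 (R.abs_envelope_bounds hP hbdd.bdd_ε hM hF (hρ (T + 1)) le_rfl)
  have h3 : ∑ t ∈ Finset.Icc tbar T,
        weight P.τ ρ α t * ∫ ω, ‖R.z t ω - P.prox (1 / ρ t) (R.z t ω)‖ ^ 2 ∂μ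
      = 2 * ∑ t ∈ Finset.Icc tbar T,
        weight P.τ ρ α t / 2 * ∫ ω, ‖R.z t ω - P.prox (1 / ρ t) (R.z t ω)‖ ^ 2 ∂μ := by
    rw [Finset.mul_sum]
    exact Finset.sum_congr rfl fun t _ => by ring
  rw [h3]
  linarith

end Run

/-! ### The output of the algorithm -/

lemma Estimators.Rate.mono {d l : ℕ} {P : Problem d l} {𝒪 : Oracle d} {est : Estimators d l}
    {r C C' : ℝ} (h : est.Rate P 𝒪 r C) (hC : C ≤ C') : est.Rate P 𝒪 r C' := by
  have hle : ∀ n : ℕ, ENNReal.ofReal (C * (n : ℝ) ^ (-r)) ≤ ENNReal.ofReal (C' * (n : ℝ) ^ (-r)) :=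
    fun n => ENNReal.ofReal_le_ofReal (by gcongr)
  exact ⟨fun n hn z hz => (h.mse_c n hn z hz).trans (hle n),
    fun n hn z hz => (h.mse_dc n hn z hz).trans (hle n),
    fun n hn z hz => (h.mse_Q n hn z hz).trans (hle n),
    fun j n hn z hz => (h.mse_dq j n hn z hz).trans (hle n),
    fun n hn z hz => (h.mse_Qinv n hn z hz).trans (hle n)⟩

lemma avgProb_nonneg {τ : ℝ} {ρ α : ℕ → ℝ} {tbar : ℕ} (hpos : ∀ t, tbar ≤ t → 0 < weight τ ρ α t)
    (T t : ℕ) : 0 ≤ avgProb τ ρ α tbar T t := by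
  unfold avgProb
  split_ifs with h
  · exact div_nonneg (hpos t h.1).le
      (Finset.sum_nonneg fun s hs => (hpos s (Finset.mem_Icc.1 hs).1).le)
  · exact le_rfl

namespace IsOutputIndex

variable {d : ℕ} {τ : ℝ} {ρ α : ℕ → ℝ} {tbar T : ℕ} {Ω : Type*} [MeasurableSpace Ω]
  {μ : Measure Ω} {z : ℕ → Ω → Vec d} {tstar : Ω → ℕ}

lemma ae_mem (h : IsOutputIndex τ ρ α tbar T μ z tstar) :
    ∀ᵐ ω ∂μ, tstar ω ∈ Finset.Icc tbar T := by
  have key : ∀ t, ∀ᵐ ω ∂μ, tstar ω = t → t ∈ Finset.Icc tbar T := by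
    intro t
    by_cases ht : t ∈ Finset.Icc tbar T
    · exact ae_of_all _ fun _ _ => ht
    · have h0 : μ (tstar ⁻¹' {t}) = 0 := by
        rw [h.law, avgProb, if_neg (by simpa using ht), ENNReal.ofReal_zero]
      filter_upwards [measure_eq_zero_iff_ae_notMem.1 h0] with ω hω heq
      exact absurd heq hω
  filter_upwards [ae_all_iff.2 key] with ω hω
  exact hω _ rfl

/-- Splits the expectation according to the value of the output index; independence factors each
piece into a probability and an expectation at a fixed time. -/
lemma integral_comp [IsProbabilityMeasure μ] (h : IsOutputIndex τ ρ α tbar T μ z tstar)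
    (hpos : ∀ t, tbar ≤ t → 0 < weight τ ρ α t) {H : ℕ → Vec d → ℝ} (hH : ∀ t, Measurable (H t))
    (hint : ∀ t ∈ Finset.Icc tbar T, Integrable (fun ω => H t (z t ω)) μ) :
    Integrable (fun ω => H (tstar ω) (z (tstar ω) ω)) μ ∧
      ∫ ω, H (tstar ω) (z (tstar ω) ω) ∂μ
        = ∑ t ∈ Finset.Icc tbar T, avgProb τ ρ α tbar T t * ∫ ω, H t (z t ω) ∂μ := by
  classical
  let ind : ℕ → ℕ → ℝ := fun t s => if s = t then 1 else 0
  have hind : ∀ t, Measurable fun ω => ind t (tstar ω) := fun t =>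
    (measurable_from_top (f := ind t)).comp h.meas
  have hdec : (fun ω => H (tstar ω) (z (tstar ω) ω))
      =ᵐ[μ] fun ω => ∑ t ∈ Finset.Icc tbar T, ind t (tstar ω) * H t (z t ω) := by
    filter_upwards [h.ae_mem] with ω hω
    rw [Finset.sum_eq_single_of_mem (tstar ω) hω fun t _ hne => by simp [ind, hne.symm]]
    simp [ind]
  have hi : ∀ t ∈ Finset.Icc tbar T, Integrable (fun ω => ind t (tstar ω) * H t (z t ω)) μ := by
    intro t ht
    refine (hint t ht).bdd_mul (c := 1) (hind t).aestronglyMeasurable (ae_of_all _ fun ω => ?_)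
    simp only [ind]
    split_ifs <;> simp
  refine ⟨(integrable_finsetSum _ hi).congr hdec.symm, ?_⟩
  rw [integral_congr_ae hdec, integral_finsetSum _ hi]
  refine Finset.sum_congr rfl fun t ht => ?_
  have htT : t < T + 1 := by have := (Finset.mem_Icc.1 ht).2; omega
  have hindep : IndepFun (fun ω => ind t (tstar ω)) (fun ω => H t (z t ω)) μ :=
    h.indep.comp (φ := ind t) (ψ := fun v : Fin (T + 1) → Vec d => H t (v ⟨t, htT⟩))
      measurable_from_top ((hH t).comp (measurable_pi_apply _))
  rw [hindep.integral_fun_mul_eq_mul_integral (hind t).aestronglyMeasurable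
    (hint t ht).aestronglyMeasurable]
  congr 1
  have heq : (fun ω => ind t (tstar ω)) = (tstar ⁻¹' {t}).indicator 1 := by
    funext ω
    simp [ind, Set.indicator_apply]
  rw [heq, integral_indicator_one (h.meas (measurableSet_singleton t)), measureReal_def, h.law,
    ENNReal.toReal_ofReal (avgProb_nonneg hpos T t)]

/-- The output index is almost surely at most `T`, and the parameter is nondecreasing. -/
lemma integral_power_sq_le [IsProbabilityMeasure μ] (h : IsOutputIndex τ ρ α tbar T μ z tstar)
    {p a : ℝ} (hp : 0 < p) (ha : 0 ≤ a) :
    Integrable (fun ω => power p a (tstar ω) ^ 2) μ ∧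
      ∫ ω, power p a (tstar ω) ^ 2 ∂μ ≤ power p a T ^ 2 := by
  have hm : Measurable fun ω => power p a (tstar ω) ^ 2 :=
    (measurable_from_top (f := fun t => power p a t ^ 2)).comp h.meas
  have hb : ∀ᵐ ω ∂μ, power p a (tstar ω) ^ 2 ≤ power p a T ^ 2 := by
    filter_upwards [h.ae_mem] with ω hω
    have := (power_pos (a := a) hp (tstar ω)).le
    gcongr
    exact power_mono hp.le ha (Finset.mem_Icc.1 hω).2
  have hi : Integrable (fun ω => power p a (tstar ω) ^ 2) μ := by
    refine Integrable.of_bound (C := power p a T ^ 2) hm.aestronglyMeasurable ?_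
    filter_upwards [hb] with ω hω
    rwa [Real.norm_of_nonneg (sq_nonneg _)]
  refine ⟨hi, ?_⟩
  simpa using integral_mono_ae hi (integrable_const _) hb

end IsOutputIndex

/-- The bound for the weighted sum of the expected squared distances, for polynomial
parameters. -/
lemma exists_bound_sum_weight_mul {d l : ℕ} {P : Problem d l} {𝒪 : Oracle d}
    {est : Estimators d l} {r C B : ℝ} (hr : 0 < r) (hP : P.Regular) (h𝒪 : 𝒪.Valid P)
    (hest : est.WellPosed P 𝒪) (hbdd : est.Bounded P 𝒪 B) (hrate : est.Rate P 𝒪 r C)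
    {a b ρ₀ α₀ : ℝ} (ha : 0 ≤ a) (hab : a ≤ b) (hρ₀ : P.τ < ρ₀) (hα₀ : ρ₀ + P.τ ≤ α₀)
    {m₀ n₀ : ℕ} {j k : ℝ} (hm₀ : 0 < m₀) (hn₀ : 0 < n₀) (hj : 1 + a - 2 * b < j)
    (hk : 2 * (1 + a - b) / r < k) (tbar : ℕ) :
    ∃ K : ℝ, 0 ≤ K ∧ ∀ T, tbar ≤ T →
      ∀ {Ω : Type*} [MeasurableSpace Ω] (μ : Measure Ω) [IsProbabilityMeasure μ]
        (R : Run P 𝒪 est (batchSize n₀ k) (batchSize m₀ j) (power α₀ b) T μ),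
        ∑ t ∈ Finset.Icc tbar T, weight P.τ (power ρ₀ a) (power α₀ b) t
          * ∫ ω, ‖R.z t ω - P.prox (1 / power ρ₀ a t) (R.z t ω)‖ ^ 2 ∂μ ≤ K := by
  have hτ := hP.τ_nonneg
  have hρ : 0 < ρ₀ := hτ.trans_lt hρ₀
  have hα : 0 < α₀ := by linarith
  -- The rate constant is not assumed nonnegative, so it is replaced by its positive part.
  have hrate' := hrate.mono (le_max_left C 0)
  have hC : 0 ≤ max C 0 := le_max_right _ _
  obtain ⟨M, hM⟩ := hP.exists_boundedBy
  obtain ⟨F, hF0, hF⟩ := hP.exists_abs_f_le hbdd.bdd_ε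
  obtain ⟨K₁, hK₁, hsum₁⟩ := exists_bound_sum_batch hρ hα ha hm₀ hj
  obtain ⟨K₂, hK₂, hsum₂⟩ := exists_bound_sum_estimation hρ hα ha hr hn₀ hk
  have hB0 : 0 ≤ B := by
    have := hP.prob_ε
    obtain ⟨e, he⟩ := hbdd.bdd_ε.exists
    exact (norm_nonneg _).trans he
  have hE0 : 0 ≤ estimationConst P M B (max C 0) := by
    have := Estimators.modelConst_nonneg hP hM.nonneg hB0
    unfold estimationConst
    positivity
  have hone : ∀ (e : ℝ), 0 ≤ e → ∀ t : ℕ, (1 : ℝ) ≤ ((t : ℝ) + 1) ^ e := fun e he t =>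
    Real.one_le_rpow (by have : (0 : ℝ) ≤ t := Nat.cast_nonneg t
                         linarith) he
  have hρt : ∀ t, P.τ < power ρ₀ a t := fun t => by
    have := hone a ha t
    unfold power
    nlinarith
  have hραt : ∀ t, power ρ₀ a t + P.τ ≤ power α₀ b t := fun t => by
    have h1 := hone b (ha.trans hab) t
    have h2 : ((t : ℝ) + 1) ^ a ≤ ((t : ℝ) + 1) ^ b :=
      Real.rpow_le_rpow_of_exponent_le (by have : (0 : ℝ) ≤ t := Nat.cast_nonneg t
                                           linarith) hab
    unfold power
    nlinarith
  have hαt : ∀ t, 0 < power α₀ b t := power_pos hα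
  have herr : ∀ t, 0 ≤ stepError P M B (max C 0) r (batchSize n₀ k t) (batchSize m₀ j t)
      (power α₀ b t) := fun t => by
    have := hαt t
    unfold stepError
    positivity
  -- The term `2 F` bounds the total change of the envelope; the others bound the summed sampling
  -- and estimation errors. None of them involves `T` or the run.
  refine ⟨2 * (2 * F + (2 * lipConst P M B ^ 2 * K₁ + estimationConst P M B (max C 0) * K₂)),
    by positivity, fun T hT Ω _ μ _ R => ?_⟩
  refine (R.sum_weight_mul_le hr hP h𝒪 hest hbdd hrate' hC hM hF (batchSize_pos hn₀ k)
    (batchSize_pos hm₀ j) hαt hρt hραt herr hT).trans ?_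
  gcongr
  calc _ = 2 * lipConst P M B ^ 2 * ∑ t ∈ Finset.Icc tbar T,
          power ρ₀ a (t + 1) / (batchSize m₀ j t * power α₀ b t ^ 2)
        + estimationConst P M B (max C 0) * ∑ t ∈ Finset.Icc tbar T,
          power ρ₀ a (t + 1) / ((batchSize n₀ k t : ℝ) ^ (r / 2) * power α₀ b t) := by
        rw [Finset.mul_sum, Finset.mul_sum, ← Finset.sum_add_distrib]
        refine Finset.sum_congr rfl fun t _ => ?_
        unfold stepError
        have h1 := (hαt t).ne'
        have h2 : (batchSize m₀ j t : ℝ) ≠ 0 := by exact_mod_cast (batchSize_pos hm₀ j t).ne'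
        have h3 : (batchSize n₀ k t : ℝ) ^ (r / 2) ≠ 0 :=
          (Real.rpow_pos_of_pos (by exact_mod_cast batchSize_pos hn₀ k t) _).ne'
        field_simp
    _ ≤ _ := by
        gcongr
        · exact hsum₁ tbar T
        · exact hsum₂ tbar T

end ALS

end

/-! ### Assembly of the three conclusions -/

theorem corollary2 {d l : ℕ} (P : ALS.Problem d l) (𝒪 : ALS.Oracle d) (est : ALS.Estimators d l)
    (r C B : ℝ) (hr₀ : 0 < r) (hr₁ : r ≤ 1)
    (hP : P.Regular) (h𝒪 : 𝒪.Valid P) (hest : est.WellPosed P 𝒪)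
    (hbdd : est.Bounded P 𝒪 B) (hrate : est.Rate P 𝒪 r C)
    (a b ρ₀ α₀ : ℝ) (ha : 0 ≤ a) (hab : a ≤ b) (hb : b < 1)
    (hρ₀ : P.τ < ρ₀) (hα₀ : ρ₀ + P.τ ≤ α₀) :
    (∃ tbar, ALS.StepCondition P.τ (ALS.power ρ₀ a) (ALS.power α₀ b) tbar) ∧
    ∀ tbar, ALS.StepCondition P.τ (ALS.power ρ₀ a) (ALS.power α₀ b) tbar →
    ∀ (m₀ n₀ : ℕ) (j k : ℝ), 0 < m₀ → 0 < n₀ →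
      1 + a - 2 * b < j → 2 * (1 + a - b) / r < k →
      -- `Δ(T)` is bounded from above, whatever the estimation error constant in it
      (∀ Ctilde : ℝ, 0 < Ctilde → ∃ K : ℝ, ∀ T, tbar ≤ T →
        ALS.errorBudget P r Ctilde (ALS.power ρ₀ a) (ALS.power α₀ b)
          (ALS.batchSize n₀ k) (ALS.batchSize m₀ j) tbar T ≤ K) ∧
      -- `p_t` is approximately proportional to `(t + 1)^{2a - b}`
      (∃ u : ℕ → ℝ, (∀ t, tbar ≤ t → 0 < u t) ∧ Tendsto u atTop (𝓝 1) ∧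
        ∀ T, tbar ≤ T → ∃ κ : ℝ, 0 < κ ∧ ∀ t, tbar ≤ t → t ≤ T →
          ALS.avgProb P.τ (ALS.power ρ₀ a) (ALS.power α₀ b) tbar T t
            = κ * u t * ((t : ℝ) + 1) ^ (2 * a - b)) ∧
      -- rates for the output of the algorithm
      ∃ K : ℝ, ∀ T, tbar ≤ T →
        ∀ (Ω : Type*) [MeasurableSpace Ω] (μ : Measure Ω) [IsProbabilityMeasure μ]
          (R : ALS.Run P 𝒪 est (ALS.batchSize n₀ k) (ALS.batchSize m₀ j) (ALS.power α₀ b) T μ)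
          (tstar : Ω → ℕ),
          ALS.IsOutputIndex P.τ (ALS.power ρ₀ a) (ALS.power α₀ b) tbar T μ R.z tstar →
          Integrable (fun ω => ‖R.z (tstar ω) ω
            - P.prox (1 / ALS.power ρ₀ a (tstar ω)) (R.z (tstar ω) ω)‖ ^ 2) μ ∧
          Integrable (fun ω => ALS.power ρ₀ a (tstar ω) ^ 2) μ ∧
          ∫ ω, ‖R.z (tstar ω) ω
              - P.prox (1 / ALS.power ρ₀ a (tstar ω)) (R.z (tstar ω) ω)‖ ^ 2 ∂μ
            ≤ K * (1 / ((T : ℝ) + 1) ^ (1 + 2 * a - b)) ∧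
          (∫ ω, ALS.power ρ₀ a (tstar ω) ^ 2 ∂μ) *
            (∫ ω, ‖R.z (tstar ω) ω
              - P.prox (1 / ALS.power ρ₀ a (tstar ω)) (R.z (tstar ω) ω)‖ ^ 2 ∂μ)
            ≤ K * (1 / ((T : ℝ) + 1) ^ (1 - b)) := by
  have hτ := hP.τ_nonneg
  have hρ : 0 < ρ₀ := hτ.trans_lt hρ₀
  have hα : 0 < α₀ := by linarith
  refine ⟨ALS.exists_stepCondition hρ₀ hρ hα ha hab hb,
    fun tbar htbar m₀ n₀ j k hm₀ hn₀ hj hk => ?_⟩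
  have hpos := (ALS.stepCondition_iff_weight_pos (ALS.power_pos hα) tbar).1 htbar
  refine ⟨fun Ctilde hC => ALS.exists_bound_errorBudget P hρ hα ha hr₀ hm₀ hn₀ hj hk hC tbar,
    ALS.exists_avgProb_eq hρ₀ hρ hα ha hab hb hpos, ?_⟩
  obtain ⟨K, hK, hsum⟩ := ALS.exists_bound_sum_weight_mul hr₀ hP h𝒪 hest hbdd hrate ha hab hρ₀ hα₀
    hm₀ hn₀ hj hk tbar
  obtain ⟨c, hc, hlow⟩ := ALS.exists_lower_bound_sum_weight hρ₀ hρ hα ha hab hb hpos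
  -- One constant for both rates: the first needs `K / c`, and the second needs `K / c * ρ₀ ^ 2`
  -- because it multiplies by `ρ_T²`.
  refine ⟨K / c * (1 + ρ₀ ^ 2), fun T hT Ω _ μ _ R tstar hout => ?_⟩
  have hB := hbdd.bdd_ε
  obtain ⟨M, hM⟩ := hP.exists_boundedBy
  have hρt : ∀ t, P.τ < ALS.power ρ₀ a t := fun t =>
    hρ₀.trans_le (by simpa [ALS.power] using ALS.power_mono hρ.le ha (Nat.zero_le t))
  obtain ⟨hint, heq⟩ := hout.integral_comp hpos
    (H := fun t x => ‖x - P.prox (1 / ALS.power ρ₀ a t) x‖ ^ 2)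
    (fun t => (measurable_id.sub (hP.measurable_prox hB R.nonempty_X (hρt t))).norm.pow_const 2)
    (fun t ht => by
      have htT : t ≤ T + 1 := by have := (Finset.mem_Icc.1 ht).2; omega
      exact R.integrable_sq_dist_prox hP hB hM (hρt t) htT htT)
  obtain ⟨hint', hle'⟩ := hout.integral_power_sq_le hρ ha
  have hx : (0 : ℝ) < (T : ℝ) + 1 := by positivity
  have hpow : (0 : ℝ) < ((T : ℝ) + 1) ^ (1 + 2 * a - b) := by positivity
  have hW : 0 < ∑ s ∈ Finset.Icc tbar T, ALS.weight P.τ (ALS.power ρ₀ a) (ALS.power α₀ b) s :=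
    (mul_pos hc hpow).trans_le (hlow T hT)
  have hmain : ∫ ω, ‖R.z (tstar ω) ω
      - P.prox (1 / ALS.power ρ₀ a (tstar ω)) (R.z (tstar ω) ω)‖ ^ 2 ∂μ
      ≤ K / c * (1 / ((T : ℝ) + 1) ^ (1 + 2 * a - b)) := by
    rw [heq]
    calc _ = (∑ t ∈ Finset.Icc tbar T, ALS.weight P.τ (ALS.power ρ₀ a) (ALS.power α₀ b) t
            * ∫ ω, ‖R.z t ω - P.prox (1 / ALS.power ρ₀ a t) (R.z t ω)‖ ^ 2 ∂μ)
            / ∑ s ∈ Finset.Icc tbar T, ALS.weight P.τ (ALS.power ρ₀ a) (ALS.power α₀ b) s := by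
          rw [Finset.sum_div]
          refine Finset.sum_congr rfl fun t ht => ?_
          rw [ALS.avgProb, if_pos (Finset.mem_Icc.1 ht)]
          ring
      _ ≤ K / (c * ((T : ℝ) + 1) ^ (1 + 2 * a - b)) :=
          div_le_div₀ hK (hsum T hT μ R) (by positivity) (hlow T hT)
      _ = _ := by field_simp
  have hKc : 0 ≤ K / c := by positivity
  refine ⟨hint, hint', hmain.trans ?_, ?_⟩
  · gcongr
    nlinarith [sq_nonneg ρ₀]
  · have hnn : 0 ≤ ∫ ω, ‖R.z (tstar ω) ω
        - P.prox (1 / ALS.power ρ₀ a (tstar ω)) (R.z (tstar ω) ω)‖ ^ 2 ∂μ :=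
      MeasureTheory.integral_nonneg fun _ => by positivity
    calc _ ≤ ALS.power ρ₀ a T ^ 2 * (K / c * (1 / ((T : ℝ) + 1) ^ (1 + 2 * a - b))) := by
          gcongr
      _ = K / c * ρ₀ ^ 2 * (1 / ((T : ℝ) + 1) ^ (1 - b)) := by
          -- The factor `(T+1)^{2a}` of `ρ_T²` cancels against the first rate and leaves the
          -- exponent `1 - b`.
          have h1 : ((T : ℝ) + 1) ^ (1 + 2 * a - b)
              = ((T : ℝ) + 1) ^ a * ((T : ℝ) + 1) ^ a * ((T : ℝ) + 1) ^ (1 - b) := by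
            rw [← Real.rpow_add hx, ← Real.rpow_add hx]
            congr 1
            ring
          rw [h1, ALS.power]
          have h2 := Real.rpow_pos_of_pos hx a
          have h3 := Real.rpow_pos_of_pos hx (1 - b)
          field_simp
      _ ≤ _ := by
          gcongr
          linarith
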